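/- Theorem (Quenched CLT of averaged SGD with dropout). Let $d\in\mathbb N$, $p\in(0,1)$ and $\beta^*\in\mathbb R^d$. Let $(x,\epsilon,D)$ be independent, where $x\in\mathbb R^d$ is a random vector with $\mathbb E[x_i^2]\in(0,\infty)$ for $i=1,\dots,d$, the noise $\epsilon\in\mathbb R$ satisfies $\mathbb E[\epsilon]=0$ and $\mathrm{Var}(\epsilon)=1$, and $D$ is a random $d\times d$ diagonal matrix with i.i.d. $\mathrm{Bernoulli}(p)$ diagonal entries. Put $y=x^\top\beta^*+\epsilon$ and $f_{D,(y,x)}(\beta)=\beta+\alpha Dx(y-x^\top D\beta)$. Write $A_p=pA+(1-p)\mathrm{Diag}(A)$ for a $d\times d$ matrix $A$, and $\mu_q(v)=(\mathbb E\|D\,xx^\top D\,v\|_2^q)^{1/q}\in[0,\infty]$. Suppose that $\alpha>0$ satisfies, for some real $q\ge 2$, $$\frac{\alpha(q-1)}{2}\ \sup_{v\in\mathbb R^d,\ \|v\|_2=1}\ \frac{(1+\alpha\mu_q(v))^{q-2}\,\mu_q(v)^2}{p\,v^\top\mathbb E[(xx^\top)_p]\,v}<1$$ (in particular $\mu_q(v)<\infty$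 for all unit vectors $v$). Then the following hold. (a) The risk $\beta\mapsto\mathbb E[\tfrac12(y-x^\top D\beta)^2]$ has a unique minimizer $\breve\beta$ on $\mathbb R^d$. (b) Let $\xi_k$, $k\in\mathbb Z$, be i.i.d. copies of $(D,(y,x))$. For every $k\in\mathbb Z$ and every fixed $b\in\mathbb R^d$, the limit $\breve\beta_k^\circ(\alpha)=\lim_{m\to\infty}f_{\xi_k}\circ\cdots\circ f_{\xi_{k-m}}(b)$ exists almost surely and does not depend on $b$. The recursion $\beta_k=f_{\xi_k}(\beta_{k-1})$ has a unique stationary distribution $\breve\pi_\alpha$, and $\breve\beta_k^\circ(\alpha)\sim\breve\pi_\alpha$ for all $k\in\mathbb Z$. Moreover $\mathbb E\|\breve\beta_k^\circ(\alpha)\|_2^2<\infty$, the series $$\breve\Sigma(\alpha)=\sum_{k=-\infty}^{\infty}\mathbb E\big[(\breve\beta_0^\circ(\alpha)-\breve\beta)(\breve\beta_k^\circ(\alpha)-\breve\beta)^\top\big]$$ (the long-run covariance matrix of the stationary sequence) converges absolutely, and $\breve\Sigma(\alpha)$ is positive semidefinite. (c) Let $(D_k,(y_k,x_k))$, $k=1,2,\dots$,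 be i.i.d. copies of $(D,(y,x))$, obtained from i.i.d. copies $(D_k,x_k,\epsilon_k)$ of $(D,x,\epsilon)$ by $y_k=x_k^\top\beta^*+\epsilon_k$. For any initial vector $\breve\beta_0\in\mathbb R^d$, let $\breve\beta_k(\alpha)=\breve\beta_{k-1}(\alpha)+\alpha D_kx_k(y_k-x_k^\top D_k\breve\beta_{k-1}(\alpha))$ for $k\ge1$, with $\breve\beta_0(\alpha)=\breve\beta_0$, and $\bar\beta_n^{\mathrm{sgd}}(\alpha)=\frac1n\sum_{k=1}^n\breve\beta_k(\alpha)$. Then $$\sqrt n\,\big(\bar\beta_n^{\mathrm{sgd}}(\alpha)-\breve\beta\big)\Rightarrow\mathcal N\big(0,\breve\Sigma(\alpha)\big)\qquad\text{as } n\to\infty,$$ where $\Rightarrow$ denotes convergence in distribution. -/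

import Mathlib

open MeasureTheory ProbabilityTheory Filter Topology
open scoped ENNReal Matrix

noncomputable section

namespace DropoutSGD

/-- Euclidean space `ℝ^d`. -/
abbrev Vec (d : ℕ) := EuclideanSpace ℝ (Fin d)

/-- The random input `(D, (y, x))` of one iteration. The dropout matrix `D` is stored as the vector
of its diagonal entries. -/
abbrev Sample (d : ℕ) := (Fin d → ℝ) × ℝ × Vec d

/-- The diagonal matrix with diagonal `δ`. -/
def dropMat {d : ℕ} (δ : Fin d → ℝ) : Matrix (Fin d) (Fin d) ℝ := Matrix.diagonal δ

/-- The Gram matrix `x xᵀ` of a single covariate vector. -/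
def gram {d : ℕ} (x : Vec d) : Matrix (Fin d) (Fin d) ℝ := Matrix.vecMulVec x.ofLp x.ofLp

/-- `A_p = p A + (1 - p) Diag(A)`. -/
def offDiagScale {d : ℕ} (p : ℝ) (A : Matrix (Fin d) (Fin d) ℝ) : Matrix (Fin d) (Fin d) ℝ :=
  p • A + (1 - p) • Matrix.diagonal A.diag

/-! ### The linear model with Bernoulli dropout -/

/-- The joint law of `(D, x, ε)`: the diagonal entries of `D` are i.i.d. Bernoulli(`p`), `x` has law
`covLaw`, `ε` has law `noiseLaw`, and `D`, `x`, `ε` are independent. -/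
def inputLaw {d : ℕ} (p : unitInterval) (covLaw : Measure (Vec d)) (noiseLaw : Measure ℝ) :
    Measure ((Fin d → ℝ) × Vec d × ℝ) :=
  (Measure.pi fun _ : Fin d => bernoulliMeasure (1 : ℝ) 0 p).prod (covLaw.prod noiseLaw)

/-- The joint law of `(D, (y, x))` with `y = xᵀ β* + ε`. -/
def sampleLaw {d : ℕ} (p : unitInterval) (covLaw : Measure (Vec d)) (noiseLaw : Measure ℝ)
    (bstar : Vec d) : Measure (Sample d) :=
  (inputLaw p covLaw noiseLaw).map fun s => (s.1, inner ℝ s.2.1 bstar + s.2.2, s.2.1)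

/-- The `ℓ²`-regularized least-squares risk `E[(y - xᵀ D β)² / 2]`. -/
def risk {d : ℕ} (μ : Measure (Sample d)) (b : Vec d) : ℝ :=
  ∫ s, (1 / 2 : ℝ) * (s.2.1 - inner ℝ s.2.2 (Matrix.toEuclideanLin (dropMat s.1) b)) ^ 2 ∂μ

/-! ### The SGD recursion with dropout -/

/-- One step `β ↦ β + α D x (y - xᵀ D β)`. -/
def step {d : ℕ} (α : ℝ) (s : Sample d) (b : Vec d) : Vec d :=
  b + (α * (s.2.1 - inner ℝ s.2.2 (Matrix.toEuclideanLin (dropMat s.1) b))) •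
    Matrix.toEuclideanLin (dropMat s.1) s.2.2

/-- The iterates started at `b₀`. The inputs of iterations `1, 2, …` are the entries `ξ 0, ξ 1, …`
of the sequence `ξ`. -/
def sgd {d : ℕ} (α : ℝ) (ξ : ℕ → Sample d) (b₀ : Vec d) : ℕ → Vec d
  | 0 => b₀
  | k + 1 => step α (ξ k) (sgd α ξ b₀ k)

/-- The average of the iterates number `1, …, n`. -/
def avgSgd {d : ℕ} (α : ℝ) (ξ : ℕ → Sample d) (b₀ : Vec d) (n : ℕ) : Vec d :=
  (n : ℝ)⁻¹ • ∑ k ∈ Finset.Icc 1 n, sgd α ξ b₀ k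

/-! ### The learning-rate condition -/

/-- `μ_q(v) = (E ‖D x xᵀ D v‖^q)^(1/q)`, with values in `[0, ∞]`. -/
def mom {d : ℕ} (μ : Measure (Sample d)) (q : ℝ) (v : Vec d) : ℝ≥0∞ :=
  eLpNorm (fun s : Sample d =>
    Matrix.toEuclideanLin (dropMat s.1 * gram s.2.2 * dropMat s.1) v) (ENNReal.ofReal q) μ

/-- `E[(x xᵀ)_p]`. -/
def meanGram {d : ℕ} (p : ℝ) (covLaw : Measure (Vec d)) : Matrix (Fin d) (Fin d) ℝ :=
  Matrix.of fun i j => ∫ x, offDiagScale p (gram x) i j ∂covLaw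

/-- The condition
`α (q - 1) / 2 * sup_{‖v‖ = 1} (1 + α μ_q(v))^(q - 2) μ_q(v)² / (p vᵀ E[(x xᵀ)_p] v) < 1`,
evaluated in `[0, ∞]`; in particular it fails if `μ_q(v) = ∞` for some unit vector `v`. -/
def LearningRateCond {d : ℕ} (p : unitInterval) (covLaw : Measure (Vec d)) (noiseLaw : Measure ℝ)
    (bstar : Vec d) (q α : ℝ) : Prop :=
  ENNReal.ofReal (α * (q - 1) / 2) *
    (⨆ (v : Vec d) (_ : ‖v‖ = 1),
      (1 + ENNReal.ofReal α * mom (sampleLaw p covLaw noiseLaw bstar) q v) ^ (q - 2) *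
        mom (sampleLaw p covLaw noiseLaw bstar) q v ^ 2 /
          ENNReal.ofReal ((p : ℝ) * (v.ofLp ⬝ᵥ (meanGram p covLaw *ᵥ v.ofLp)))) < 1

/-! ### The stationary sequence and its long-run covariance -/

/-- The law of a two-sided i.i.d. sequence of inputs `(ξ_k)`, `k ∈ ℤ`. -/
def twoSided {d : ℕ} (μ : Measure (Sample d)) : Measure (ℤ → Sample d) :=
  Measure.infinitePi fun _ : ℤ => μ

/-- The backward iterates `f_{ξ_k} ∘ ⋯ ∘ f_{ξ_{k-m}} (b)`. -/
def backward {d : ℕ} (α : ℝ) (ξ : ℤ → Sample d) (k : ℤ) : ℕ → Vec d → Vec d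
  | 0, b => step α (ξ k) b
  | m + 1, b => backward α ξ k m (step α (ξ (k - ((m : ℤ) + 1))) b)

/-- The stationary sequence `β°_k = lim_{m → ∞} f_{ξ_k} ∘ ⋯ ∘ f_{ξ_{k-m}} (b)`, taken at `b = 0`. -/
def stat {d : ℕ} (α : ℝ) (k : ℤ) (ξ : ℤ → Sample d) : Vec d :=
  limUnder atTop fun m : ℕ => backward α ξ k m 0

/-- `π` is a stationary distribution of the recursion: if `β ∼ π` is independent of the input
`ξ ∼ μ`, then `f_ξ(β) ∼ π`. -/
def IsStationary {d : ℕ} (α : ℝ) (μ : Measure (Sample d)) (π : Measure (Vec d)) : Prop :=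
  (π.prod μ).map (fun z => step α z.2 z.1) = π

/-- The matrix `E[(β°_0 - b) (β°_k - b)ᵀ]`. -/
def autocov {d : ℕ} (α : ℝ) (μ : Measure (Sample d)) (b : Vec d) (k : ℤ) :
    Matrix (Fin d) (Fin d) ℝ :=
  Matrix.of fun i j => ∫ ξ, (stat α 0 ξ i - b i) * (stat α k ξ j - b j) ∂(twoSided μ)

/-- The long-run covariance matrix `∑_{k ∈ ℤ} E[(β°_0 - b) (β°_k - b)ᵀ]`. -/
def longRunCov {d : ℕ} (α : ℝ) (μ : Measure (Sample d)) (b : Vec d) : Matrix (Fin d) (Fin d) ℝ :=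
  ∑' k : ℤ, autocov α μ b k

end DropoutSGD

end

open MeasureTheory ProbabilityTheory Filter Topology
open scoped ENNReal Matrix NNReal

namespace DropoutSGD

/-! ### A central limit theorem for stationary martingale differences -/

/-! Write u = Dx. One step is an affine map whose linear part v ↦ v − α⟨u,v⟩u satisfies E‖v −
α⟨u,v⟩u‖² = ‖v‖² − 2α E⟨u,v⟩² + α² E‖⟨u,v⟩u‖². Since q ≥ 2, the learning-rate condition implies its
version for q = 2, which bounds the last term by 2αc E⟨u,v⟩² with c < 1
(`LearningRateCond.exists_lt_one`). Dropout makes E[uuᵀ] positive definite even when E[xxᵀ] is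
singular (`le_integral_inner_feature_sq`). Hence the random maps contract in mean square by a factor
r < 1 (`isContracting_of_moments`). The same positivity makes the normal equations E[(y − ⟨u,b⟩)u] =
0 solvable. Their solution b is the unique minimizer of the risk and also the fixed point of the
mean step.

Contraction yields the stationary sequence: backward iterates have geometrically small increments in
L², so they converge almost surely to a limit that forgets the start
(`IsContracting.ae_tendsto_backward`). A stationary law integrated against the backward iterates
does not change, so it must be the law of that limit.

The central limit theorem follows Gordin's martingale approximation. Put Z_k = β°_k − b and A = I −
αE[uuᵀ], so that A Z_k is the mean of Z_{k+1} given the past, and M_k = ⟨s, Z_{k+1} − A Z_k⟩ is a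
martingale difference. Given a direction t, solve t = s − As. Then the sum of the ⟨t, Z_{k+1}⟩ is
the sum of the M_k plus two boundary terms, and replacing the stationary sequence by the iterates
from an arbitrary start costs a geometric series. The total error is bounded in L¹ uniformly in n
(`IsContracting.exists_integral_abs_sub_sum_martDiff_le`) and vanishes after division by √n. The
martingale is handled by a recursion for characteristic functions
(`tendsto_integral_cexp_of_martingale`), where the squares M_k² decorrelate from the past because
restarting the recursion at b makes them independent of it up to a geometric error. The covariance
series in direction t telescopes to E M_0² (`IsContracting.hasSum_crossCov_self`), which identifies
the limiting variance and shows that the long-run covariance is positive semidefinite.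

Conditional expectations never appear: the next input and any function of the past have a product
law (`hasLaw_prodMk_eval`), and Fubini does the conditioning. -/

/-- The cubic Taylor remainder serves for |x| ≤ 1 and the triangle inequality for |x| ≥ 1. The
minimum keeps the bound integrable under a second moment alone while still gaining a small factor,
as in Lindeberg's argument. -/
lemma norm_cexp_taylor_two_le (x : ℝ) :
    ‖Complex.exp (x * Complex.I) - 1 - x * Complex.I + (x : ℂ) ^ 2 / 2‖
      ≤ 4 * (x ^ 2 * min |x| 1) := by
  rcases le_total |x| 1 with h | h
  · rw [min_eq_left h]
    have h1 : ‖(x : ℂ) * Complex.I‖ ≤ 1 := by simpa using h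
    have h2 := Complex.exp_bound h1 (n := 3) (by norm_num)
    have h3 : Complex.exp (x * Complex.I) - 1 - x * Complex.I + (x : ℂ) ^ 2 / 2
        = Complex.exp (x * Complex.I) -
          ∑ m ∈ Finset.range 3, ((x : ℂ) * Complex.I) ^ m / (m.factorial : ℂ) := by
      simp [Finset.sum_range_succ, mul_pow, Nat.factorial]
      ring
    rw [h3]
    refine h2.trans ?_
    have h4 : ‖(x : ℂ) * Complex.I‖ = |x| := by simp
    rw [h4, show x ^ 2 * |x| = |x| ^ 3 by rw [← sq_abs]; ring]
    have : 0 ≤ |x| ^ 3 := by positivity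
    norm_num [Nat.factorial]
    linarith
  · rw [min_eq_right h]
    have h1 : ‖Complex.exp (x * Complex.I)‖ = 1 := Complex.norm_exp_ofReal_mul_I x
    have h2 : ‖(x : ℂ) * Complex.I‖ = |x| := by simp
    have h3 : ‖(x : ℂ) ^ 2 / 2‖ = |x| ^ 2 / 2 := by simp
    have h4 : |x| ≤ |x| ^ 2 := by nlinarith
    calc _ ≤ ‖Complex.exp (x * Complex.I) - 1 - x * Complex.I‖ + ‖(x : ℂ) ^ 2 / 2‖ :=
          norm_add_le _ _
      _ ≤ ‖Complex.exp (x * Complex.I)‖ + ‖(1 : ℂ)‖ + ‖(x : ℂ) * Complex.I‖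
          + ‖(x : ℂ) ^ 2 / 2‖ := by
          gcongr
          exact (norm_sub_le _ _).trans (by gcongr; exact norm_sub_le _ _)
      _ ≤ _ := by rw [h1, h2, h3, norm_one, ← sq_abs x]; nlinarith

lemma norm_cexp_sub_cexp_le (x y : ℝ) :
    ‖Complex.exp (x * Complex.I) - Complex.exp (y * Complex.I)‖ ≤ |x - y| := by
  have h : Complex.exp (x * Complex.I) - Complex.exp (y * Complex.I)
      = Complex.exp (y * Complex.I) * (Complex.exp (Complex.I * ((x - y : ℝ) : ℂ)) - 1) := by
    rw [mul_sub, ← Complex.exp_add, mul_one]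
    congr 2
    push_cast; ring
  rw [h, norm_mul, Complex.norm_exp_ofReal_mul_I, one_mul]
  exact Real.norm_exp_I_mul_ofReal_sub_one_le

/-- A discrete Grönwall estimate: later multiplications by c do not enlarge earlier errors, so the
one-step errors simply add up. -/
lemma norm_sub_pow_mul_le_sum {φ : ℕ → ℂ} {c : ℂ} {β : ℕ → ℝ} (hc : ‖c‖ ≤ 1)
    (h : ∀ k, ‖φ (k + 1) - c * φ k‖ ≤ β k) (n : ℕ) :
    ‖φ n - c ^ n * φ 0‖ ≤ ∑ k ∈ Finset.range n, β k := by
  induction n with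
  | zero => simp
  | succ n ih =>
    rw [Finset.sum_range_succ]
    have : φ (n + 1) - c ^ (n + 1) * φ 0
        = c * (φ n - c ^ n * φ 0) + (φ (n + 1) - c * φ n) := by ring
    rw [this]
    refine (norm_add_le _ _).trans (add_le_add ?_ (h n))
    rw [norm_mul]
    exact (mul_le_of_le_one_left (norm_nonneg _) hc).trans ih

/-! ### Truncation, Lindeberg's condition and the characteristic function recursion -/

variable {Ω : Type*} [MeasurableSpace Ω] {P : Measure Ω}

lemma tendsto_integral_posPart_sub {W : Ω → ℝ} (hW : Integrable W P) :
    Tendsto (fun K : ℕ => ∫ ω, max (W ω - K) 0 ∂P) atTop (𝓝 0) := by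
  suffices h : Tendsto (fun K : ℕ => ∫ ω, max (W ω - K) 0 ∂P) atTop (𝓝 (∫ _ : Ω, (0 : ℝ) ∂P)) by
    rwa [integral_zero] at h
  refine tendsto_integral_of_dominated_convergence (fun ω => |W ω|) (fun K => ?_) hW.abs
    (fun K => ?_) ?_
  · exact ((hW.aestronglyMeasurable.aemeasurable.sub_const _).max
      aemeasurable_const).aestronglyMeasurable
  · refine ae_of_all _ fun ω => ?_
    rw [Real.norm_of_nonneg (le_max_right _ _)]
    refine max_le ?_ (abs_nonneg _)
    have := le_abs_self (W ω)
    have : (0 : ℝ) ≤ K := by positivity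
    linarith
  · refine ae_of_all _ fun ω => ?_
    obtain ⟨N, hN⟩ := exists_nat_ge (W ω)
    refine tendsto_const_nhds.congr' ?_
    filter_upwards [eventually_ge_atTop N] with K hK
    have : (N : ℝ) ≤ K := by exact_mod_cast hK
    rw [max_eq_right]; linarith

/-- Lindeberg's condition for identically distributed terms, by domination with X². -/
lemma tendsto_integral_sq_mul_min {X : Ω → ℝ} (hX : MemLp X 2 P) {a : ℕ → ℝ}
    (ha : Tendsto a atTop (𝓝 0)) :
    Tendsto (fun n : ℕ => ∫ ω, X ω ^ 2 * min |a n * X ω| 1 ∂P) atTop (𝓝 0) := by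
  suffices h : Tendsto (fun n : ℕ => ∫ ω, X ω ^ 2 * min |a n * X ω| 1 ∂P) atTop
      (𝓝 (∫ _ : Ω, (0 : ℝ) ∂P)) by rwa [integral_zero] at h
  have hm := hX.aestronglyMeasurable.aemeasurable
  refine tendsto_integral_of_dominated_convergence (fun ω => X ω ^ 2) (fun K => ?_)
    hX.integrable_sq (fun K => ?_) ?_
  · exact ((hm.pow_const 2).mul ((hm.const_mul _).abs.min
      aemeasurable_const)).aestronglyMeasurable
  · refine ae_of_all _ fun ω => ?_
    have h1 : 0 ≤ min |a K * X ω| 1 := le_min (abs_nonneg _) zero_le_one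
    rw [Real.norm_of_nonneg (by positivity)]
    exact mul_le_of_le_one_right (sq_nonneg _) (min_le_right _ _)
  · refine ae_of_all _ fun ω => ?_
    have h1 : Tendsto (fun n => |a n * X ω|) atTop (𝓝 0) := by
      simpa using (ha.mul_const (X ω)).abs
    have h2 : Tendsto (fun n => min |a n * X ω| 1) atTop (𝓝 0) := by
      simpa using h1.min (tendsto_const_nhds (x := (1 : ℝ)))
    simpa using h2.const_mul (X ω ^ 2)

lemma integrable_cexp_mul [IsFiniteMeasure P] {S : Ω → ℝ} {g : Ω → ℂ} (hS : AEMeasurable S P)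
    (hg : Integrable g P) : Integrable (fun ω => Complex.exp (S ω * Complex.I) * g ω) P := by
  refine hg.bdd_mul (c := 1) ?_ (ae_of_all _ fun ω => (Complex.norm_exp_ofReal_mul_I _).le)
  exact (Complex.measurable_exp.comp_aemeasurable
    ((Complex.measurable_ofReal.comp_aemeasurable hS).mul_const _)).aestronglyMeasurable

lemma norm_integral_cexp_mul_le [IsFiniteMeasure P] {S : Ω → ℝ} {g : Ω → ℂ}
    {h : Ω → ℝ} (hh : Integrable h P)
    (hgh : ∀ ω, ‖g ω‖ ≤ h ω) : ‖∫ ω, Complex.exp (S ω * Complex.I) * g ω ∂P‖ ≤ ∫ ω, h ω ∂P := by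
  refine norm_integral_le_of_norm_le hh (ae_of_all _ fun ω => ?_)
  rw [norm_mul, Complex.norm_exp_ofReal_mul_I, one_mul]
  exact hgh ω

/-- One step of the characteristic function recursion for a martingale. -/
lemma norm_charFun_martingale_step_le [IsProbabilityMeasure P] {S X : Ω → ℝ} (hS : AEMeasurable S P)
    (hX : MemLp X 2 P) (a v : ℝ)
    (hmart : ∫ ω, Complex.exp ((a * S ω : ℝ) * Complex.I) * (X ω : ℂ) ∂P = 0) :
    ‖∫ ω, Complex.exp ((a * (S ω + X ω) : ℝ) * Complex.I) ∂P
        - (1 - v * a ^ 2 / 2 : ℝ) * ∫ ω, Complex.exp ((a * S ω : ℝ) * Complex.I) ∂P‖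
      ≤ 4 * a ^ 2 * ∫ ω, X ω ^ 2 * min |a * X ω| 1 ∂P
        + a ^ 2 / 2 * ‖∫ ω, Complex.exp ((a * S ω : ℝ) * Complex.I)
            * ((X ω ^ 2 - v : ℝ) : ℂ) ∂P‖ := by
  have haS : AEMeasurable (fun ω => a * S ω) P := hS.const_mul a
  have hm := hX.aestronglyMeasurable.aemeasurable
  have hX1 : Integrable X P := hX.integrable one_le_two
  have hXsq := hX.integrable_sq
  have hi1 : Integrable (fun ω => Complex.exp ((a * S ω : ℝ) * Complex.I) * (X ω : ℂ)) P :=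
    integrable_cexp_mul haS (hX1.ofReal (𝕜 := ℂ))
  have hi2 : Integrable (fun ω => Complex.exp ((a * S ω : ℝ) * Complex.I)
      * ((X ω ^ 2 - v : ℝ) : ℂ)) P :=
    integrable_cexp_mul haS ((hXsq.sub (integrable_const v)).ofReal (𝕜 := ℂ))
  have hi0 := integrable_cexp_mul haS (integrable_const (1 : ℂ))
  simp only [mul_one] at hi0
  have hb : Integrable (fun ω => 4 * a ^ 2 * (X ω ^ 2 * min |a * X ω| 1)) P := by
    refine Integrable.const_mul ?_ _
    refine Integrable.mono' hXsq ((hm.pow_const 2).mul ((hm.const_mul _).abs.min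
      aemeasurable_const)).aestronglyMeasurable (ae_of_all _ fun ω => ?_)
    have h1 : 0 ≤ min |a * X ω| 1 := le_min (abs_nonneg _) zero_le_one
    rw [Real.norm_of_nonneg (by positivity)]
    exact mul_le_of_le_one_right (sq_nonneg _) (min_le_right _ _)
  set R : Ω → ℂ := fun ω => Complex.exp ((a * X ω : ℝ) * Complex.I) - 1
    - (a * X ω : ℝ) * Complex.I + ((a * X ω : ℝ) : ℂ) ^ 2 / 2 with hR
  have hRm : AEStronglyMeasurable R P := by
    have h1 : AEMeasurable (fun ω => ((a * X ω : ℝ) : ℂ)) P :=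
      Complex.measurable_ofReal.comp_aemeasurable (hm.const_mul a)
    exact ((((Complex.measurable_exp.comp_aemeasurable (h1.mul_const _)).sub_const 1).sub
      (h1.mul_const _)).add ((h1.pow_const 2).div_const 2)).aestronglyMeasurable
  have hRb : ∀ ω, ‖R ω‖ ≤ 4 * a ^ 2 * (X ω ^ 2 * min |a * X ω| 1) := fun ω => by
    refine (norm_cexp_taylor_two_le (a * X ω)).trans (le_of_eq ?_)
    ring
  have hRi : Integrable R P := hb.mono' hRm (ae_of_all _ hRb)
  have hi3 := integrable_cexp_mul haS hRi
  -- Expand exp(iaX) to second order and split X² = v + (X² − v): the v part joins the leading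
  -- coefficient, the linear term dies by `hmart`, and the centred square is kept for the mixing
  -- estimate.
  have hpt : ∀ ω, Complex.exp ((a * (S ω + X ω) : ℝ) * Complex.I)
      = (1 - v * a ^ 2 / 2 : ℝ) * Complex.exp ((a * S ω : ℝ) * Complex.I)
        + (a * Complex.I) * (Complex.exp ((a * S ω : ℝ) * Complex.I) * (X ω : ℂ))
        - (a ^ 2 / 2) * (Complex.exp ((a * S ω : ℝ) * Complex.I) * ((X ω ^ 2 - v : ℝ) : ℂ))
        + Complex.exp ((a * S ω : ℝ) * Complex.I) * R ω := fun ω => by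
    have : Complex.exp ((a * (S ω + X ω) : ℝ) * Complex.I)
      = Complex.exp ((a * S ω : ℝ) * Complex.I) * Complex.exp ((a * X ω : ℝ) * Complex.I) := by
      rw [← Complex.exp_add]; congr 1; push_cast; ring
    rw [this, hR]
    push_cast
    ring
  have hint : ∫ ω, Complex.exp ((a * (S ω + X ω) : ℝ) * Complex.I) ∂P
      - (1 - v * a ^ 2 / 2 : ℝ) * ∫ ω, Complex.exp ((a * S ω : ℝ) * Complex.I) ∂P
      = ∫ ω, Complex.exp ((a * S ω : ℝ) * Complex.I) * R ω ∂P
        - (a ^ 2 / 2) * ∫ ω, Complex.exp ((a * S ω : ℝ) * Complex.I)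
            * ((X ω ^ 2 - v : ℝ) : ℂ) ∂P := by
    simp_rw [hpt]
    have hA : Integrable (fun ω =>
        ((1 - v * a ^ 2 / 2 : ℝ) : ℂ) * Complex.exp ((a * S ω : ℝ) * Complex.I)
        + (a * Complex.I) * (Complex.exp ((a * S ω : ℝ) * Complex.I) * (X ω : ℂ))) P :=
      (hi0.const_mul _).add (hi1.const_mul _)
    have hB : Integrable (fun ω =>
        ((1 - v * a ^ 2 / 2 : ℝ) : ℂ) * Complex.exp ((a * S ω : ℝ) * Complex.I)
        + (a * Complex.I) * (Complex.exp ((a * S ω : ℝ) * Complex.I) * (X ω : ℂ))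
        - (a ^ 2 / 2) * (Complex.exp ((a * S ω : ℝ) * Complex.I) * ((X ω ^ 2 - v : ℝ) : ℂ))) P :=
      hA.sub (hi2.const_mul _)
    rw [integral_add hB hi3, integral_sub hA (hi2.const_mul _),
      integral_add (hi0.const_mul _) (hi1.const_mul _), integral_const_mul, integral_const_mul,
      integral_const_mul, hmart]
    ring
  rw [hint]
  refine (norm_sub_le _ _).trans (add_le_add ?_ (le_of_eq ?_))
  · rw [← integral_const_mul]
    exact norm_integral_cexp_mul_le hb hRb
  · rw [norm_mul]
    congr 1
    rw [show ((a : ℂ) ^ 2 / 2) = ((a ^ 2 / 2 : ℝ) : ℂ) by push_cast; rfl, Complex.norm_real,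
      Real.norm_of_nonneg (by positivity)]

/-- Replacing `S` by `S + T` in the phase costs little if `a T` is small. -/
lemma norm_integral_cexp_add_mul_le [IsProbabilityMeasure P] {S T W : Ω → ℝ} (hS : AEMeasurable S P)
    (hT : Integrable T P) (hW : Integrable W P) (a K : ℝ) (hK : 0 ≤ K) :
    ‖∫ ω, Complex.exp ((a * (S ω + T ω) : ℝ) * Complex.I) * (W ω : ℂ) ∂P‖
      ≤ ‖∫ ω, Complex.exp ((a * S ω : ℝ) * Complex.I) * (W ω : ℂ) ∂P‖
        + (|a| * K * ∫ ω, |T ω| ∂P + 2 * ∫ ω, max (|W ω| - K) 0 ∂P) := by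
  have hTm := hT.aestronglyMeasurable.aemeasurable
  have hi1 := integrable_cexp_mul ((hS.add hTm).const_mul a) (hW.ofReal (𝕜 := ℂ))
  have hi2 := integrable_cexp_mul (hS.const_mul a) (hW.ofReal (𝕜 := ℂ))
  have hpos : Integrable (fun ω => max (|W ω| - K) 0) P :=
    (hW.abs.sub (integrable_const K)).pos_part
  have hb : Integrable (fun ω => |a| * K * |T ω| + 2 * max (|W ω| - K) 0) P :=
    (hT.abs.const_mul _).add (hpos.const_mul 2)
  have h1 : ∫ ω, Complex.exp ((a * (S ω + T ω) : ℝ) * Complex.I) * (W ω : ℂ) ∂P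
      = ∫ ω, Complex.exp ((a * S ω : ℝ) * Complex.I) * (W ω : ℂ) ∂P
        + ∫ ω, (Complex.exp ((a * (S ω + T ω) : ℝ) * Complex.I) * (W ω : ℂ)
          - Complex.exp ((a * S ω : ℝ) * Complex.I) * (W ω : ℂ)) ∂P := by
    rw [integral_sub]
    · ring
    · exact hi1
    · exact hi2
  rw [h1]
  refine (norm_add_le _ _).trans (add_le_add le_rfl ?_)
  rw [← integral_const_mul, ← integral_const_mul, ← integral_add (hT.abs.const_mul _)
    (hpos.const_mul 2)]
  refine norm_integral_le_of_norm_le hb (ae_of_all _ fun ω => ?_)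
  rw [← sub_mul, norm_mul, Complex.norm_real, Real.norm_eq_abs]
  set D := ‖Complex.exp ((a * (S ω + T ω) : ℝ) * Complex.I)
    - Complex.exp ((a * S ω : ℝ) * Complex.I)‖ with hD
  have hD1 : D ≤ |a| * |T ω| := by
    refine (norm_cexp_sub_cexp_le _ _).trans (le_of_eq ?_)
    rw [← abs_mul]; congr 1; ring
  have hD2 : D ≤ 2 := by
    refine (norm_sub_le _ _).trans ?_
    rw [Complex.norm_exp_ofReal_mul_I, Complex.norm_exp_ofReal_mul_I]; norm_num
  have hD0 : 0 ≤ D := norm_nonneg _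
  -- Below the level K the Lipschitz bound on the phase is used; above it only the trivial bound 2,
  -- so that no joint moment of T and W is needed.
  have hW1 : |W ω| ≤ K + max (|W ω| - K) 0 := by
    have := le_max_left (|W ω| - K) 0; linarith
  calc D * |W ω| ≤ D * (K + max (|W ω| - K) 0) := by gcongr
    _ = D * K + D * max (|W ω| - K) 0 := by ring
    _ ≤ (|a| * |T ω|) * K + 2 * max (|W ω| - K) 0 := by
        gcongr
    _ = _ := by ring

/-- Central limit theorem for identically distributed martingale differences whose conditional
second moments mix, at the level of characteristic functions. -/
theorem tendsto_integral_cexp_of_martingale [IsProbabilityMeasure P] {X : ℕ → Ω → ℝ} {v : ℝ}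
    (hX : MemLp (X 0) 2 P) (hident : ∀ k, IdentDistrib (X k) (X 0) P P)
    (hv : ∫ ω, X 0 ω ^ 2 ∂P = v)
    (hmart : ∀ k (a : ℝ), ∫ ω, Complex.exp ((a * ∑ j ∈ Finset.range k, X j ω : ℝ) * Complex.I)
      * (X k ω : ℂ) ∂P = 0)
    (hmix : ∀ η > 0, ∃ m : ℕ, ∀ k (a : ℝ),
      ‖∫ ω, Complex.exp ((a * ∑ j ∈ Finset.range k, X j ω : ℝ) * Complex.I)
        * ((X (k + m) ω ^ 2 - v : ℝ) : ℂ) ∂P‖ ≤ η) :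
    Tendsto (fun n : ℕ => ∫ ω, Complex.exp
      (((√(n : ℝ))⁻¹ * ∑ j ∈ Finset.range n, X j ω : ℝ) * Complex.I) ∂P) atTop
      (𝓝 (Complex.exp (-(v : ℂ) / 2))) := by
  have hXk : ∀ k, MemLp (X k) 2 P := fun k => (hident k).memLp_iff.2 hX
  have hXi : ∀ k, Integrable (X k) P := fun k => (hXk k).integrable one_le_two
  have hXm : ∀ k, AEMeasurable (X k) P := fun k => (hident k).aemeasurable_fst
  have hSm : ∀ k, AEMeasurable (fun ω => ∑ j ∈ Finset.range k, X j ω) P := fun k =>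
    Finset.aemeasurable_fun_sum _ fun j _ => hXm j
  have hv0 : 0 ≤ v := hv ▸ integral_nonneg fun ω => sq_nonneg _
  have hW : ∀ k, Integrable (fun ω => X k ω ^ 2 - v) P := fun k =>
    (hXk k).integrable_sq.sub (integrable_const v)
  set ψ : ℝ → ℝ := fun a => ∫ ω, X 0 ω ^ 2 * min |a * X 0 ω| 1 ∂P with hψ
  have hψk : ∀ k a, ∫ ω, X k ω ^ 2 * min |a * X k ω| 1 ∂P = ψ a := fun k a =>
    ((hident k).comp (u := fun x => x ^ 2 * min |a * x| 1) (by fun_prop)).integral_eq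
  set κ : ℝ → ℝ := fun K => ∫ ω, max (|X 0 ω ^ 2 - v| - K) 0 ∂P with hκ
  have hκk : ∀ k K, ∫ ω, max (|X k ω ^ 2 - v| - K) 0 ∂P = κ K := fun k K =>
    ((hident k).comp (u := fun x => max (|x ^ 2 - v| - K) 0) (by fun_prop)).integral_eq
  have hψ0 : ∀ a, 0 ≤ ψ a := fun a => integral_nonneg fun ω =>
    mul_nonneg (sq_nonneg _) (le_min (abs_nonneg _) zero_le_one)
  set ν : ℝ := ∫ ω, |X 0 ω| ∂P with hν
  have hν0 : 0 ≤ ν := integral_nonneg fun ω => abs_nonneg _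
  have hνk : ∀ k, ∫ ω, |X k ω| ∂P = ν := fun k =>
    ((hident k).comp (u := fun x => |x|) (by fun_prop)).integral_eq
  have hWk : ∀ k, ∫ ω, |X k ω ^ 2 - v| ∂P ≤ 2 * v := fun k => by
    have h1 : ∫ ω, X k ω ^ 2 ∂P = v := by
      rw [← hv]; exact ((hident k).comp (u := fun x => x ^ 2) (by fun_prop)).integral_eq
    calc _ ≤ ∫ ω, (X k ω ^ 2 + v) ∂P := by
          refine integral_mono (hW k).abs ((hXk k).integrable_sq.add (integrable_const v)) ?_
          intro ω
          refine (abs_sub _ _).trans ?_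
          simp [abs_of_nonneg hv0]
      _ = 2 * v := by
          rw [integral_add (hXk k).integrable_sq (integrable_const v), h1]; simp; ring
  -- the bound for fixed truncation levels
  have hbound : ∀ (η : ℝ) (m : ℕ) (K : ℝ), 0 ≤ η → 0 ≤ K →
      (∀ k (a : ℝ), ‖∫ ω, Complex.exp ((a * ∑ j ∈ Finset.range k, X j ω : ℝ) * Complex.I)
        * ((X (k + m) ω ^ 2 - v : ℝ) : ℂ) ∂P‖ ≤ η) →
      ∀ (a : ℝ) (n : ℕ), |1 - v * a ^ 2 / 2| ≤ 1 →
      ‖∫ ω, Complex.exp ((a * ∑ j ∈ Finset.range n, X j ω : ℝ) * Complex.I) ∂P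
        - ((1 - v * a ^ 2 / 2 : ℝ) : ℂ) ^ n‖
      ≤ n * (4 * a ^ 2 * ψ a + a ^ 2 / 2 * (η + (|a| * K * (m * ν) + 2 * κ K)))
        + m * (a ^ 2 * v) := by
    intro η m K hη hK hm a n ha
    have hκ0 : 0 ≤ κ K := integral_nonneg fun ω => le_max_right _ _
    -- The first m steps have no past at distance m; they are charged the crude a² v, which comes
    -- from a²/2 times E|X² − v| ≤ 2v.
    set β : ℕ → ℝ := fun k => (4 * a ^ 2 * ψ a
      + a ^ 2 / 2 * (η + (|a| * K * (m * ν) + 2 * κ K))) + if k < m then a ^ 2 * v else 0 with hβ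
    have key := norm_sub_pow_mul_le_sum
      (φ := fun k => ∫ ω, Complex.exp ((a * ∑ j ∈ Finset.range k, X j ω : ℝ) * Complex.I) ∂P)
      (c := ((1 - v * a ^ 2 / 2 : ℝ) : ℂ)) (β := β) (by rw [Complex.norm_real]; exact ha) (fun k => by
        have h1 := norm_charFun_martingale_step_le (hSm k) (hXk k) a v (hmart k a)
        simp_rw [Finset.sum_range_succ]
        refine h1.trans ?_
        rw [hψk, hβ]
        simp only
        by_cases hk : k < m
        · rw [if_pos hk]
          have h2 : ‖∫ ω, Complex.exp ((a * ∑ j ∈ Finset.range k, X j ω : ℝ) * Complex.I)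
              * ((X k ω ^ 2 - v : ℝ) : ℂ) ∂P‖ ≤ 2 * v :=
            (norm_integral_cexp_mul_le (hW k).abs fun ω => by
              rw [Complex.norm_real, Real.norm_eq_abs]).trans (hWk k)
          have h3 : 0 ≤ a ^ 2 / 2 * (η + (|a| * K * (m * ν) + 2 * κ K)) := by positivity
          have h4 := mul_le_mul_of_nonneg_left h2 (show 0 ≤ a ^ 2 / 2 by positivity)
          linarith
        · rw [if_neg hk, add_zero]
          -- Drop the last m summands from the phase: mixing applies to the shortened sum, and the
          -- removed block has L¹ norm at most mν.
          obtain ⟨l, rfl⟩ : ∃ l, k = l + m := ⟨k - m, by omega⟩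
          gcongr
          simp_rw [Finset.sum_range_add]
          have hTi : Integrable (fun ω => ∑ x ∈ Finset.range m, X (l + x) ω) P :=
            integrable_finsetSum _ fun j _ => hXi _
          refine (norm_integral_cexp_add_mul_le (hSm l) hTi (hW (l + m)) a K hK).trans ?_
          rw [hκk]
          gcongr
          · exact hm l a
          · calc ∫ ω, |∑ x ∈ Finset.range m, X (l + x) ω| ∂P
                ≤ ∫ ω, ∑ x ∈ Finset.range m, |X (l + x) ω| ∂P :=
                  integral_mono hTi.abs (integrable_finsetSum _ fun j _ => (hXi _).abs)
                    fun ω => Finset.abs_sum_le_sum_abs _ _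
              _ = m * ν := by
                  rw [integral_finsetSum _ fun j _ => (hXi _).abs]
                  simp [hνk]) n
    simp only [Finset.range_zero, Finset.sum_empty, mul_zero, Complex.ofReal_zero, zero_mul,
      Complex.exp_zero, integral_const, probReal_univ, one_smul, mul_one] at key
    refine key.trans ?_
    rw [hβ, Finset.sum_add_distrib]
    refine add_le_add (by simp [mul_add]) ?_
    rw [← Finset.sum_filter, Finset.sum_const, nsmul_eq_mul]
    gcongr
    calc _ ≤ (Finset.range m).card := Finset.card_le_card fun x hx => by
          simp at hx ⊢; exact hx.2
      _ = m := by simp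
  have ha0 : Tendsto (fun n : ℕ => (√(n : ℝ))⁻¹) atTop (𝓝 0) :=
    tendsto_inv_atTop_zero.comp (Real.tendsto_sqrt_atTop.comp tendsto_natCast_atTop_atTop)
  have hexp : Tendsto (fun n : ℕ => ((1 - v * ((√(n : ℝ))⁻¹) ^ 2 / 2 : ℝ) : ℂ) ^ n) atTop
      (𝓝 (Complex.exp (-(v : ℂ) / 2))) := by
    have h1 := Complex.tendsto_one_add_div_pow_exp (-(v : ℂ) / 2)
    refine h1.congr fun n => ?_
    congr 1
    rw [inv_pow, Real.sq_sqrt (Nat.cast_nonneg n)]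
    push_cast
    ring
  suffices hz : Tendsto (fun n : ℕ => ∫ ω, Complex.exp
      (((√(n : ℝ))⁻¹ * ∑ j ∈ Finset.range n, X j ω : ℝ) * Complex.I) ∂P
      - ((1 - v * ((√(n : ℝ))⁻¹) ^ 2 / 2 : ℝ) : ℂ) ^ n) atTop (𝓝 0) by
    simpa using hz.add hexp
  rw [tendsto_zero_iff_norm_tendsto_zero]
  refine (tendsto_order.2 ⟨fun x hx => Eventually.of_forall fun n => hx.trans_le (norm_nonneg _),
    fun ε hε => ?_⟩)
  -- The order of choice matters: first the gap m, then the level K, then n large. The part that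
  -- survives n → ∞ is ½(ε/4 + 2κ(K)), below ε.
  obtain ⟨m, hm⟩ := hmix (ε / 4) (by positivity)
  obtain ⟨K, hK⟩ := ((tendsto_order.1 (tendsto_integral_posPart_sub (hW 0).abs)).2 (ε / 4)
    (by positivity)).exists
  have hlim : Tendsto (fun n : ℕ => 4 * ψ (√(n : ℝ))⁻¹
      + 1 / 2 * (ε / 4 + (|(√(n : ℝ))⁻¹| * K * (m * ν) + 2 * κ K))
      + m * ((√(n : ℝ))⁻¹ ^ 2 * v)) atTop
      (𝓝 (4 * 0 + 1 / 2 * (ε / 4 + (|0| * K * (m * ν) + 2 * κ K)) + m * (0 ^ 2 * v))) :=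
    (((tendsto_integral_sq_mul_min hX ha0).const_mul 4).add
      ((((ha0.abs.mul_const _).mul_const _).add_const _).const_add _ |>.const_mul _)).add
      (((ha0.pow 2).mul_const v).const_mul _)
  have hlt : 4 * 0 + 1 / 2 * (ε / 4 + (|0| * K * (m * ν) + 2 * κ K)) + m * (0 ^ 2 * v) < ε := by
    simp only [abs_zero]
    have : κ K < ε / 4 := hK
    nlinarith
  have hcoef : Tendsto (fun n : ℕ => v * ((√(n : ℝ))⁻¹) ^ 2 / 2) atTop (𝓝 (v * 0 ^ 2 / 2)) :=
    ((ha0.pow 2).const_mul v).div_const 2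
  filter_upwards [(tendsto_order.1 hlim).2 ε hlt, eventually_ge_atTop 1,
    (tendsto_order.1 hcoef).2 1 (by norm_num)] with n hn hn1 hc
  have hn0 : (0 : ℝ) < n := by exact_mod_cast hn1
  refine (hbound (ε / 4) m K (by positivity) (by positivity) hm _ n ?_).trans_lt ?_
  · have : 0 ≤ v * ((√(n : ℝ))⁻¹) ^ 2 / 2 := by positivity
    rw [abs_le]; constructor <;> linarith
  · convert hn using 1
    have : (n : ℝ) * (√(n : ℝ))⁻¹ ^ 2 = 1 := by
      rw [inv_pow, Real.sq_sqrt hn0.le, mul_inv_cancel₀ hn0.ne']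
    linear_combination (4 * ψ (√(n : ℝ))⁻¹
      + 1 / 2 * (ε / 4 + (|(√(n : ℝ))⁻¹| * K * (m * ν) + 2 * κ K))) * this

end DropoutSGD

noncomputable section
namespace DropoutSGD

/-! ### The recursion as a random affine map -/

section Affine

variable {d : ℕ}

lemma toEuclideanLin_dropMat_apply (δ : Fin d → ℝ) (v : Vec d) (i : Fin d) :
    Matrix.toEuclideanLin (dropMat δ) v i = δ i * v i := by
  simp [dropMat, Matrix.toLpLin_apply, Matrix.mulVec_diagonal]

/-- The covariate vector after dropout, `D x`. -/
def feature (s : Sample d) : Vec d := Matrix.toEuclideanLin (dropMat s.1) s.2.2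

lemma feature_apply (s : Sample d) (i : Fin d) : feature s i = s.1 i * s.2.2 i :=
  toEuclideanLin_dropMat_apply _ _ _

lemma inner_dropMat (s : Sample d) (v : Vec d) :
    inner ℝ s.2.2 (Matrix.toEuclideanLin (dropMat s.1) v) = inner ℝ (feature s) v := by
  simp only [PiLp.inner_apply, feature, toEuclideanLin_dropMat_apply]
  refine Finset.sum_congr rfl fun i _ => ?_
  simp
  ring

/-- The linear part `v ↦ v - α (Dx)(Dx)ᵀ v` of one step of the recursion. -/
def linPart (α : ℝ) (s : Sample d) (v : Vec d) : Vec d :=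
  v - (α * inner ℝ (feature s) v) • feature s

lemma step_eq (α : ℝ) (s : Sample d) (b : Vec d) :
    step α s b = b + (α * (s.2.1 - inner ℝ (feature s) b)) • feature s := by
  rw [step, inner_dropMat, feature]

/-- The response cancels, so two trajectories driven by the same inputs approach each other under
the linear parts alone. -/
lemma step_sub_step (α : ℝ) (s : Sample d) (b c : Vec d) :
    step α s b - step α s c = linPart α s (b - c) := by
  rw [step_eq, step_eq, linPart, inner_sub_right]
  module

lemma measurable_feature : Measurable (feature : Sample d → Vec d) := by
  have : (feature : Sample d → Vec d)
      = fun s => WithLp.toLp 2 (fun i => s.1 i * s.2.2 i) := by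
    ext s i; simp [feature_apply]
  rw [this]
  fun_prop

lemma measurable_step (α : ℝ) : Measurable fun z : Sample d × Vec d => step α z.1 z.2 := by
  simp_rw [step_eq]
  have h : Measurable fun z : Sample d × Vec d => feature z.1 :=
    measurable_feature.comp measurable_fst
  fun_prop

lemma _root_.Measurable.step {X : Type*} {_ : MeasurableSpace X} (α : ℝ) {f : X → Sample d}
    {V : X → Vec d} (hf : Measurable f) (hV : Measurable V) :
    Measurable fun x => DropoutSGD.step α (f x) (V x) :=
  (measurable_step α).comp (hf.prodMk hV)

lemma measurable_linPart (α : ℝ) : Measurable fun z : Sample d × Vec d => linPart α z.1 z.2 := by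
  unfold linPart
  have h : Measurable fun z : Sample d × Vec d => feature z.1 :=
    measurable_feature.comp measurable_fst
  fun_prop

lemma continuous_step (α : ℝ) (s : Sample d) : Continuous (step α s) := by
  have : step α s = fun b => b + (α * (s.2.1 - inner ℝ (feature s) b)) • feature s :=
    funext fun b => step_eq α s b
  rw [this]
  fun_prop

/-- The state at time `l + n` of the recursion that sits at `c` at time `l`. -/
def flow (α : ℝ) (ξ : ℤ → Sample d) (l : ℤ) : ℕ → Vec d → Vec d
  | 0, c => c
  | n + 1, c => step α (ξ (l + n + 1)) (flow α ξ l n c)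

/-- Peels off the earliest step, whereas the definition peels off the latest. -/
lemma flow_succ' (α : ℝ) (ξ : ℤ → Sample d) (l : ℤ) (n : ℕ) (c : Vec d) :
    flow α ξ l (n + 1) c = flow α ξ (l + 1) n (step α (ξ (l + 1)) c) := by
  induction n with
  | zero => simp [flow]
  | succ n ih =>
    rw [flow, ih, flow]
    congr 2
    push_cast; ring

lemma flow_shift (α : ℝ) (ξ : ℤ → Sample d) (k l : ℤ) (n : ℕ) (c : Vec d) :
    flow α (fun j => ξ (j + k)) l n c = flow α ξ (l + k) n c := by
  induction n with
  | zero => rfl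
  | succ n ih =>
    rw [flow, ih, flow]
    congr 2
    ring

/-- The backward iterate of index m uses the m + 1 inputs from k − m to k, hence the starting time k
− m − 1. -/
lemma backward_eq_flow (α : ℝ) (ξ : ℤ → Sample d) (k : ℤ) (m : ℕ) (c : Vec d) :
    backward α ξ k m c = flow α ξ (k - m - 1) (m + 1) c := by
  induction m generalizing c with
  | zero => simp [flow, backward]
  | succ m ih =>
    rw [backward, ih, flow_succ' (n := m + 1)]
    push_cast
    rw [show k - ((m : ℤ) + 1) - 1 + 1 = k - m - 1 by ring,
      show k - ((m : ℤ) + 1) = k - m - 1 by ring]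

lemma backward_succ (α : ℝ) (ξ : ℤ → Sample d) (k : ℤ) (m : ℕ) (c : Vec d) :
    backward α ξ k (m + 1) c = step α (ξ k) (backward α ξ (k - 1) m c) := by
  rw [backward_eq_flow, backward_eq_flow, flow]
  push_cast
  rw [show k - ((m : ℤ) + 1) - 1 + (m + 1) + 1 = k by ring,
    show k - ((m : ℤ) + 1) - 1 = k - 1 - m - 1 by ring]

lemma sgd_eq_flow (α : ℝ) (ξ : ℤ → Sample d) (b₀ : Vec d) (n : ℕ) :
    sgd α (fun k : ℕ => ξ (k + 1)) b₀ n = flow α ξ 0 n b₀ := by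
  induction n with
  | zero => rfl
  | succ n ih => rw [sgd, ih, flow, zero_add]

/-- True for every input sequence, convergent or not, since both sides are the same `limUnder`. With
shift invariance of the product law it carries all the stationarity used later. -/
lemma stat_shift (α : ℝ) (ξ : ℤ → Sample d) (k l : ℤ) :
    stat α l (fun j => ξ (j + k)) = stat α (l + k) ξ := by
  unfold stat
  congr 1
  funext m
  rw [backward_eq_flow, backward_eq_flow, flow_shift]
  congr 1
  ring

end Affine

/-! ### Functions of part of a two-sided i.i.d. sequence -/

section Coordinates

variable {d : ℕ}

/-- The σ-algebra generated by the inputs with index in `T`. -/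
@[reducible]
def coordAlg (d : ℕ) (T : Set ℤ) : MeasurableSpace (ℤ → Sample d) :=
  ⨆ j ∈ T, MeasurableSpace.comap (fun ξ : ℤ → Sample d => ξ j) inferInstance

lemma coordAlg_le (T : Set ℤ) : coordAlg d T ≤ MeasurableSpace.pi :=
  iSup₂_le fun j _ => (measurable_pi_apply j).comap_le

lemma coordAlg_mono {T T' : Set ℤ} (h : T ⊆ T') : coordAlg d T ≤ coordAlg d T' :=
  biSup_mono h

lemma measurable_coordAlg_eval {T : Set ℤ} {j : ℤ} (hj : j ∈ T) :
    Measurable[coordAlg d T] fun ξ : ℤ → Sample d => ξ j :=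
  Measurable.of_comap_le (le_iSup₂_of_le j hj le_rfl)

instance isProbabilityMeasure_twoSided (μ : Measure (Sample d)) [IsProbabilityMeasure μ] :
    IsProbabilityMeasure (twoSided μ) := by
  unfold twoSided; infer_instance

lemma hasLaw_eval_twoSided (μ : Measure (Sample d)) [IsProbabilityMeasure μ] (k : ℤ) :
    HasLaw (fun ξ : ℤ → Sample d => ξ k) μ (twoSided μ) :=
  (measurePreserving_eval_infinitePi (fun _ : ℤ => μ) k).hasLaw

lemma measurePreserving_shift (μ : Measure (Sample d)) [IsProbabilityMeasure μ] (k : ℤ) :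
    MeasurePreserving (fun (ξ : ℤ → Sample d) j => ξ (j + k)) (twoSided μ) (twoSided μ) where
  measurable := by fun_prop
  map_eq := Measure.map_infinitePi_infinitePi_of_inj (P := fun _ : ℤ => μ)
    (f := fun j : ℤ => j + k) (add_left_injective k)

lemma indepFun_of_disjoint (μ : Measure (Sample d)) [IsProbabilityMeasure μ] {T T' : Set ℤ}
    (hT : Disjoint T T') {β γ : Type*} [MeasurableSpace β] [MeasurableSpace γ]
    {V : (ℤ → Sample d) → β} {W : (ℤ → Sample d) → γ}
    (hV : Measurable[coordAlg d T] V) (hW : Measurable[coordAlg d T'] W) :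
    IndepFun V W (twoSided μ) := by
  have h1 : iIndepFun (fun (j : ℤ) (ξ : ℤ → Sample d) => ξ j) (twoSided μ) :=
    iIndepFun_infinitePi (P := fun _ : ℤ => μ) (X := fun _ ω => ω) (fun _ => measurable_id)
  have h2 : Indep (coordAlg d T) (coordAlg d T') (twoSided μ) :=
    indep_iSup_of_disjoint (fun j => (measurable_pi_apply j).comap_le) h1.iIndep hT
  exact indep_of_indep_of_le_left (indep_of_indep_of_le_right h2 hW.comap_le) hV.comap_le

/-- An input whose index lies outside T is independent of whatever T determines. The product law
lets Fubini average over the fresh input first, in place of conditioning. -/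
lemma hasLaw_prodMk_eval (μ : Measure (Sample d)) [IsProbabilityMeasure μ] {T : Set ℤ} {k : ℤ}
    (hk : k ∉ T) {β : Type*} [MeasurableSpace β] {V : (ℤ → Sample d) → β}
    (hV : Measurable[coordAlg d T] V) :
    HasLaw (fun ξ : ℤ → Sample d => (ξ k, V ξ)) (μ.prod ((twoSided μ).map V)) (twoSided μ) where
  aemeasurable :=
    ((measurable_pi_apply k).prodMk (hV.mono (coordAlg_le T) le_rfl)).aemeasurable
  map_eq := by
    have h := indepFun_of_disjoint μ (T := {k}) (T' := T) (by simpa using hk)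
      (measurable_coordAlg_eval (Set.mem_singleton k)) hV
    rw [(indepFun_iff_map_prod_eq_prod_map_map (measurable_pi_apply k).aemeasurable
      (hV.mono (coordAlg_le T) le_rfl).aemeasurable).1 h, (hasLaw_eval_twoSided μ k).map_eq]

lemma measurable_step_coordAlg (α : ℝ) {T : Set ℤ} {k : ℤ} (hk : k ∈ T)
    {V : (ℤ → Sample d) → Vec d} (hV : Measurable[coordAlg d T] V) :
    Measurable[coordAlg d T] fun ξ => step α (ξ k) (V ξ) :=
  (measurable_coordAlg_eval hk).step α hV

lemma measurable_flow_coordAlg (α : ℝ) {T : Set ℤ} {l : ℤ} {n : ℕ}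
    (hT : Set.Ioc l (l + n) ⊆ T)
    {V : (ℤ → Sample d) → Vec d} (hV : Measurable[coordAlg d T] V) :
    Measurable[coordAlg d T] fun ξ => flow α ξ l n (V ξ) := by
  induction n with
  | zero => exact hV
  | succ n ih =>
    refine measurable_step_coordAlg α (hT ?_) (ih fun x hx => hT ?_)
    · simp
    · simp at hx ⊢; omega

lemma measurable_backward_coordAlg (α : ℝ) {T : Set ℤ} {k : ℤ} (hT : Set.Iic k ⊆ T) (m : ℕ)
    (c : Vec d) : Measurable[coordAlg d T] fun ξ => backward α ξ k m c := by
  simp_rw [backward_eq_flow]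
  refine measurable_flow_coordAlg α (V := fun _ => c) (fun x hx => hT ?_)
    (@measurable_const _ _ _ (coordAlg d T) c)
  simp at hx ⊢; omega

/-- `limUnder` of measurable maps is measurable even where the limit fails to exist, so no null set
has to be added to the σ-algebra of the past. -/
lemma measurable_stat_coordAlg (α : ℝ) (k : ℤ) :
    Measurable[coordAlg d (Set.Iic k)] fun ξ => stat α k ξ :=
  (@StronglyMeasurable.limUnder ℕ (ℤ → Sample d) (Vec d) (coordAlg d (Set.Iic k)) _ _ atTop _
    (fun m ξ => backward α ξ k m 0) _ _ fun m =>
      (measurable_backward_coordAlg α subset_rfl m 0).stronglyMeasurable).measurable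

lemma measurable_stat (α : ℝ) (k : ℤ) : Measurable (stat α k : (ℤ → Sample d) → Vec d) :=
  (measurable_stat_coordAlg α k).mono (coordAlg_le _) le_rfl

end Coordinates

end DropoutSGD
end

noncomputable section
namespace DropoutSGD

/-! ### Geometric moment contraction -/

section L2

variable {Ω E : Type*} [MeasurableSpace Ω] [NormedAddCommGroup E] {P : Measure Ω}

lemma eLpNorm_two_sq (f : Ω → E) : eLpNorm f 2 P ^ 2 = ∫⁻ ω, ‖f ω‖ₑ ^ 2 ∂P := by
  have h := eLpNorm_nnreal_pow_eq_lintegral (f := f) (μ := P) (p := 2) two_ne_zero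
  norm_num at h
  exact_mod_cast h

/-- On a probability space L¹ norms are at most L² norms, so the expected sum of the norms is
bounded by a geometric series. -/
lemma ae_tsum_enorm_ne_top_of_geometric [IsProbabilityMeasure P] {g : ℕ → Ω → E} {r : ℝ≥0}
    (hr : r < 1) {C : ℝ≥0∞} (hC : C ≠ ∞) (hg : ∀ n, AEStronglyMeasurable (g n) P)
    (hle : ∀ n, eLpNorm (g n) 2 P ≤ r ^ n * C) : ∀ᵐ ω ∂P, ∑' n, ‖g n ω‖ₑ ≠ ∞ := by
  have hint : ∫⁻ ω, ∑' n, ‖g n ω‖ₑ ∂P ≠ ∞ := by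
    rw [lintegral_tsum fun n => (hg n).enorm]
    refine ne_top_of_le_ne_top (b := ∑' n : ℕ, (r : ℝ≥0∞) ^ n * C) ?_
      (ENNReal.tsum_le_tsum fun n => ?_)
    · rw [ENNReal.tsum_mul_right, ENNReal.tsum_geometric]
      refine ENNReal.mul_ne_top (ENNReal.inv_ne_top.2 ?_) hC
      exact (tsub_pos_iff_lt.2 (by exact_mod_cast hr)).ne'
    · rw [← eLpNorm_one_eq_lintegral_enorm]
      exact (eLpNorm_le_eLpNorm_of_exponent_le one_le_two (hg n)).trans (hle n)
  exact (ae_lt_top' (AEMeasurable.tsum fun n => (hg n).enorm) hint).mono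
    fun ω h => h.ne

end L2

variable {d : ℕ}

/-- The σ-algebra on the domain is a plain implicit variable so that it can be instantiated with
`coordAlg`. -/
lemma measurable_vec_sub {X : Type*} {_ : MeasurableSpace X} {V V' : X → Vec d}
    (hV : Measurable V) (hV' : Measurable V') : Measurable fun x => V x - V' x :=
  hV.sub hV'

/-- The random affine maps `step α s`, `s ∼ μ`, are square integrable and contract by the factor
`r < 1` in mean square. -/
structure IsContracting (α : ℝ) (μ : Measure (Sample d)) (r : ℝ≥0) : Prop where
  lt_one : r < 1
  eLpNorm_linPart_le : ∀ v, eLpNorm (fun s => linPart α s v) 2 μ ≤ r * ‖v‖ₑ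
  memLp_step : ∀ v, MemLp (fun s => step α s v) 2 μ

namespace IsContracting

variable {α : ℝ} {μ : Measure (Sample d)} [IsProbabilityMeasure μ] {r : ℝ≥0}

/-- Freeze V by Fubini, apply the contraction for deterministic vectors, and integrate the result
over the law of V. -/
lemma eLpNorm_linPart_eval_le (h : IsContracting α μ r) {T : Set ℤ} {k : ℤ} (hk : k ∉ T)
    {V : (ℤ → Sample d) → Vec d} (hV : Measurable[coordAlg d T] V) :
    eLpNorm (fun ξ => linPart α (ξ k) (V ξ)) 2 (twoSided μ) ≤ r * eLpNorm V 2 (twoSided μ) := by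
  rw [← ENNReal.pow_le_pow_left_iff two_ne_zero, mul_pow, eLpNorm_two_sq, eLpNorm_two_sq]
  have hVm : Measurable V := hV.mono (coordAlg_le T) le_rfl
  have hm : Measurable fun z : Sample d × Vec d => ‖linPart α z.1 z.2‖ₑ ^ 2 :=
    (measurable_linPart α).enorm.pow_const 2
  have : IsProbabilityMeasure ((twoSided μ).map V) :=
    Measure.isProbabilityMeasure_map hVm.aemeasurable
  have h1 := (hasLaw_prodMk_eval μ hk hV).lintegral_comp hm.aemeasurable
  simp only at h1
  rw [h1, lintegral_prod_symm' _ hm]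
  calc _ ≤ ∫⁻ v, (r : ℝ≥0∞) ^ 2 * ‖v‖ₑ ^ 2 ∂((twoSided μ).map V) := by
        refine lintegral_mono fun v => ?_
        simp only
        rw [← eLpNorm_two_sq (fun s => linPart α s v), ← mul_pow]
        exact pow_le_pow_left' (h.eLpNorm_linPart_le v) 2
    _ = _ := by
        rw [lintegral_const_mul _ (by fun_prop), lintegral_map (by fun_prop) hVm]

lemma eLpNorm_flow_sub_le (h : IsContracting α μ r) {l : ℤ} (n : ℕ)
    {V V' : (ℤ → Sample d) → Vec d} (hV : Measurable[coordAlg d (Set.Iic l)] V)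
    (hV' : Measurable[coordAlg d (Set.Iic l)] V') :
    eLpNorm (fun ξ => flow α ξ l n (V ξ) - flow α ξ l n (V' ξ)) 2 (twoSided μ)
      ≤ r ^ n * eLpNorm (fun ξ => V ξ - V' ξ) 2 (twoSided μ) := by
  induction n with
  | zero => simp [flow]
  | succ n ih =>
    have hsub : Set.Iic l ⊆ Set.Iic (l + n) := Set.Iic_subset_Iic.2 (by omega)
    have hIoc : Set.Ioc l (l + n) ⊆ Set.Iic (l + n) := fun x hx => hx.2
    have hm1 := measurable_flow_coordAlg α hIoc (hV.mono (coordAlg_mono hsub) le_rfl)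
    have hm2 := measurable_flow_coordAlg α hIoc (hV'.mono (coordAlg_mono hsub) le_rfl)
    simp_rw [flow, step_sub_step]
    refine (h.eLpNorm_linPart_eval_le (k := l + n + 1) (T := Set.Iic (l + n)) (by simp)
      (measurable_vec_sub hm1 hm2)).trans ?_
    rw [pow_succ', mul_assoc]
    gcongr

lemma memLp_step_eval (h : IsContracting α μ r) (k : ℤ) (v : Vec d) :
    MemLp (fun ξ : ℤ → Sample d => step α (ξ k) v) 2 (twoSided μ) :=
  (h.memLp_step v).comp_measurePreserving
    ((hasLaw_eval_twoSided μ k).measurePreserving (measurable_pi_apply k))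

lemma eLpNorm_backward_sub_le (h : IsContracting α μ r) (k : ℤ) (m : ℕ) (c c' : Vec d) :
    eLpNorm (fun ξ => backward α ξ k m c - backward α ξ k m c') 2 (twoSided μ)
      ≤ r ^ m * ‖c - c'‖ₑ := by
  simp_rw [backward_eq_flow]
  refine (h.eLpNorm_flow_sub_le (m + 1) (V := fun _ => c) (V' := fun _ => c')
    (@measurable_const _ _ _ (coordAlg d _) c) (@measurable_const _ _ _ (coordAlg d _) c')).trans ?_
  rw [eLpNorm_const _ two_ne_zero (NeZero.ne _), measure_univ, ENNReal.one_rpow, mul_one]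
  gcongr ?_ * _
  exact pow_le_pow_right_of_le_one' (by exact_mod_cast h.lt_one.le) (Nat.le_succ m)

/-- Both iterates end with the same m + 1 maps and differ only in where they stand at time k − m −
1. One factor r is given away to keep the exponent m. -/
lemma eLpNorm_backward_succ_sub_le (h : IsContracting α μ r) (k : ℤ) (m : ℕ) (c : Vec d) :
    eLpNorm (fun ξ => backward α ξ k (m + 1) c - backward α ξ k m c) 2 (twoSided μ)
      ≤ r ^ m * eLpNorm (fun s => step α s c - c) 2 μ := by
  simp_rw [backward_eq_flow, flow_succ' (n := m + 1)]
  push_cast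
  simp_rw [show k - ((m : ℤ) + 1) - 1 + 1 = k - m - 1 by ring]
  refine (h.eLpNorm_flow_sub_le (l := k - m - 1) (m + 1)
    (V := fun ξ => step α (ξ (k - m - 1)) c) (V' := fun _ => c)
    (measurable_step_coordAlg α (by simp) (@measurable_const _ _ _ (coordAlg d _) c))
    (@measurable_const _ _ _ (coordAlg d _) c)).trans ?_
  have hlaw : eLpNorm (fun ξ : ℤ → Sample d => step α (ξ (k - m - 1)) c - c) 2 (twoSided μ)
      = eLpNorm (fun s => step α s c - c) 2 μ :=
    eLpNorm_comp_measurePreserving (g := fun s => step α s c - c)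
      (((h.memLp_step c).aestronglyMeasurable).sub aestronglyMeasurable_const)
      ((hasLaw_eval_twoSided μ _).measurePreserving (measurable_pi_apply _))
  rw [hlaw]
  gcongr ?_ * _
  exact pow_le_pow_right_of_le_one' (by exact_mod_cast h.lt_one.le) (Nat.le_succ m)

lemma measurable_backward (α : ℝ) (k : ℤ) (m : ℕ) (c : Vec d) :
    Measurable fun ξ : ℤ → Sample d => backward α ξ k m c :=
  (measurable_backward_coordAlg α subset_rfl m c).mono (coordAlg_le _) le_rfl

/-- Summable increments make the iterates from 0 Cauchy, and the distance to the iterates from c is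
summable as well, hence tends to zero. -/
lemma ae_tendsto_backward (h : IsContracting α μ r) (k : ℤ) (c : Vec d) :
    ∀ᵐ ξ ∂(twoSided μ), Tendsto (fun m : ℕ => backward α ξ k m c) atTop (𝓝 (stat α k ξ)) := by
  have h1 := ae_tsum_enorm_ne_top_of_geometric h.lt_one
    (((h.memLp_step 0).sub (memLp_const 0)).eLpNorm_ne_top)
    (fun m => ((measurable_backward α k (m + 1) 0).sub
      (measurable_backward α k m 0)).aestronglyMeasurable)
    (fun m => h.eLpNorm_backward_succ_sub_le k m 0)
  have h2 := ae_tsum_enorm_ne_top_of_geometric h.lt_one (C := ‖c - 0‖ₑ) (by simp)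
    (fun m => ((measurable_backward α k m c).sub
      (measurable_backward α k m 0)).aestronglyMeasurable)
    (fun m => h.eLpNorm_backward_sub_le k m c 0)
  filter_upwards [h1, h2] with ξ hξ1 hξ2
  have hc : CauchySeq fun m : ℕ => backward α ξ k m 0 :=
    cauchySeq_of_edist_le_of_tsum_ne_top _
      (fun n => (edist_comm _ _).trans_le (edist_eq_enorm_sub _ _).le) hξ1
  have ht : Tendsto (fun m : ℕ => backward α ξ k m 0) atTop (𝓝 (stat α k ξ)) :=
    hc.tendsto_limUnder
  have hz : Tendsto (fun m : ℕ => backward α ξ k m c - backward α ξ k m 0) atTop (𝓝 0) := by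
    rw [tendsto_zero_iff_enorm_tendsto_zero]
    exact ENNReal.tendsto_atTop_zero_of_tsum_ne_top hξ2
  simpa using hz.add ht

lemma ae_stat_eq_step (h : IsContracting α μ r) (k : ℤ) :
    ∀ᵐ ξ ∂(twoSided μ), stat α (k + 1) ξ = step α (ξ (k + 1)) (stat α k ξ) := by
  filter_upwards [h.ae_tendsto_backward (k + 1) 0, h.ae_tendsto_backward k 0] with ξ h1 h2
  have h3 := ((continuous_step α (ξ (k + 1))).tendsto _).comp h2
  refine tendsto_nhds_unique ((tendsto_add_atTop_iff_nat 1).2 h1) (h3.congr fun m => ?_)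
  rw [backward_succ]
  simp

lemma ae_stat_eq_flow (h : IsContracting α μ r) (l : ℤ) (n : ℕ) :
    ∀ᵐ ξ ∂(twoSided μ), stat α (l + n) ξ = flow α ξ l n (stat α l ξ) := by
  induction n with
  | zero => simp [flow]
  | succ n ih =>
    filter_upwards [ih, h.ae_stat_eq_step (l + n)] with ξ h1 h2
    rw [flow, ← h1, ← h2]
    congr 1
    push_cast; ring

lemma memLp_stat (h : IsContracting α μ r) (k : ℤ) : MemLp (stat α k) 2 (twoSided μ) := by
  have hK : ∀ k : ℤ, eLpNorm (fun ξ : ℤ → Sample d => step α (ξ k) 0) 2 (twoSided μ)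
      = eLpNorm (fun s => step α s 0) 2 μ := fun k =>
    eLpNorm_comp_measurePreserving (g := fun s => step α s 0)
      ((h.memLp_step 0).aestronglyMeasurable)
      ((hasLaw_eval_twoSided μ _).measurePreserving (measurable_pi_apply _))
  -- B = K/(1 − r) is the fixed point of B ↦ K + rB. It bounds all backward iterates in L², and
  -- Fatou's lemma carries the bound to the limit.
  obtain ⟨B, hB⟩ : ∃ B : ℝ≥0, eLpNorm (fun s => step α s 0) 2 μ + r * B ≤ B := by
    lift eLpNorm (fun s => step α s 0) 2 μ to ℝ≥0 using (h.memLp_step 0).eLpNorm_ne_top with K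
    have hr : (r : ℝ) < 1 := by exact_mod_cast h.lt_one
    refine ⟨Real.toNNReal (K / (1 - r)), ?_⟩
    norm_cast
    rw [← NNReal.coe_le_coe, NNReal.coe_add, NNReal.coe_mul,
      Real.coe_toNNReal _ (by have := sub_pos.2 hr; positivity)]
    have : (1 - (r : ℝ)) ≠ 0 := (sub_pos.2 hr).ne'
    apply le_of_eq
    field_simp
    ring
  have hbd : ∀ (m : ℕ) (k : ℤ),
      eLpNorm (fun ξ => backward α ξ k m 0) 2 (twoSided μ) ≤ B := by
    intro m
    induction m with
    | zero =>
      intro k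
      simp only [backward]
      rw [hK]
      exact le_self_add.trans hB
    | succ m ih =>
      intro k
      have hsplit : (fun ξ => backward α ξ k (m + 1) 0) = (fun ξ : ℤ → Sample d => step α (ξ k) 0)
          + fun ξ => linPart α (ξ k) (backward α ξ (k - 1) m 0) := by
        funext ξ
        have := step_sub_step α (ξ k) (backward α ξ (k - 1) m 0) 0
        rw [sub_zero] at this
        simp [backward_succ, ← this]
      rw [hsplit]
      have hm : Measurable fun ξ : ℤ → Sample d => linPart α (ξ k) (backward α ξ (k - 1) m 0) :=
        (measurable_linPart α).comp
          ((measurable_pi_apply k).prodMk (measurable_backward α (k - 1) m 0))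
      refine (eLpNorm_add_le (h.memLp_step_eval k 0).aestronglyMeasurable
        hm.aestronglyMeasurable one_le_two).trans (le_trans ?_ hB)
      rw [hK]
      gcongr
      refine (h.eLpNorm_linPart_eval_le (T := Set.Iic (k - 1)) (by simp)
        (measurable_backward_coordAlg α subset_rfl m 0)).trans ?_
      gcongr
      exact ih (k - 1)
  refine ⟨(measurable_stat α k).aestronglyMeasurable, ?_⟩
  refine (Lp.eLpNorm_le_of_ae_tendsto (Eventually.of_forall fun m => hbd m k)
    (fun m => (measurable_backward α k m 0).aestronglyMeasurable)
    (h.ae_tendsto_backward k 0)).trans_lt ENNReal.coe_lt_top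

end IsContracting

/-! ### The stationary distribution -/

/-- The law of the stationary sequence. -/
def statLaw (α : ℝ) (μ : Measure (Sample d)) : Measure (Vec d) := (twoSided μ).map (stat α 0)

variable {α : ℝ} {μ : Measure (Sample d)} [IsProbabilityMeasure μ] {r : ℝ≥0}

instance isProbabilityMeasure_statLaw : IsProbabilityMeasure (statLaw α μ) :=
  Measure.isProbabilityMeasure_map (measurable_stat α 0).aemeasurable

lemma hasLaw_stat (k : ℤ) : HasLaw (stat α k) (statLaw α μ) (twoSided μ) where
  aemeasurable := (measurable_stat α k).aemeasurable
  map_eq := by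
    have h : (stat α k : (ℤ → Sample d) → Vec d) = stat α 0 ∘ fun ξ j => ξ (j + k) := by
      funext ξ; simp [stat_shift]
    rw [h, ← Measure.map_map (measurable_stat α 0) (by fun_prop),
      (measurePreserving_shift μ k).map_eq, statLaw]

/-- The state at time 0 is independent of the input at time 1, the step takes this pair to the state
at time 1, and both states have the same law. -/
lemma IsContracting.isStationary_statLaw (h : IsContracting α μ r) :
    IsStationary α μ (statLaw α μ) := by
  have h1 := hasLaw_prodMk_eval μ (k := 0 + 1) (T := Set.Iic 0) (by simp)
    (measurable_stat_coordAlg α 0)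
  have h2 := (hasLaw_stat (α := α) (μ := μ) (0 + 1)).map_eq
  rw [Measure.map_congr (h.ae_stat_eq_step 0)] at h2
  unfold IsStationary
  rw [← Measure.prod_swap, Measure.map_map ?_ measurable_swap]
  · have h3 := h1.map_eq
    rw [(hasLaw_stat 0).map_eq] at h3
    rw [← h3]
    have h4 : Measurable fun ξ : ℤ → Sample d => (ξ (0 + 1), stat α 0 ξ) :=
      (measurable_pi_apply _).prodMk (measurable_stat α 0)
    refine (Measure.map_map ?_ h4).trans h2
    exact measurable_step α
  · exact (measurable_step α).comp measurable_swap

/-- The induction averages out the last step, which replaces φ by its image under the transition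
operator; hence φ is generalized. Stationarity then removes that operator. -/
lemma lintegral_flow_of_isStationary {π : Measure (Vec d)} [IsProbabilityMeasure π]
    (hπ : IsStationary α μ π) {φ : Vec d → ℝ≥0∞} (hφ : Measurable φ) (l : ℤ) (n : ℕ) :
    ∫⁻ v, ∫⁻ ξ, φ (flow α ξ l n v) ∂(twoSided μ) ∂π = ∫⁻ v, φ v ∂π := by
  induction n generalizing φ with
  | zero => simp [flow]
  | succ n ih =>
    have hm : Measurable fun z : Sample d × Vec d => φ (step α z.1 z.2) :=
      hφ.comp (measurable_step α)
    have h1 : ∀ v, ∫⁻ ξ, φ (flow α ξ l (n + 1) v) ∂(twoSided μ)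
        = ∫⁻ ξ, ∫⁻ s, φ (step α s (flow α ξ l n v)) ∂μ ∂(twoSided μ) := fun v => by
      have hfl : Measurable[coordAlg d (Set.Iic (l + n))] fun ξ => flow α ξ l n v :=
        measurable_flow_coordAlg α (V := fun _ => v) (fun x hx => hx.2)
          (@measurable_const _ _ _ (coordAlg d _) v)
      have hfl' : Measurable fun ξ : ℤ → Sample d => flow α ξ l n v :=
        hfl.mono (coordAlg_le _) le_rfl
      have : IsProbabilityMeasure ((twoSided μ).map fun ξ => flow α ξ l n v) :=
        Measure.isProbabilityMeasure_map hfl'.aemeasurable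
      have h2 := (hasLaw_prodMk_eval μ (k := l + n + 1) (by simp) hfl).lintegral_comp
        hm.aemeasurable
      simp only [flow] at h2 ⊢
      rw [h2, lintegral_prod_symm' _ hm, lintegral_map hm.lintegral_prod_left' hfl']
    simp_rw [h1]
    rw [ih hm.lintegral_prod_left']
    have hm' : Measurable fun z : Vec d × Sample d => φ (step α z.2 z.1) := hm.comp measurable_swap
    have hs : Measurable fun z : Vec d × Sample d => step α z.2 z.1 :=
      (measurable_step α).comp measurable_swap
    conv_rhs => rw [← hπ]
    rw [lintegral_map hφ hs, lintegral_prod _ hm'.aemeasurable]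

/-- For bounded continuous f, the mean of f over backward iterates converges for each start to its
mean under the limit law. Averaged over starts drawn from π it equals ∫ f dπ for every m.
Boundedness of f replaces any moment assumption on π. -/
lemma IsContracting.eq_statLaw (h : IsContracting α μ r) {π : Measure (Vec d)}
    [IsProbabilityMeasure π] (hπ : IsStationary α μ π) : π = statLaw α μ := by
  refine ext_of_forall_lintegral_eq_of_IsFiniteMeasure fun f => ?_
  have hfm : Measurable fun v => (f v : ℝ≥0∞) := f.continuous.measurable.coe_nnreal_ennreal
  have hbd : ∀ v, (f v : ℝ≥0∞) ≤ (nndist f 0 : ℝ≥0) := fun v => by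
    exact_mod_cast BoundedContinuousFunction.NNReal.upper_bound f v
  have hlim : ∀ v, Tendsto (fun m : ℕ => ∫⁻ ξ, f (backward α ξ 0 m v) ∂(twoSided μ)) atTop
      (𝓝 (∫⁻ ξ, f (stat α 0 ξ) ∂(twoSided μ))) := fun v => by
    refine tendsto_lintegral_of_dominated_convergence (fun _ => (nndist f 0 : ℝ≥0))
      (fun m => hfm.comp (measurable_backward α 0 m v)) (fun m => ae_of_all _ fun ξ => hbd _)
      (by simp) ?_
    filter_upwards [h.ae_tendsto_backward 0 v] with ξ hξ
    exact ENNReal.tendsto_coe.2 ((f.continuous.tendsto _).comp hξ)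
  have hmeas : ∀ m : ℕ, Measurable fun v => ∫⁻ ξ, f (backward α ξ 0 m v) ∂(twoSided μ) := by
    intro m
    have hj : Measurable fun z : Vec d × (ℤ → Sample d) => backward α z.2 0 m z.1 := by
      simp_rw [backward_eq_flow]
      generalize (m + 1) = n
      induction n with
      | zero => exact measurable_fst
      | succ n ih =>
        exact Measurable.step α
          (f := fun z : Vec d × (ℤ → Sample d) => z.2 (0 - (m : ℤ) - 1 + n + 1)) (by fun_prop) ih
    exact (hfm.comp hj).lintegral_prod_right'
  have hlim2 : Tendsto (fun m : ℕ => ∫⁻ v, ∫⁻ ξ, f (backward α ξ 0 m v) ∂(twoSided μ) ∂π) atTop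
      (𝓝 (∫⁻ _, ∫⁻ ξ, f (stat α 0 ξ) ∂(twoSided μ) ∂π)) := by
    refine tendsto_lintegral_of_dominated_convergence (fun _ => (nndist f 0 : ℝ≥0)) hmeas
      (fun m => ae_of_all _ fun v => ?_) (by simp) (ae_of_all _ hlim)
    exact (lintegral_mono fun ξ => hbd _).trans (by simp)
  have hconst : ∀ m : ℕ, ∫⁻ v, ∫⁻ ξ, f (backward α ξ 0 m v) ∂(twoSided μ) ∂π = ∫⁻ v, f v ∂π :=
    fun m => by
      simp_rw [backward_eq_flow]
      exact lintegral_flow_of_isStationary hπ hfm _ _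
  simp_rw [hconst] at hlim2
  have h3 := tendsto_nhds_unique tendsto_const_nhds hlim2
  rw [h3, lintegral_const, measure_univ, mul_one]
  rw [statLaw, lintegral_map hfm (measurable_stat α 0)]

end DropoutSGD
end

noncomputable section
namespace DropoutSGD

/-! ### The martingale part of the stationary sequence -/

section L2

variable {Ω E : Type*} [MeasurableSpace Ω] [NormedAddCommGroup E] {P : Measure Ω}

lemma integral_norm_sq_eq {f : Ω → E} (hf : AEStronglyMeasurable f P) :
    ∫ ω, ‖f ω‖ ^ 2 ∂P = (eLpNorm f 2 P).toReal ^ 2 := by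
  rw [← ENNReal.toReal_pow, eLpNorm_two_sq,
    integral_eq_lintegral_of_nonneg_ae (f := fun ω => ‖f ω‖ ^ 2)
      (ae_of_all _ fun ω => by positivity) (hf.norm.pow 2)]
  congr 1
  refine lintegral_congr fun ω => ?_
  rw [ENNReal.ofReal_pow (norm_nonneg _), ofReal_norm]

lemma integral_norm_le_eLpNorm_two [IsProbabilityMeasure P] {f : Ω → E} (hf : MemLp f 2 P) :
    ∫ ω, ‖f ω‖ ∂P ≤ (eLpNorm f 2 P).toReal := by
  rw [integral_norm_eq_lintegral_enorm hf.1, ← eLpNorm_one_eq_lintegral_enorm]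
  exact ENNReal.toReal_mono hf.eLpNorm_ne_top (eLpNorm_le_eLpNorm_of_exponent_le one_le_two hf.1)

lemma integral_abs_sq_sub_sq_le {X Y : Ω → ℝ} (hX : MemLp X 2 P) (hY : MemLp Y 2 P)
    {θ : ℝ} (hθ : 0 < θ) :
    ∫ ω, |X ω ^ 2 - Y ω ^ 2| ∂P
      ≤ θ * ∫ ω, X ω ^ 2 ∂P + (1 + θ⁻¹) * ∫ ω, (X ω - Y ω) ^ 2 ∂P := by
  have hXY : Integrable (fun ω => (X ω - Y ω) ^ 2) P := (hX.sub hY).integrable_sq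
  rw [← integral_const_mul, ← integral_const_mul,
    ← integral_add (hX.integrable_sq.const_mul _) (hXY.const_mul _)]
  refine integral_mono (hX.integrable_sq.sub hY.integrable_sq).abs
    ((hX.integrable_sq.const_mul _).add (hXY.const_mul _)) fun ω => ?_
  simp only
  generalize X ω = x
  generalize Y ω = y
  -- Weighted arithmetic–geometric mean inequality for the cross term in x² − y² = 2x(x − y) − (x −
  -- y)².
  have h1 : 0 ≤ θ⁻¹ * (θ * x - (x - y)) ^ 2 := by positivity
  have h2 : 0 ≤ θ⁻¹ * (θ * x + (x - y)) ^ 2 := by positivity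
  have h3 : θ⁻¹ * (θ * x - (x - y)) ^ 2 = θ * x ^ 2 - 2 * x * (x - y) + θ⁻¹ * (x - y) ^ 2 := by
    field_simp
    ring
  have h4 : θ⁻¹ * (θ * x + (x - y)) ^ 2 = θ * x ^ 2 + 2 * x * (x - y) + θ⁻¹ * (x - y) ^ 2 := by
    field_simp
    ring
  rw [h3] at h1
  rw [h4] at h2
  rw [abs_le]
  constructor <;> nlinarith [sq_nonneg (x - y)]

/-- If `X` is close to a variable `Y` independent of `S`, then `X²` is nearly uncorrelated with
functions of `S`. -/
lemma norm_integral_cexp_mul_sq_sub_le [IsProbabilityMeasure P] {S X Y : Ω → ℝ} {v : ℝ}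
    (hS : Measurable S) (hX : MemLp X 2 P) (hY : MemLp Y 2 P) (hSY : IndepFun S Y P)
    (hv : ∫ ω, X ω ^ 2 ∂P = v) (a : ℝ) :
    ‖∫ ω, Complex.exp ((a * S ω : ℝ) * Complex.I) * ((X ω ^ 2 - v : ℝ) : ℂ) ∂P‖
      ≤ 2 * ∫ ω, |X ω ^ 2 - Y ω ^ 2| ∂P := by
  set w := ∫ ω, Y ω ^ 2 ∂P with hw
  have hd : Integrable (fun ω => X ω ^ 2 - Y ω ^ 2) P := hX.integrable_sq.sub hY.integrable_sq
  have hy : Integrable (fun ω => Y ω ^ 2 - w) P := hY.integrable_sq.sub (integrable_const w)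
  have haS : AEMeasurable (fun ω => a * S ω) P := (hS.const_mul a).aemeasurable
  have hi1 : Integrable (fun ω => Complex.exp ((a * S ω : ℝ) * Complex.I)
      * ((X ω ^ 2 - Y ω ^ 2 : ℝ) : ℂ)) P := integrable_cexp_mul haS (hd.ofReal (𝕜 := ℂ))
  have hi2 : Integrable (fun ω => Complex.exp ((a * S ω : ℝ) * Complex.I)
      * ((Y ω ^ 2 - w : ℝ) : ℂ)) P := integrable_cexp_mul haS (hy.ofReal (𝕜 := ℂ))
  have hi3 : Integrable (fun ω => Complex.exp ((a * S ω : ℝ) * Complex.I)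
      * ((w - v : ℝ) : ℂ)) P := integrable_cexp_mul haS (integrable_const _)
  have hsplit : ∀ ω, Complex.exp ((a * S ω : ℝ) * Complex.I) * ((X ω ^ 2 - v : ℝ) : ℂ)
      = Complex.exp ((a * S ω : ℝ) * Complex.I) * ((X ω ^ 2 - Y ω ^ 2 : ℝ) : ℂ)
        + Complex.exp ((a * S ω : ℝ) * Complex.I) * ((Y ω ^ 2 - w : ℝ) : ℂ)
        + Complex.exp ((a * S ω : ℝ) * Complex.I) * ((w - v : ℝ) : ℂ) := fun ω => by
    push_cast; ring
  -- By independence the integral factors, and w centres Y². Of the other two terms, one replaces X²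
  -- by Y² and the other w by v; each is at most E|X² − Y²|, whence the factor 2.
  have hz : ∫ ω, Complex.exp ((a * S ω : ℝ) * Complex.I) * ((Y ω ^ 2 - w : ℝ) : ℂ) ∂P = 0 := by
    have h1 := hSY.integral_fun_comp_mul_comp (𝕜 := ℂ)
      (f := fun x : ℝ => Complex.exp ((a * x : ℝ) * Complex.I))
      (g := fun y : ℝ => ((y ^ 2 - w : ℝ) : ℂ)) hS.aemeasurable hY.1.aemeasurable
      (by fun_prop) (by fun_prop)
    rw [h1, integral_complex_ofReal, integral_sub hY.integrable_sq (integrable_const w)]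
    simp [hw]
  have hi12 : Integrable (fun ω => Complex.exp ((a * S ω : ℝ) * Complex.I)
      * ((X ω ^ 2 - Y ω ^ 2 : ℝ) : ℂ) + Complex.exp ((a * S ω : ℝ) * Complex.I)
      * ((Y ω ^ 2 - w : ℝ) : ℂ)) P := hi1.add hi2
  have hvw : |w - v| ≤ ∫ ω, |X ω ^ 2 - Y ω ^ 2| ∂P := by
    rw [abs_sub_comm, ← hv, hw, ← integral_sub hX.integrable_sq hY.integrable_sq]
    exact abs_integral_le_integral_abs
  simp_rw [hsplit]
  rw [integral_add hi12 hi3, integral_add hi1 hi2, hz, add_zero, two_mul]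
  refine (norm_add_le _ _).trans (add_le_add ?_ ?_)
  · exact norm_integral_cexp_mul_le hd.abs fun ω => by rw [Complex.norm_real, Real.norm_eq_abs]
  · refine (norm_integral_cexp_mul_le (integrable_const |w - v|) fun ω => by
      rw [Complex.norm_real, Real.norm_eq_abs]).trans ?_
    simpa using hvw

end L2

variable {d : ℕ}

lemma enorm_inner_le (v w : Vec d) : ‖(inner ℝ v w : ℝ)‖ₑ ≤ ‖v‖ₑ * ‖w‖ₑ := by
  simp only [enorm_eq_nnnorm]
  exact_mod_cast nnnorm_inner_le_nnnorm (𝕜 := ℝ) v w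

/-- `A` is the mean of the linear part of the recursion and `b` is fixed by the mean step. -/
structure IsMeanStep (α : ℝ) (μ : Measure (Sample d)) (A : Vec d →L[ℝ] Vec d) (b : Vec d) :
    Prop where
  integral_linPart : ∀ v, ∫ s, linPart α s v ∂μ = A v
  integral_step : ∫ s, step α s b ∂μ = b
  symm : ∀ v w, inner ℝ v (A w) = inner ℝ (A v) w

variable {α : ℝ} {μ : Measure (Sample d)} [IsProbabilityMeasure μ] {r : ℝ≥0}
  {A : Vec d →L[ℝ] Vec d} {b : Vec d}

namespace IsContracting

omit [IsProbabilityMeasure μ] in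
lemma memLp_linPart (h : IsContracting α μ r) (v : Vec d) :
    MemLp (fun s => linPart α s v) 2 μ := by
  have := (h.memLp_step v).sub (h.memLp_step 0)
  refine this.congr_norm ?_ (ae_of_all _ fun s => ?_)
  · exact ((measurable_linPart α).comp (measurable_id.prodMk measurable_const)).aestronglyMeasurable
  · simp [step_sub_step]

lemma memLp_linPart_eval (h : IsContracting α μ r) {T : Set ℤ} {k : ℤ} (hk : k ∉ T)
    {V : (ℤ → Sample d) → Vec d} (hV : Measurable[coordAlg d T] V)
    (hV2 : MemLp V 2 (twoSided μ)) :
    MemLp (fun ξ => linPart α (ξ k) (V ξ)) 2 (twoSided μ) := by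
  refine ⟨((measurable_linPart α).comp ((measurable_pi_apply k).prodMk
    (hV.mono (coordAlg_le T) le_rfl))).aestronglyMeasurable, ?_⟩
  exact (h.eLpNorm_linPart_eval_le hk hV).trans_lt
    (ENNReal.mul_lt_top ENNReal.coe_lt_top hV2.eLpNorm_lt_top)

lemma integral_step_sub (h : IsContracting α μ r) (hA : IsMeanStep α μ A b) (v : Vec d) :
    ∫ s, (step α s v - b) ∂μ = A (v - b) := by
  have h1 : ∀ s, step α s v - b = linPart α s (v - b) + (step α s b - b) := fun s => by
    rw [← step_sub_step]; abel
  have h2 : Integrable (fun s => step α s b) μ := (h.memLp_step b).integrable one_le_two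
  have h3 : Integrable (fun s => step α s b - b) μ := h2.sub (integrable_const b)
  simp_rw [h1]
  rw [integral_add ((h.memLp_linPart _).integrable one_le_two) h3,
    hA.integral_linPart, integral_sub h2 (integrable_const b), hA.integral_step]
  simp

/-- The norm of a mean is at most the mean of the norm, hence at most the L² norm, so the mean map
inherits the factor r. -/
lemma norm_mean_le (h : IsContracting α μ r) (hA : IsMeanStep α μ A b) (v : Vec d) :
    ‖A v‖ ≤ r * ‖v‖ := by
  rw [← hA.integral_linPart]
  refine (norm_integral_le_integral_norm _).trans
    ((integral_norm_le_eLpNorm_two (h.memLp_linPart v)).trans ?_)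
  refine (ENNReal.toReal_mono (by finiteness) (h.eLpNorm_linPart_le v)).trans (le_of_eq ?_)
  simp

/-- Given the past, the mean of the next state is `b + A (v - b)`, where `v` is the present one. -/
lemma integral_inner_step_smul (h : IsContracting α μ r) (hA : IsMeanStep α μ A b)
    {T : Set ℤ} {k : ℤ} (hk : k ∉ T) {V : (ℤ → Sample d) → Vec d}
    (hV : Measurable[coordAlg d T] V) (hV2 : MemLp V 2 (twoSided μ))
    {G : Type*} [NormedAddCommGroup G] [NormedSpace ℝ G] [MeasurableSpace G] [BorelSpace G]
    [SecondCountableTopology G] [CompleteSpace G] {H : (ℤ → Sample d) → G} (hH : Measurable[coordAlg d T] H)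
    (hH2 : MemLp H 2 (twoSided μ)) (w : Vec d) :
    ∫ ξ, inner ℝ w (step α (ξ k) (V ξ) - b) • H ξ ∂(twoSided μ)
      = ∫ ξ, inner ℝ w (A (V ξ - b)) • H ξ ∂(twoSided μ) := by
  have hVb : Measurable[coordAlg d T] fun ξ => V ξ - b :=
    measurable_vec_sub hV (@measurable_const _ _ _ (coordAlg d T) b)
  have hVm : Measurable V := hV.mono (coordAlg_le T) le_rfl
  have hHm : Measurable H := hH.mono (coordAlg_le T) le_rfl
  -- Decompose the step from V as its linear part at V − b plus the deviation of the step from b;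
  -- each is square integrable.
  have hstep : MemLp (fun ξ : ℤ → Sample d => step α (ξ k) (V ξ) - b) 2 (twoSided μ) := by
    have h1 := (h.memLp_linPart_eval hk hVb (hV2.sub (memLp_const b))).add
      ((h.memLp_step_eval k b).sub (memLp_const b))
    refine h1.congr_norm ((Measurable.step α (measurable_pi_apply k)
      hVm).sub_const b).aestronglyMeasurable (ae_of_all _ fun ξ => ?_)
    simp only [Pi.add_apply, Pi.sub_apply]
    rw [← step_sub_step]
    congr 1
    abel
  have hint : Integrable (fun ξ : ℤ → Sample d => inner ℝ w (step α (ξ k) (V ξ) - b) • H ξ)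
      (twoSided μ) := memLp_one_iff_integrable.1 (hH2.smul (r := 1) (hstep.const_inner w))
  have hVH : Measurable[coordAlg d T] fun ξ => (V ξ, H ξ) := hV.prodMk hH
  have hlaw := hasLaw_prodMk_eval μ hk hVH
  have : IsProbabilityMeasure ((twoSided μ).map fun ξ => (V ξ, H ξ)) :=
    Measure.isProbabilityMeasure_map (hVm.prodMk hHm).aemeasurable
  have hFm : Measurable fun z : Sample d × (Vec d × G) =>
      inner ℝ w (step α z.1 z.2.1 - b) • z.2.2 :=
    (((Measurable.step α measurable_fst (measurable_fst.comp measurable_snd)).sub_const b).const_inner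
      ).smul (measurable_snd.comp measurable_snd)
  have hFi : Integrable (fun z : Sample d × (Vec d × G) =>
      inner ℝ w (step α z.1 z.2.1 - b) • z.2.2)
      (μ.prod ((twoSided μ).map fun ξ => (V ξ, H ξ))) := by
    rw [← hlaw.map_eq, integrable_map_measure hFm.aestronglyMeasurable hlaw.aemeasurable]
    exact hint
  have h1 := hlaw.integral_comp (f := fun z : Sample d × (Vec d × G) =>
      inner ℝ w (step α z.1 z.2.1 - b) • z.2.2) hFm.aestronglyMeasurable
  have h2 : ∀ y : Vec d × G, ∫ s, inner ℝ w (step α s y.1 - b) • y.2 ∂μ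
      = inner ℝ w (A (y.1 - b)) • y.2 := fun y => by
    rw [integral_smul_const, integral_inner, h.integral_step_sub hA]
    exact ((h.memLp_step y.1).sub (memLp_const b)).integrable one_le_two
  calc _ = ∫ z, inner ℝ w (step α z.1 z.2.1 - b) • z.2.2
        ∂(μ.prod ((twoSided μ).map fun ξ => (V ξ, H ξ))) := h1
    _ = ∫ y, inner ℝ w (A (y.1 - b)) • y.2 ∂((twoSided μ).map fun ξ => (V ξ, H ξ)) := by
        rw [integral_prod_symm _ hFi]
        simp_rw [h2]
    _ = _ := integral_map (hVm.prodMk hHm).aemeasurable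
        (by fun_prop)

lemma memLp_stat_sub (h : IsContracting α μ r) (k : ℤ) (b : Vec d) :
    MemLp (fun ξ => stat α k ξ - b) 2 (twoSided μ) :=
  (h.memLp_stat k).sub (memLp_const b)

/-- The test function H may be complex, which gives the martingale property against phases, or real,
which gives the covariance recursion. -/
lemma integral_inner_stat_succ_smul (h : IsContracting α μ r) (hA : IsMeanStep α μ A b) (k : ℤ)
    {G : Type*} [NormedAddCommGroup G] [NormedSpace ℝ G] [MeasurableSpace G] [BorelSpace G]
    [SecondCountableTopology G] [CompleteSpace G] {H : (ℤ → Sample d) → G}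
    (hH : Measurable[coordAlg d (Set.Iic k)] H) (hH2 : MemLp H 2 (twoSided μ)) (w : Vec d) :
    ∫ ξ, inner ℝ w (stat α (k + 1) ξ - b) • H ξ ∂(twoSided μ)
      = ∫ ξ, inner ℝ w (A (stat α k ξ - b)) • H ξ ∂(twoSided μ) := by
  rw [← h.integral_inner_step_smul hA (k := k + 1) (by simp) (measurable_stat_coordAlg α k)
    (h.memLp_stat k) hH hH2]
  refine integral_congr_ae ?_
  filter_upwards [h.ae_stat_eq_step k] with ξ hξ
  rw [hξ]

end IsContracting

/-- The martingale differences `⟨w, (β°_{k+1} - b) - A (β°_k - b)⟩`. -/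
def martDiff (α : ℝ) (A : Vec d →L[ℝ] Vec d) (b w : Vec d) (k : ℤ) (ξ : ℤ → Sample d) : ℝ :=
  inner ℝ w (stat α (k + 1) ξ - b - A (stat α k ξ - b))

lemma measurable_inner_sub_clm {X : Type*} {_ : MeasurableSpace X} (A : Vec d →L[ℝ] Vec d)
    (b w : Vec d) {V V' : X → Vec d} (hV : Measurable V) (hV' : Measurable V') :
    Measurable fun x => inner ℝ w (V' x - b - A (V x - b)) := by
  fun_prop

lemma measurable_martDiff_coordAlg (α : ℝ) (A : Vec d →L[ℝ] Vec d) (b w : Vec d) (k : ℤ) :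
    Measurable[coordAlg d (Set.Iic (k + 1))] (martDiff α A b w k) :=
  measurable_inner_sub_clm A b w
    ((measurable_stat_coordAlg α k).mono
      (coordAlg_mono (Set.Iic_subset_Iic.2 (by omega))) le_rfl)
    (measurable_stat_coordAlg α (k + 1))

lemma measurable_martDiff (α : ℝ) (A : Vec d →L[ℝ] Vec d) (b w : Vec d) (k : ℤ) :
    Measurable (martDiff α A b w k) :=
  (measurable_martDiff_coordAlg α A b w k).mono (coordAlg_le _) le_rfl

lemma measurable_sum_fun {X ι : Type*} {_ : MeasurableSpace X} {f : ι → X → ℝ} {s : Finset ι}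
    (hf : ∀ i ∈ s, Measurable (f i)) : Measurable fun x => ∑ i ∈ s, f i x :=
  Finset.measurable_fun_sum s hf

lemma measurable_cexp_mul_I {X : Type*} {_ : MeasurableSpace X} {f : X → ℝ}
    (hf : Measurable f) (a : ℝ) : Measurable fun x => Complex.exp ((a * f x : ℝ) * Complex.I) := by
  fun_prop

/-- The difference with index j already involves the input j + 1, so a sum over j < n sees the
inputs up to n. -/
lemma measurable_sum_martDiff_coordAlg (α : ℝ) (A : Vec d →L[ℝ] Vec d) (b w : Vec d) (n : ℕ) :
    Measurable[coordAlg d (Set.Iic (n : ℤ))]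
      fun ξ => ∑ j ∈ Finset.range n, martDiff α A b w j ξ :=
  measurable_sum_fun fun j hj => (measurable_martDiff_coordAlg α A b w j).mono
    (coordAlg_mono (Set.Iic_subset_Iic.2 (by have := Finset.mem_range.1 hj; omega))) le_rfl

lemma IsContracting.memLp_inner_sub_clm {V V' : (ℤ → Sample d) → Vec d}
    (hV : MemLp V 2 (twoSided μ)) (hV' : MemLp V' 2 (twoSided μ)) (w : Vec d) :
    MemLp (fun ξ => inner ℝ w (V' ξ - b - A (V ξ - b))) 2 (twoSided μ) :=
  ((hV'.sub (memLp_const b)).sub (A.comp_memLp' (hV.sub (memLp_const b)))).const_inner w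

lemma IsContracting.memLp_martDiff (h : IsContracting α μ r) (w : Vec d) (k : ℤ) :
    MemLp (martDiff α A b w k) 2 (twoSided μ) :=
  memLp_inner_sub_clm (h.memLp_stat k) (h.memLp_stat (k + 1)) w

lemma identDistrib_martDiff (w : Vec d) (k : ℤ) :
    IdentDistrib (martDiff α A b w k) (martDiff α A b w 0) (twoSided μ) (twoSided μ) where
  aemeasurable_fst := (measurable_martDiff α A b w k).aemeasurable
  aemeasurable_snd := (measurable_martDiff α A b w 0).aemeasurable
  map_eq := by
    have h : martDiff α A b w k = martDiff α A b w 0 ∘ fun ξ j => ξ (j + k) := by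
      funext ξ
      simp only [martDiff, Function.comp_apply, stat_shift, zero_add, add_comm k]
    rw [h, ← Measure.map_map (measurable_martDiff α A b w 0) (by fun_prop),
      (measurePreserving_shift μ k).map_eq]

/-- The martingale difference at time `k + m` of the recursion that sits at `b` at time `k`. -/
def truncDiff (α : ℝ) (A : Vec d →L[ℝ] Vec d) (b w : Vec d) (k : ℤ) (m : ℕ)
    (ξ : ℤ → Sample d) : ℝ :=
  inner ℝ w (flow α ξ k (m + 1) b - b - A (flow α ξ k m b - b))

lemma measurable_const_coordAlg {β : Type*} [MeasurableSpace β] (T : Set ℤ) (c : β) :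
    Measurable[coordAlg d T] fun _ : ℤ → Sample d => c :=
  @measurable_const _ _ _ (coordAlg d T) c

lemma measurable_truncDiff_coordAlg (α : ℝ) (A : Vec d →L[ℝ] Vec d) (b w : Vec d) (k : ℤ)
    (m : ℕ) : Measurable[coordAlg d (Set.Ioi k)] (truncDiff α A b w k m) :=
  measurable_inner_sub_clm A b w
    (measurable_flow_coordAlg α (V := fun _ => b) (fun _ hx => hx.1)
      (measurable_const_coordAlg _ b))
    (measurable_flow_coordAlg α (V := fun _ => b) (fun _ hx => hx.1)
      (measurable_const_coordAlg _ b))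

lemma measurable_flow (α : ℝ) (l : ℤ) (n : ℕ) {V : (ℤ → Sample d) → Vec d} (hV : Measurable V) :
    Measurable fun ξ => flow α ξ l n (V ξ) := by
  induction n with
  | zero => exact hV
  | succ n ih => exact Measurable.step α (measurable_pi_apply _) ih

lemma eLpNorm_stat_sub (k : ℤ) (b : Vec d) :
    eLpNorm (fun ξ => stat α k ξ - b) 2 (twoSided μ)
      = eLpNorm (fun ξ => stat α 0 ξ - b) 2 (twoSided μ) := by
  have h0 : (fun ξ : ℤ → Sample d => stat α k ξ - b)
      = (fun ξ => stat α 0 ξ - b) ∘ fun ξ j => ξ (j + k) := by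
    funext ξ; simp only [Function.comp_apply, stat_shift, zero_add]
  rw [h0, eLpNorm_comp_measurePreserving
    ((measurable_stat α 0).sub_const b).aestronglyMeasurable (measurePreserving_shift μ k)]

lemma IsContracting.eLpNorm_flow_stat_sub_le (h : IsContracting α μ r) (k : ℤ) (n : ℕ)
    (b : Vec d) :
    eLpNorm (fun ξ => flow α ξ k n (stat α k ξ) - flow α ξ k n b) 2 (twoSided μ)
      ≤ r ^ n * eLpNorm (fun ξ => stat α 0 ξ - b) 2 (twoSided μ) := by
  rw [← eLpNorm_stat_sub k]
  exact h.eLpNorm_flow_sub_le n (V := stat α k) (V' := fun _ => b) (measurable_stat_coordAlg α k)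
    (measurable_const_coordAlg _ b)

/-- The stationary trajectory and the one restarted at b at time k share their inputs afterwards.
The difference is linear in their distances after m and m + 1 steps, both geometrically small. -/
lemma IsContracting.eLpNorm_martDiff_sub_truncDiff_le (h : IsContracting α μ r) (w : Vec d)
    (k : ℤ) (m : ℕ) :
    eLpNorm (fun ξ => martDiff α A b w (k + m) ξ - truncDiff α A b w k m ξ) 2 (twoSided μ)
      ≤ r ^ m * (‖w‖ₑ * (1 + ‖A‖ₑ) * eLpNorm (fun ξ => stat α 0 ξ - b) 2 (twoSided μ)) := by
  set Δ : ℕ → (ℤ → Sample d) → Vec d := fun n ξ =>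
    flow α ξ k n (stat α k ξ) - flow α ξ k n b with hΔ
  have hΔle : ∀ n, eLpNorm (Δ n) 2 (twoSided μ)
      ≤ r ^ n * eLpNorm (fun ξ => stat α 0 ξ - b) 2 (twoSided μ) := fun n =>
    h.eLpNorm_flow_stat_sub_le k n b
  have hΔm : ∀ n, AEStronglyMeasurable (Δ n) (twoSided μ) := fun n =>
    ((measurable_flow α k n (measurable_stat α k)).sub
      (measurable_flow α k n measurable_const)).aestronglyMeasurable
  have hXY : (fun ξ => martDiff α A b w (k + m) ξ - truncDiff α A b w k m ξ) =ᵐ[twoSided μ]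
      fun ξ => inner ℝ w (Δ (m + 1) ξ - A (Δ m ξ)) := by
    filter_upwards [h.ae_stat_eq_flow k m, h.ae_stat_eq_flow k (m + 1)] with ξ h1 h2
    simp only [martDiff, truncDiff, hΔ, ← inner_sub_right]
    push_cast at h2 ⊢
    rw [add_assoc, h1, h2, map_sub, map_sub, map_sub]
    congr 1
    abel
  have hAΔ : AEStronglyMeasurable (fun ξ => A (Δ m ξ)) (twoSided μ) :=
    A.continuous.comp_aestronglyMeasurable (hΔm m)
  rw [eLpNorm_congr_ae hXY]
  calc eLpNorm (fun ξ => inner ℝ w (Δ (m + 1) ξ - A (Δ m ξ))) 2 (twoSided μ)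
      ≤ ‖w‖ₑ * eLpNorm (fun ξ => Δ (m + 1) ξ - A (Δ m ξ)) 2 (twoSided μ) := by
        refine eLpNorm_le_mul_eLpNorm_of_ae_le_mul'' (p := 2)
          ((hΔm (m + 1)).sub hAΔ) (ae_of_all _ fun ξ => ?_)
        exact enorm_inner_le w _
    _ ≤ ‖w‖ₑ * (eLpNorm (Δ (m + 1)) 2 (twoSided μ) + ‖A‖ₑ * eLpNorm (Δ m) 2 (twoSided μ)) := by
        gcongr
        refine (eLpNorm_sub_le (hΔm (m + 1)) hAΔ one_le_two).trans ?_
        gcongr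
        exact eLpNorm_le_mul_eLpNorm_of_ae_le_mul'' (p := 2) (hΔm m)
          (ae_of_all _ fun ξ => A.le_opENorm _)
    _ ≤ ‖w‖ₑ * (r ^ m * eLpNorm (fun ξ => stat α 0 ξ - b) 2 (twoSided μ)
          + ‖A‖ₑ * (r ^ m * eLpNorm (fun ξ => stat α 0 ξ - b) 2 (twoSided μ))) := by
        gcongr
        · refine (hΔle (m + 1)).trans ?_
          gcongr ?_ * _
          exact pow_le_pow_right_of_le_one' (by exact_mod_cast h.lt_one.le) (Nat.le_succ m)
        · exact hΔle m
    _ = _ := by ring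

/-- The central limit theorem for the martingale part of the stationary sequence. -/
theorem IsContracting.tendsto_integral_cexp_martDiff (h : IsContracting α μ r)
    (hA : IsMeanStep α μ A b) (w : Vec d) :
    Tendsto (fun n : ℕ => ∫ ξ, Complex.exp (((√(n : ℝ))⁻¹ *
      ∑ j ∈ Finset.range n, martDiff α A b w j ξ : ℝ) * Complex.I) ∂(twoSided μ)) atTop
      (𝓝 (Complex.exp (-((∫ ξ, martDiff α A b w 0 ξ ^ 2 ∂(twoSided μ) : ℝ) : ℂ) / 2))) := by
  refine tendsto_integral_cexp_of_martingale (X := fun k : ℕ => martDiff α A b w k)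
    (h.memLp_martDiff w 0) (fun k => identDistrib_martDiff w k) rfl ?_ ?_
  · intro k a
    have hSm := measurable_sum_martDiff_coordAlg α A b w k
    set H : (ℤ → Sample d) → ℂ := fun ξ => Complex.exp
      ((a * ∑ j ∈ Finset.range k, martDiff α A b w j ξ : ℝ) * Complex.I) with hH
    have hHm : Measurable[coordAlg d (Set.Iic (k : ℤ))] H := measurable_cexp_mul_I hSm a
    have hHm' : Measurable H := hHm.mono (coordAlg_le _) le_rfl
    have hH2 : MemLp H 2 (twoSided μ) := MemLp.of_bound hHm'.aestronglyMeasurable 1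
      (ae_of_all _ fun ξ => (Complex.norm_exp_ofReal_mul_I _).le)
    have h1 := h.integral_inner_stat_succ_smul hA (k : ℤ) hHm hH2 w
    have hi1 : Integrable (fun ξ => inner ℝ w (stat α (k + 1) ξ - b) • H ξ) (twoSided μ) :=
      memLp_one_iff_integrable.1 (hH2.smul (r := 1) ((h.memLp_stat_sub (k + 1) b).const_inner (𝕜 := ℝ) w))
    have hi2 : Integrable (fun ξ => inner ℝ w (A (stat α k ξ - b)) • H ξ) (twoSided μ) :=
      memLp_one_iff_integrable.1 (hH2.smul (r := 1)
        ((A.comp_memLp' (h.memLp_stat_sub k b)).const_inner (𝕜 := ℝ) w))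
    rw [← sub_eq_zero, ← integral_sub hi1 hi2] at h1
    rw [← h1]
    refine integral_congr_ae (ae_of_all _ fun ξ => ?_)
    have hM : martDiff α A b w k ξ
        = inner ℝ w (stat α (k + 1) ξ - b) - inner ℝ w (A (stat α k ξ - b)) := by
      rw [martDiff, inner_sub_right]
    change H ξ * (martDiff α A b w k ξ : ℂ) = _
    beta_reduce
    rw [hM, ← sub_smul, Complex.real_smul, mul_comm]
  · intro η hη
    set v := ∫ ξ, martDiff α A b w 0 ξ ^ 2 ∂(twoSided μ) with hv
    have hv0 : 0 ≤ v := integral_nonneg fun ξ => sq_nonneg _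
    set K : ℝ≥0∞ := ‖w‖ₑ * (1 + ‖A‖ₑ) * eLpNorm (fun ξ => stat α 0 ξ - b) 2 (twoSided μ) with hK
    have hKtop : K ≠ ∞ := ENNReal.mul_ne_top (by finiteness) (h.memLp_stat_sub 0 b).eLpNorm_ne_top
    have hr : (r : ℝ) < 1 := by exact_mod_cast h.lt_one
    -- This makes θv ≤ η/4, with v + 1 avoiding division by zero. The other summand is brought below
    -- η/4 by m, and the factor 2 from the decorrelation bound gives η.
    set θ : ℝ := η / (4 * (v + 1)) with hθ
    have hθ0 : 0 < θ := by positivity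
    have hlim : Tendsto (fun m : ℕ => (1 + θ⁻¹) * ((r : ℝ) ^ m * K.toReal) ^ 2) atTop (𝓝 0) := by
      have := (((tendsto_pow_atTop_nhds_zero_of_lt_one r.2 hr).mul_const K.toReal).pow 2).const_mul
        (1 + θ⁻¹)
      simpa using this
    obtain ⟨m, hm⟩ := ((tendsto_order.1 hlim).2 (η / 4) (by positivity)).exists
    refine ⟨m, fun k a => ?_⟩
    simp only [Nat.cast_add]
    set Y : (ℤ → Sample d) → ℝ := truncDiff α A b w k m with hY
    have hYm : Measurable[coordAlg d (Set.Ioi (k : ℤ))] Y :=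
      measurable_truncDiff_coordAlg α A b w k m
    have hind : IndepFun (fun ξ => ∑ j ∈ Finset.range k, martDiff α A b w j ξ) Y (twoSided μ) :=
      indepFun_of_disjoint μ (T := Set.Iic (k : ℤ)) (T' := Set.Ioi (k : ℤ)) (Set.Iic_disjoint_Ioi le_rfl)
        (measurable_sum_martDiff_coordAlg α A b w k) hYm
    have hX := h.memLp_martDiff (A := A) (b := b) w ((k : ℤ) + (m : ℤ))
    have hXYle : eLpNorm (fun ξ => martDiff α A b w ((k : ℤ) + (m : ℤ)) ξ - Y ξ) 2 (twoSided μ)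
        ≤ r ^ m * K := h.eLpNorm_martDiff_sub_truncDiff_le w k m
    have hXYm : AEStronglyMeasurable (fun ξ => martDiff α A b w ((k : ℤ) + (m : ℤ)) ξ - Y ξ)
        (twoSided μ) := hX.1.sub (hYm.mono (coordAlg_le _) le_rfl).aestronglyMeasurable
    have hXYmem : MemLp (fun ξ => martDiff α A b w ((k : ℤ) + (m : ℤ)) ξ - Y ξ) 2 (twoSided μ) :=
      ⟨hXYm, hXYle.trans_lt (ENNReal.mul_lt_top (by finiteness) hKtop.lt_top)⟩
    have hYmem : MemLp Y 2 (twoSided μ) := by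
      have := hX.sub hXYmem
      refine this.ae_eq (ae_of_all _ fun ξ => ?_)
      simp
    have hvk : ∫ ξ, martDiff α A b w ((k : ℤ) + (m : ℤ)) ξ ^ 2 ∂(twoSided μ) = v :=
      ((identDistrib_martDiff w _).comp (u := fun x => x ^ 2) (by fun_prop)).integral_eq
    refine (norm_integral_cexp_mul_sq_sub_le
      ((measurable_sum_martDiff_coordAlg α A b w k).mono (coordAlg_le _) le_rfl) hX hYmem hind
      hvk a).trans ?_
    have h5 := integral_abs_sq_sub_sq_le hX hYmem hθ0
    rw [hvk] at h5
    have h6 : ∫ ξ, (martDiff α A b w ((k : ℤ) + (m : ℤ)) ξ - Y ξ) ^ 2 ∂(twoSided μ)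
        ≤ ((r : ℝ) ^ m * K.toReal) ^ 2 := by
      have h7 := integral_norm_sq_eq hXYm
      simp only [Real.norm_eq_abs, sq_abs] at h7
      rw [h7]
      gcongr
      refine (ENNReal.toReal_mono (by finiteness) hXYle).trans (le_of_eq ?_)
      simp
    have h8 : θ * v ≤ η / 4 := by
      rw [hθ, div_mul_eq_mul_div, div_le_div_iff₀ (by positivity) (by norm_num)]
      nlinarith
    have h9 := mul_le_mul_of_nonneg_left h6 (show 0 ≤ 1 + θ⁻¹ by positivity)
    linarith

end DropoutSGD
end

noncomputable section
namespace DropoutSGD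

/-! ### The long-run covariance -/

variable {d : ℕ} {α : ℝ} {μ : Measure (Sample d)} [IsProbabilityMeasure μ] {r : ℝ≥0}
  {A : Vec d →L[ℝ] Vec d} {b : Vec d}

/-- The covariance `E ⟨v, β°_0 - b⟩ ⟨w, β°_k - b⟩`. -/
def crossCov (α : ℝ) (μ : Measure (Sample d)) (b : Vec d) (k : ℤ) (v w : Vec d) : ℝ :=
  ∫ ξ, inner ℝ v (stat α 0 ξ - b) * inner ℝ w (stat α k ξ - b) ∂(twoSided μ)

lemma crossCov_neg (k : ℤ) (v w : Vec d) : crossCov α μ b (-k) v w = crossCov α μ b k w v := by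
  have hm : Measurable fun ξ : ℤ → Sample d =>
      inner ℝ v (stat α 0 ξ - b) * inner ℝ w (stat α (-k) ξ - b) := by
    have h1 := measurable_stat (d := d) α 0
    have h2 := measurable_stat (d := d) α (-k)
    fun_prop
  unfold crossCov
  rw [← (measurePreserving_shift μ k).map_eq,
    integral_map (measurePreserving_shift μ k).measurable.aemeasurable
      hm.aestronglyMeasurable, (measurePreserving_shift μ k).map_eq]
  simp only [stat_shift, zero_add, neg_add_cancel, mul_comm]

namespace IsContracting

lemma integrable_crossCov (h : IsContracting α μ r) (k l : ℤ) (v w : Vec d) :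
    Integrable (fun ξ => inner ℝ v (stat α k ξ - b) * inner ℝ w (stat α l ξ - b)) (twoSided μ) :=
  ((h.memLp_stat_sub k b).const_inner v).integrable_mul ((h.memLp_stat_sub l b).const_inner w)

/-- Averaging over the newest input replaces Z_{n+1} by A Z_n, and symmetry of A moves the operator
onto the test vector. -/
lemma crossCov_nat (h : IsContracting α μ r) (hA : IsMeanStep α μ A b) (n : ℕ) (v w : Vec d) :
    crossCov α μ b n v w = crossCov α μ b 0 v ((A ^ n) w) := by
  induction n generalizing w with
  | zero => simp
  | succ n ih =>
    have h1 := h.integral_inner_stat_succ_smul hA (n : ℤ) (G := ℝ)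
      (H := fun ξ => inner ℝ v (stat α 0 ξ - b))
      (Measurable.const_inner (measurable_vec_sub ((measurable_stat_coordAlg α 0).mono
        (coordAlg_mono (Set.Iic_subset_Iic.2 (by omega))) le_rfl) (measurable_const_coordAlg _ b)))
      ((h.memLp_stat_sub 0 b).const_inner v) w
    simp_rw [hA.symm, smul_eq_mul, mul_comm _ (inner ℝ v _)] at h1
    rw [pow_succ, mul_apply_eq_comp, ← ih, crossCov, crossCov, ← h1]
    push_cast
    rfl

lemma crossCov_sub_right (h : IsContracting α μ r) (k : ℤ) (u v w : Vec d) :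
    crossCov α μ b k u (v - w) = crossCov α μ b k u v - crossCov α μ b k u w := by
  unfold crossCov
  rw [← integral_sub (h.integrable_crossCov _ _ _ _) (h.integrable_crossCov _ _ _ _)]
  simp_rw [inner_sub_left, mul_sub]

lemma crossCov_zero_comm (v w : Vec d) : crossCov α μ b 0 v w = crossCov α μ b 0 w v := by
  rw [← crossCov_neg, neg_zero]

lemma abs_crossCov_zero_le (h : IsContracting α μ r) (v w : Vec d) :
    |crossCov α μ b 0 v w| ≤ ‖v‖ * ‖w‖ * ∫ ξ, ‖stat α 0 ξ - b‖ ^ 2 ∂(twoSided μ) := by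
  rw [← integral_const_mul, crossCov, ← Real.norm_eq_abs]
  refine norm_integral_le_of_norm_le ((h.memLp_stat_sub 0 b).norm.integrable_sq.const_mul _)
    (ae_of_all _ fun ξ => ?_)
  rw [norm_mul]
  calc _ ≤ (‖v‖ * ‖stat α 0 ξ - b‖) * (‖w‖ * ‖stat α 0 ξ - b‖) := by
        gcongr <;> exact norm_inner_le_norm _ _
    _ = _ := by ring

lemma norm_mean_pow_le (h : IsContracting α μ r) (hA : IsMeanStep α μ A b) (n : ℕ) (w : Vec d) :
    ‖(A ^ n) w‖ ≤ r ^ n * ‖w‖ := by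
  induction n with
  | zero => simp
  | succ n ih =>
    rw [pow_succ', mul_apply_eq_comp, pow_succ', mul_assoc]
    exact (h.norm_mean_le hA _).trans (by gcongr)

lemma summable_crossCov_nat (h : IsContracting α μ r) (hA : IsMeanStep α μ A b) (v w : Vec d) :
    Summable fun n : ℕ => crossCov α μ b n v w := by
  have hr : (r : ℝ) < 1 := by exact_mod_cast h.lt_one
  have hC := h.abs_crossCov_zero_le (b := b) v
  have hC0 : 0 ≤ ∫ ξ, ‖stat α 0 ξ - b‖ ^ 2 ∂(twoSided μ) := integral_nonneg fun ξ => sq_nonneg _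
  generalize (∫ ξ, ‖stat α 0 ξ - b‖ ^ 2 ∂(twoSided μ)) = C at hC hC0
  have hsum : Summable fun n : ℕ => (r : ℝ) ^ n * (‖v‖ * ‖w‖ * C) :=
    (summable_geometric_of_lt_one r.coe_nonneg hr).mul_right _
  refine hsum.of_norm_bounded fun n => ?_
  rw [h.crossCov_nat hA, Real.norm_eq_abs]
  refine (hC _).trans ?_
  calc ‖v‖ * ‖(A ^ n) w‖ * C ≤ ‖v‖ * (r ^ n * ‖w‖) * C := by
        gcongr
        exact h.norm_mean_pow_le hA n w
    _ = _ := by ring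

lemma summable_crossCov (h : IsContracting α μ r) (hA : IsMeanStep α μ A b) (v w : Vec d) :
    Summable fun k : ℤ => crossCov α μ b k v w :=
  Summable.of_nat_of_neg (h.summable_crossCov_nat hA v w)
    (by simpa only [crossCov_neg] using h.summable_crossCov_nat hA w v)

/-- Along s − As the terms are consecutive differences of the covariances with Aⁿs, so the series
telescopes. -/
lemma hasSum_crossCov_nat (h : IsContracting α μ r) (hA : IsMeanStep α μ A b) (v s : Vec d) :
    HasSum (fun n : ℕ => crossCov α μ b n v (s - A s)) (crossCov α μ b 0 v s) := by
  have hr : (r : ℝ) < 1 := by exact_mod_cast h.lt_one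
  have hs := (h.summable_crossCov_nat hA v (s - A s)).hasSum
  have hlim : Tendsto (fun n : ℕ => crossCov α μ b 0 v ((A ^ n) s)) atTop (𝓝 0) := by
    have := (h.summable_crossCov_nat hA v s).tendsto_atTop_zero
    exact this.congr fun n => h.crossCov_nat hA n v s
  have hpart : ∀ N : ℕ, ∑ n ∈ Finset.range N, crossCov α μ b n v (s - A s)
      = crossCov α μ b 0 v s - crossCov α μ b 0 v ((A ^ N) s) := fun N => by
    have : ∀ n : ℕ, crossCov α μ b n v (s - A s)
        = crossCov α μ b 0 v ((A ^ n) s) - crossCov α μ b 0 v ((A ^ (n + 1)) s) := fun n => by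
      rw [h.crossCov_nat hA, map_sub, h.crossCov_sub_right, pow_succ,
        mul_apply_eq_comp]
    simp_rw [this]
    rw [Finset.sum_range_sub']
    simp
  have h1 := hs.tendsto_sum_nat
  simp_rw [hpart] at h1
  have h2 : Tendsto (fun N : ℕ => crossCov α μ b 0 v s - crossCov α μ b 0 v ((A ^ N) s)) atTop
      (𝓝 (crossCov α μ b 0 v s)) := by simpa using hlim.const_sub (crossCov α μ b 0 v s)
  rwa [tendsto_nhds_unique h1 h2] at hs

/-- Expand the square. Stationarity treats ⟨s, Z_1⟩², and the cross term reduces to the last one by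
the covariance recursion. -/
lemma integral_martDiff_sq (h : IsContracting α μ r) (hA : IsMeanStep α μ A b) (s : Vec d) :
    ∫ ξ, martDiff α A b s 0 ξ ^ 2 ∂(twoSided μ)
      = crossCov α μ b 0 s s - crossCov α μ b 0 (A s) (A s) := by
  have h11 : ∫ ξ, inner ℝ s (stat α 1 ξ - b) * inner ℝ s (stat α 1 ξ - b) ∂(twoSided μ)
      = crossCov α μ b 0 s s := by
    have hm : Measurable fun ξ : ℤ → Sample d =>
        inner ℝ s (stat α 0 ξ - b) * inner ℝ s (stat α 0 ξ - b) := by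
      have h1 := measurable_stat (d := d) α 0
      fun_prop
    unfold crossCov
    rw [← (measurePreserving_shift μ 1).map_eq,
      integral_map (measurePreserving_shift μ 1).measurable.aemeasurable
        hm.aestronglyMeasurable, (measurePreserving_shift μ 1).map_eq]
    simp only [stat_shift, zero_add]
  have h01 : crossCov α μ b 1 (A s) s = crossCov α μ b 0 (A s) (A s) := by
    have := h.crossCov_nat hA 1 (A s) s
    simpa using this
  have hpt : ∀ ξ, martDiff α A b s 0 ξ ^ 2
      = inner ℝ s (stat α 1 ξ - b) * inner ℝ s (stat α 1 ξ - b)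
        - 2 * (inner ℝ (A s) (stat α 0 ξ - b) * inner ℝ s (stat α 1 ξ - b))
        + inner ℝ (A s) (stat α 0 ξ - b) * inner ℝ (A s) (stat α 0 ξ - b) := fun ξ => by
    rw [martDiff, inner_sub_right, hA.symm, zero_add]
    ring
  have hi : Integrable (fun ξ => inner ℝ s (stat α 1 ξ - b) * inner ℝ s (stat α 1 ξ - b)
      - 2 * (inner ℝ (A s) (stat α 0 ξ - b) * inner ℝ s (stat α 1 ξ - b))) (twoSided μ) :=
    (h.integrable_crossCov _ _ _ _).sub ((h.integrable_crossCov _ _ _ _).const_mul 2)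
  simp_rw [hpt]
  rw [integral_add hi (h.integrable_crossCov _ _ _ _),
    integral_sub (h.integrable_crossCov _ _ _ _) ((h.integrable_crossCov _ _ _ _).const_mul 2),
    integral_const_mul, h11]
  change crossCov α μ b 0 s s - 2 * crossCov α μ b 1 (A s) s + crossCov α μ b 0 (A s) (A s) = _
  rw [h01]
  ring

/-- The two one-sided series agree by shift invariance and both contain the term k = 0, which is
subtracted once. By symmetry of the covariance at lag 0 the remainder is the variance of the
martingale difference. -/
lemma hasSum_crossCov_self (h : IsContracting α μ r) (hA : IsMeanStep α μ A b) (s : Vec d) :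
    HasSum (fun k : ℤ => crossCov α μ b k (s - A s) (s - A s))
      (∫ ξ, martDiff α A b s 0 ξ ^ 2 ∂(twoSided μ)) := by
  have h1 := HasSum.of_nat_of_neg (f := fun k : ℤ => crossCov α μ b k (s - A s) (s - A s))
    (h.hasSum_crossCov_nat hA (s - A s) s)
    (by simpa only [crossCov_neg] using h.hasSum_crossCov_nat hA (s - A s) s)
  have hc : crossCov α μ b 0 (A s) s = crossCov α μ b 0 s (A s) := crossCov_zero_comm _ _
  have hl : ∀ w, crossCov α μ b 0 (s - A s) w
      = crossCov α μ b 0 s w - crossCov α μ b 0 (A s) w := fun w => by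
    rw [crossCov_zero_comm, h.crossCov_sub_right, crossCov_zero_comm, crossCov_zero_comm w]
  have heq : crossCov α μ b 0 (s - A s) s + crossCov α μ b 0 (s - A s) s
      - crossCov α μ b 0 (s - A s) (s - A s) = ∫ ξ, martDiff α A b s 0 ξ ^ 2 ∂(twoSided μ) := by
    rw [h.integral_martDiff_sq hA, h.crossCov_sub_right, hl, hl, hc]
    ring
  rwa [heq] at h1

/-- A strict contraction fixes only 0, so I − A is injective, hence surjective in finite dimension.
This solves the Poisson equation behind the martingale approximation. -/
lemma exists_sub_mean_eq (h : IsContracting α μ r) (hA : IsMeanStep α μ A b) (t : Vec d) :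
    ∃ s : Vec d, s - A s = t := by
  have hr : (r : ℝ) < 1 := by exact_mod_cast h.lt_one
  set L : Vec d →ₗ[ℝ] Vec d := LinearMap.id - (A : Vec d →ₗ[ℝ] Vec d) with hL
  have hinj : Function.Injective L := by
    rw [← LinearMap.ker_eq_bot, LinearMap.ker_eq_bot']
    intro v hv
    have hv' : v = A v := by simpa [hL, sub_eq_zero] using hv
    have h1 := h.norm_mean_le hA v
    rw [← hv'] at h1
    have : ‖v‖ ≤ 0 := by nlinarith [norm_nonneg v]
    simpa using this
  obtain ⟨s, hs⟩ := LinearMap.injective_iff_surjective.1 hinj t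
  exact ⟨s, by simpa [hL] using hs⟩

omit [IsProbabilityMeasure μ] in
lemma autocov_apply (k : ℤ) (i j : Fin d) : autocov α μ b k i j
    = crossCov α μ b k (EuclideanSpace.single i 1) (EuclideanSpace.single j 1) := by
  simp [autocov, crossCov, EuclideanSpace.inner_single_left]

lemma dotProduct_autocov_mulVec (h : IsContracting α μ r) (k : ℤ) (v w : Vec d) :
    v.ofLp ⬝ᵥ (autocov α μ b k *ᵥ w.ofLp) = crossCov α μ b k v w := by
  have hi : ∀ i j, Integrable (fun ξ => v i * ((stat α 0 ξ i - b i) * (stat α k ξ j - b j) * w j))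
      (twoSided μ) := fun i j => by
    have := h.integrable_crossCov (b := b) 0 k (EuclideanSpace.single i 1)
      (EuclideanSpace.single j 1)
    simp only [EuclideanSpace.inner_single_left, map_one, one_mul, PiLp.sub_apply] at this
    exact (this.mul_const _).const_mul _
  simp only [dotProduct, Matrix.mulVec, autocov, Matrix.of_apply, Finset.mul_sum, crossCov]
  simp_rw [← integral_mul_const, ← integral_const_mul]
  simp_rw [← integral_finsetSum _ fun j _ => hi _ j]
  rw [← integral_finsetSum _ fun i _ => integrable_finsetSum _ fun j _ => hi i j]
  refine integral_congr_ae (ae_of_all _ fun ξ => ?_)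
  simp only [PiLp.inner_apply, PiLp.sub_apply, Finset.sum_mul_sum]
  refine Finset.sum_congr rfl fun i _ => Finset.sum_congr rfl fun j _ => ?_
  simp
  ring

lemma summable_autocov (h : IsContracting α μ r) (hA : IsMeanStep α μ A b) :
    Summable fun k : ℤ => autocov α μ b k := by
  refine Pi.summable.2 fun i => Pi.summable.2 fun j => ?_
  simp_rw [autocov_apply]
  exact h.summable_crossCov hA _ _

lemma dotProduct_longRunCov_mulVec (h : IsContracting α μ r) (hA : IsMeanStep α μ A b)
    (s : Vec d) :
    (s - A s).ofLp ⬝ᵥ (longRunCov α μ b *ᵥ (s - A s).ofLp)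
      = ∫ ξ, martDiff α A b s 0 ξ ^ 2 ∂(twoSided μ) := by
  set t := s - A s with ht
  let φ : Matrix (Fin d) (Fin d) ℝ →+ ℝ :=
    { toFun := fun M => t.ofLp ⬝ᵥ (M *ᵥ t.ofLp)
      map_zero' := by simp
      map_add' := fun M N => by rw [Matrix.add_mulVec, dotProduct_add] }
  have hφ : Continuous φ := by
    change Continuous fun M : Matrix (Fin d) (Fin d) ℝ => t.ofLp ⬝ᵥ (M *ᵥ t.ofLp)
    fun_prop
  have h1 := (h.summable_autocov hA).hasSum.map φ hφ
  have h2 : (φ ∘ fun k => autocov α μ b k) = fun k => crossCov α μ b k t t :=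
    funext fun k => h.dotProduct_autocov_mulVec k t t
  rw [h2] at h1
  exact h1.unique (h.hasSum_crossCov_self hA s)

lemma posSemidef_longRunCov (h : IsContracting α μ r) (hA : IsMeanStep α μ A b) :
    (longRunCov α μ b).PosSemidef := by
  refine Matrix.PosSemidef.of_dotProduct_mulVec_nonneg ?_ fun x => ?_
  · have hs := h.summable_autocov hA
    have hneg : ∀ k, autocov α μ b (-k) = (autocov α μ b k)ᵀ := fun k => by
      ext i j
      rw [Matrix.transpose_apply, autocov_apply, autocov_apply, crossCov_neg]
    rw [Matrix.IsHermitian, Matrix.conjTranspose_eq_transpose_of_trivial, longRunCov,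
      Matrix.transpose_tsum]
    simp_rw [← hneg]
    exact (Equiv.neg ℤ).tsum_eq (fun k => autocov α μ b k)
  · obtain ⟨s, hs⟩ := h.exists_sub_mean_eq hA (WithLp.toLp 2 x)
    have h1 := h.dotProduct_longRunCov_mulVec hA s
    rw [hs] at h1
    simp only [star_trivial]
    rw [h1]
    exact integral_nonneg fun ξ => sq_nonneg _

/-! ### The quenched central limit theorem -/

/-- The sum of the iterates started at `b₀` is within a bounded distance of the martingale part of
the stationary sequence. -/
lemma exists_integral_abs_sub_sum_martDiff_le (h : IsContracting α μ r)
    (hA : IsMeanStep α μ A b) (b₀ s : Vec d) :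
    ∃ K : ℝ, ∀ n : ℕ,
      Integrable (fun ξ => inner ℝ (∑ j ∈ Finset.range n, (flow α ξ 0 (j + 1) b₀ - b)) (s - A s)
        - ∑ j ∈ Finset.range n, martDiff α A b s j ξ) (twoSided μ) ∧
      ∫ ξ, |inner ℝ (∑ j ∈ Finset.range n, (flow α ξ 0 (j + 1) b₀ - b)) (s - A s)
        - ∑ j ∈ Finset.range n, martDiff α A b s j ξ| ∂(twoSided μ) ≤ K := by
  have hr : (r : ℝ) < 1 := by exact_mod_cast h.lt_one
  set Z := fun (k : ℤ) (ξ : ℤ → Sample d) => stat α k ξ - b with hZ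
  set Δ := fun (n : ℕ) (ξ : ℤ → Sample d) => stat α n ξ - flow α ξ 0 n b₀ with hΔ
  set c := eLpNorm (fun ξ => stat α 0 ξ - b₀) 2 (twoSided μ) with hc
  have hctop : c ≠ ∞ := (h.memLp_stat_sub 0 b₀).eLpNorm_ne_top
  have hΔae : ∀ n : ℕ, Δ n =ᵐ[twoSided μ]
      fun ξ => flow α ξ 0 n (stat α 0 ξ) - flow α ξ 0 n b₀ := fun n => by
    filter_upwards [h.ae_stat_eq_flow 0 n] with ξ hξ
    rw [zero_add] at hξ
    simp only [hΔ]
    rw [hξ]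
  have hΔm : ∀ n, AEStronglyMeasurable (Δ n) (twoSided μ) := fun n =>
    ((measurable_stat α n).sub (measurable_flow α 0 n measurable_const)).aestronglyMeasurable
  have hΔle : ∀ n : ℕ, eLpNorm (Δ n) 2 (twoSided μ) ≤ r ^ n * c := fun n => by
    rw [eLpNorm_congr_ae (hΔae n)]
    exact h.eLpNorm_flow_stat_sub_le 0 n b₀
  have hΔmem : ∀ n, MemLp (Δ n) 2 (twoSided μ) := fun n =>
    ⟨hΔm n, (hΔle n).trans_lt (ENNReal.mul_lt_top (by finiteness) hctop.lt_top)⟩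
  have hΔint : ∀ n, ∫ ξ, ‖Δ n ξ‖ ∂(twoSided μ) ≤ r ^ n * c.toReal := fun n => by
    refine (integral_norm_le_eLpNorm_two (hΔmem n)).trans
      ((ENNReal.toReal_mono (by finiteness) (hΔle n)).trans (le_of_eq ?_))
    simp
  have hZi : ∀ k, Integrable (Z k) (twoSided μ) := fun k =>
    (h.memLp_stat_sub k b).integrable one_le_two
  have hZint : ∀ k, ∫ ξ, ‖Z k ξ‖ ∂(twoSided μ)
      ≤ (eLpNorm (fun ξ => stat α 0 ξ - b) 2 (twoSided μ)).toReal := fun k => by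
    refine (integral_norm_le_eLpNorm_two (h.memLp_stat_sub k b)).trans (le_of_eq ?_)
    rw [eLpNorm_stat_sub]
  set e := (eLpNorm (fun ξ => stat α 0 ξ - b) 2 (twoSided μ)).toReal with he
  -- Since ⟨s − As, Z_{j+1}⟩ = M_j + ⟨As, Z_j⟩ − ⟨As, Z_{j+1}⟩, summation leaves only two boundary
  -- terms and the gaps Δ between the stationary and the actual trajectory.
  have hpt : ∀ (n : ℕ) ξ, inner ℝ (∑ j ∈ Finset.range n, (flow α ξ 0 (j + 1) b₀ - b)) (s - A s)
        - ∑ j ∈ Finset.range n, martDiff α A b s j ξ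
      = inner ℝ (A s) (Z 0 ξ) - inner ℝ (A s) (Z n ξ)
        - ∑ j ∈ Finset.range n, inner ℝ (s - A s) (Δ (j + 1) ξ) := fun n ξ => by
    induction n with
    | zero => simp
    | succ n ih =>
      rw [Finset.sum_range_succ, Finset.sum_range_succ, Finset.sum_range_succ, inner_add_left]
      have hM : martDiff α A b s n ξ
          = inner ℝ s (Z ((n + 1 : ℕ) : ℤ) ξ) - inner ℝ (A s) (Z n ξ) := by
        rw [martDiff, inner_sub_right, hA.symm]
        simp [hZ]
      have hF : flow α ξ 0 (n + 1) b₀ - b = Z ((n + 1 : ℕ) : ℤ) ξ - Δ (n + 1) ξ := by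
        simp [hZ, hΔ]
      have hI : inner ℝ (flow α ξ 0 (n + 1) b₀ - b) (s - A s)
          = inner ℝ s (Z ((n + 1 : ℕ) : ℤ) ξ) - inner ℝ (A s) (Z ((n + 1 : ℕ) : ℤ) ξ)
            - inner ℝ (s - A s) (Δ (n + 1) ξ) := by
        rw [real_inner_comm, hF, inner_sub_right, inner_sub_left]
      linarith
  have hi1 : ∀ k, Integrable (fun ξ => inner ℝ (A s) (Z k ξ)) (twoSided μ) := fun k =>
    (hZi k).const_inner _
  have hi2 : ∀ n, Integrable (fun ξ => inner ℝ (s - A s) (Δ n ξ)) (twoSided μ) := fun n =>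
    ((hΔmem n).integrable one_le_two).const_inner _
  -- The first summand pays for the two boundary terms, the second for the geometric series of the
  -- gaps.
  refine ⟨‖A s‖ * (2 * e) + ‖s - A s‖ * ((1 - (r : ℝ))⁻¹ * c.toReal), fun n => ?_⟩
  simp_rw [hpt]
  refine ⟨((hi1 0).sub (hi1 n)).sub (integrable_finsetSum _ fun j _ => hi2 _), ?_⟩
  have hbi : Integrable (fun ξ => ‖A s‖ * (‖Z 0 ξ‖ + ‖Z n ξ‖)
      + ‖s - A s‖ * ∑ j ∈ Finset.range n, ‖Δ (j + 1) ξ‖) (twoSided μ) :=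
    (((hZi 0).norm.add (hZi n).norm).const_mul _).add ((integrable_finsetSum _ fun j _ =>
      ((hΔmem _).integrable one_le_two).norm).const_mul _)
  calc _ ≤ ∫ ξ, (‖A s‖ * (‖Z 0 ξ‖ + ‖Z n ξ‖)
      + ‖s - A s‖ * ∑ j ∈ Finset.range n, ‖Δ (j + 1) ξ‖) ∂(twoSided μ) := by
        refine integral_mono (((hi1 0).sub (hi1 n)).sub
          (integrable_finsetSum _ fun j _ => hi2 _)).abs hbi fun ξ => ?_
        simp only
        refine (abs_sub _ _).trans (add_le_add ((abs_sub _ _).trans ?_) ?_)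
        · rw [mul_add]
          exact add_le_add (abs_real_inner_le_norm _ _) (abs_real_inner_le_norm _ _)
        · rw [Finset.mul_sum]
          exact (Finset.abs_sum_le_sum_abs _ _).trans
            (Finset.sum_le_sum fun j _ => abs_real_inner_le_norm _ _)
    _ = ‖A s‖ * (∫ ξ, ‖Z 0 ξ‖ ∂(twoSided μ) + ∫ ξ, ‖Z n ξ‖ ∂(twoSided μ))
        + ‖s - A s‖ * ∑ j ∈ Finset.range n, ∫ ξ, ‖Δ (j + 1) ξ‖ ∂(twoSided μ) := by
        have hZZ : Integrable (fun ξ => ‖Z 0 ξ‖ + ‖Z n ξ‖) (twoSided μ) :=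
          (hZi 0).norm.add (hZi n).norm
        rw [integral_add (hZZ.const_mul _)
          ((integrable_finsetSum _ fun j _ => ((hΔmem _).integrable one_le_two).norm).const_mul _),
          integral_const_mul, integral_const_mul, integral_add (hZi 0).norm (hZi n).norm,
          integral_finsetSum _ fun j _ => ((hΔmem _).integrable one_le_two).norm]
    _ ≤ _ := by
        gcongr
        · linarith [hZint 0, hZint n]
        · calc ∑ j ∈ Finset.range n, ∫ ξ, ‖Δ (j + 1) ξ‖ ∂(twoSided μ)
              ≤ ∑ j ∈ Finset.range n, (r : ℝ) ^ j * c.toReal := by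
                refine Finset.sum_le_sum fun j _ => (hΔint (j + 1)).trans ?_
                gcongr ?_ * _
                exact pow_le_pow_of_le_one r.coe_nonneg hr.le (Nat.le_succ j)
            _ ≤ _ := by
                rw [← Finset.sum_mul]
                gcongr
                rw [← tsum_geometric_of_lt_one r.coe_nonneg hr]
                exact (summable_geometric_of_lt_one r.coe_nonneg hr).sum_le_tsum _
                  fun j _ => pow_nonneg r.coe_nonneg j

theorem tendsto_integral_cexp_average (h : IsContracting α μ r) (hA : IsMeanStep α μ A b)
    (b₀ t : Vec d) :
    Tendsto (fun n : ℕ => ∫ ξ, Complex.exp ((inner ℝ (√(n : ℝ) •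
        ((n : ℝ)⁻¹ • ∑ k ∈ Finset.Icc 1 n, flow α ξ 0 k b₀ - b)) t : ℝ) * Complex.I)
        ∂(twoSided μ)) atTop
      (𝓝 (Complex.exp (-((t.ofLp ⬝ᵥ (longRunCov α μ b *ᵥ t.ofLp) : ℝ) : ℂ) / 2))) := by
  obtain ⟨s, rfl⟩ := h.exists_sub_mean_eq hA t
  obtain ⟨K, hK⟩ := h.exists_integral_abs_sub_sum_martDiff_le hA b₀ s
  rw [h.dotProduct_longRunCov_mulVec hA]
  have hmart := h.tendsto_integral_cexp_martDiff hA s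
  have ha0 : Tendsto (fun n : ℕ => (√(n : ℝ))⁻¹) atTop (𝓝 0) :=
    tendsto_inv_atTop_zero.comp (Real.tendsto_sqrt_atTop.comp tendsto_natCast_atTop_atTop)
  refine (tendsto_iff_of_dist ?_).2 hmart
  refine squeeze_zero' (Eventually.of_forall fun _ => dist_nonneg) ?_
    (by simpa using ha0.mul_const K)
  filter_upwards [eventually_ge_atTop 1] with n hn
  have hn0 : (0 : ℝ) < n := by exact_mod_cast hn
  have hsqrt : √(n : ℝ) * (n : ℝ)⁻¹ = (√(n : ℝ))⁻¹ := by
    rw [← div_eq_mul_inv, Real.sqrt_div_self]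
  have hWeq : ∀ ξ, inner ℝ (√(n : ℝ) • ((n : ℝ)⁻¹ • ∑ k ∈ Finset.Icc 1 n, flow α ξ 0 k b₀ - b))
      (s - A s) = (√(n : ℝ))⁻¹ *
        inner ℝ (∑ j ∈ Finset.range n, (flow α ξ 0 (j + 1) b₀ - b)) (s - A s) := fun ξ => by
    rw [← real_inner_smul_left]
    congr 1
    have hsum : ∑ k ∈ Finset.Icc 1 n, flow α ξ 0 k b₀
        = ∑ j ∈ Finset.range n, flow α ξ 0 (j + 1) b₀ := by
      rw [Finset.range_eq_Ico, Finset.sum_Ico_add' (fun k => flow α ξ 0 k b₀) 0 n 1]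
      rfl
    rw [hsum, Finset.sum_sub_distrib, Finset.sum_const, Finset.card_range, smul_sub, smul_sub,
      smul_smul, hsqrt, ← Nat.cast_smul_eq_nsmul ℝ, smul_smul]
    congr 2
    rw [← hsqrt, mul_assoc, inv_mul_cancel₀ hn0.ne', mul_one]
  simp_rw [hWeq]
  set W : (ℤ → Sample d) → ℝ := fun ξ =>
    inner ℝ (∑ j ∈ Finset.range n, (flow α ξ 0 (j + 1) b₀ - b)) (s - A s) with hW
  set S : (ℤ → Sample d) → ℝ := fun ξ => ∑ j ∈ Finset.range n, martDiff α A b s j ξ with hS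
  obtain ⟨hint, hle⟩ := hK n
  have hWm : Measurable W := by
    have : ∀ j, Measurable fun ξ : ℤ → Sample d => flow α ξ 0 j b₀ := fun j =>
      measurable_flow α 0 j measurable_const
    fun_prop
  have hSm : Measurable S := measurable_sum_fun fun j _ => measurable_martDiff α A b s j
  have hb : ∀ {f : (ℤ → Sample d) → ℝ}, Measurable f → Integrable (fun ξ =>
      Complex.exp (((√(n : ℝ))⁻¹ * f ξ : ℝ) * Complex.I)) (twoSided μ) := fun {f} hf => by
    have := integrable_cexp_mul (P := twoSided μ) (hf.const_mul (√(n : ℝ))⁻¹).aemeasurable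
      (integrable_const (1 : ℂ))
    simpa using this
  rw [dist_eq_norm, ← integral_sub (hb hWm) (hb hSm)]
  calc _ ≤ ∫ ξ, (√(n : ℝ))⁻¹ * |W ξ - S ξ| ∂(twoSided μ) := by
        refine norm_integral_le_of_norm_le (hint.abs.const_mul _) (ae_of_all _ fun ξ => ?_)
        refine (norm_cexp_sub_cexp_le _ _).trans (le_of_eq ?_)
        rw [← mul_sub, abs_mul, abs_of_nonneg (by positivity)]
    _ ≤ _ := by
        rw [integral_const_mul]
        gcongr

end IsContracting

end DropoutSGD
end

noncomputable section
namespace DropoutSGD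

/-! ### Consequences of moment bounds on the features -/

variable {d : ℕ} {α : ℝ} {μ : Measure (Sample d)}

/-- The operator `v ↦ E[(Dx)(Dx)ᵀ] v`. -/
def gramOp (hi : ∀ v : Vec d, Integrable (fun s => inner ℝ (feature s) v • feature s) μ) :
    Vec d →ₗ[ℝ] Vec d where
  toFun v := ∫ s, inner ℝ (feature s) v • feature s ∂μ
  map_add' v w := by
    simp_rw [inner_add_right, add_smul]
    exact integral_add (hi v) (hi w)
  map_smul' c v := by
    simp_rw [inner_smul_right, mul_smul]
    exact integral_smul c _

lemma inner_gramOp (hi : ∀ v : Vec d, Integrable (fun s => inner ℝ (feature s) v • feature s) μ)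
    (v w : Vec d) :
    inner ℝ w (gramOp hi v) = ∫ s, inner ℝ (feature s) v * inner ℝ (feature s) w ∂μ := by
  rw [gramOp, LinearMap.coe_mk, AddHom.coe_mk, ← integral_inner (hi v)]
  simp_rw [inner_smul_right, real_inner_comm]

/-- The mean `v ↦ v - α E[(Dx)(Dx)ᵀ] v` of the linear part of the recursion. -/
def meanOp (α : ℝ) (hi : ∀ v : Vec d, Integrable (fun s => inner ℝ (feature s) v • feature s) μ) :
    Vec d →L[ℝ] Vec d :=
  LinearMap.toContinuousLinearMap (LinearMap.id - α • gramOp hi)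

lemma meanOp_apply (hi : ∀ v : Vec d, Integrable (fun s => inner ℝ (feature s) v • feature s) μ)
    (v : Vec d) : meanOp α hi v = v - α • gramOp hi v := by
  simp [meanOp]

variable [IsProbabilityMeasure μ]

omit [IsProbabilityMeasure μ] in
-- Positive definiteness makes the operator injective, hence onto; applied to E[y u] this solves the
-- normal equations.
lemma exists_gramOp_eq
    (hi : ∀ v : Vec d, Integrable (fun s => inner ℝ (feature s) v • feature s) μ)
    {η : ℝ} (hη : 0 < η) (hpos : ∀ v, η * ‖v‖ ^ 2 ≤ ∫ s, inner ℝ (feature s) v ^ 2 ∂μ) (c : Vec d) :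
    ∃ b : Vec d, gramOp hi b = c := by
  have hinj : Function.Injective (gramOp hi) := by
    rw [← LinearMap.ker_eq_bot, LinearMap.ker_eq_bot']
    intro v hv
    have h1 := inner_gramOp hi v v
    simp_rw [hv, inner_zero_right, ← sq] at h1
    have h2 := hpos v
    rw [← h1] at h2
    have h3 : ‖v‖ ^ 2 ≤ 0 := by nlinarith [sq_nonneg ‖v‖]
    simpa using h3
  exact LinearMap.injective_iff_surjective.1 hinj c

lemma isMeanStep_meanOp
    (hi : ∀ v : Vec d, Integrable (fun s => inner ℝ (feature s) v • feature s) μ)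
    (hyu : Integrable (fun s : Sample d => s.2.1 • feature s) μ) {b : Vec d}
    (hb : gramOp hi b = ∫ s, s.2.1 • feature s ∂μ) : IsMeanStep α μ (meanOp α hi) b where
  integral_linPart v := by
    have h : Integrable (fun s => α • inner ℝ (feature s) v • feature s) μ := (hi v).smul α
    simp_rw [linPart, mul_smul]
    rw [integral_sub (integrable_const v) h, integral_smul, meanOp_apply]
    simp [gramOp]
  integral_step := by
    have h1 : ∀ s : Sample d, step α s b
        = b + α • (s.2.1 • feature s - inner ℝ (feature s) b • feature s) := fun s => by
      rw [step_eq, ← sub_smul, smul_smul]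
    simp_rw [h1]
    have h2 : Integrable (fun s : Sample d =>
        s.2.1 • feature s - inner ℝ (feature s) b • feature s) μ := hyu.sub (hi b)
    have h3 : Integrable (fun s : Sample d =>
        α • (s.2.1 • feature s - inner ℝ (feature s) b • feature s)) μ := h2.smul α
    rw [integral_add (integrable_const b) h3, integral_smul, integral_sub hyu (hi b), ← hb]
    simp [gramOp]
  symm v w := by
    rw [meanOp_apply, meanOp_apply, inner_sub_right, inner_sub_left, inner_smul_right,
      inner_smul_left, inner_gramOp, real_inner_comm w (gramOp hi v), inner_gramOp]
    simp [mul_comm]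

lemma isContracting_of_moments (hα : 0 < α)
    (hyu : MemLp (fun s : Sample d => s.2.1 • feature s) 2 μ)
    (huu : ∀ v : Vec d, MemLp (fun s => inner ℝ (feature s) v • feature s) 2 μ)
    (hu : MemLp (feature : Sample d → Vec d) 2 μ)
    {η : ℝ} (hη : 0 < η) (hpos : ∀ v, η * ‖v‖ ^ 2 ≤ ∫ s, inner ℝ (feature s) v ^ 2 ∂μ)
    {c : ℝ} (hc : c < 1)
    (hlr : ∀ v, α * ∫ s, ‖inner ℝ (feature s) v • feature s‖ ^ 2 ∂μ
      ≤ 2 * c * ∫ s, inner ℝ (feature s) v ^ 2 ∂μ) :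
    ∃ r : ℝ≥0, IsContracting α μ r := by
  -- The maximum ensures that √ρ squares back to ρ; in dimension zero nothing else prevents the
  -- second entry from being negative.
  set ρ : ℝ := max 0 (1 - 2 * α * (1 - c) * η) with hρ
  have hρ1 : ρ < 1 := by
    rw [hρ, max_lt_iff]
    refine ⟨one_pos, ?_⟩
    have : 0 < 2 * α * (1 - c) * η := by
      have := sub_pos.2 hc
      positivity
    linarith
  have hρ0 : 0 ≤ ρ := le_max_left _ _
  have hlin : ∀ v, MemLp (fun s => linPart α s v) 2 μ := fun v => by
    simp_rw [linPart, mul_smul]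
    exact (memLp_const v).sub ((huu v).const_smul α)
  refine ⟨Real.toNNReal (√ρ), ⟨?_, fun v => ?_, fun v => ?_⟩⟩
  · rw [Real.toNNReal_lt_one, Real.sqrt_lt' one_pos]
    simpa using hρ1
  · have hsq : ∫ s, ‖linPart α s v‖ ^ 2 ∂μ ≤ ρ * ‖v‖ ^ 2 := by
      have hi1 : Integrable (fun s => inner ℝ (feature s) v ^ 2) μ :=
        (hu.inner_const v).integrable_sq
      have hi2 : Integrable (fun s => ‖inner ℝ (feature s) v • feature s‖ ^ 2) μ :=
        (huu v).norm.integrable_sq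
      have hpt : ∀ s, ‖linPart α s v‖ ^ 2 = ‖v‖ ^ 2 - 2 * α * inner ℝ (feature s) v ^ 2
          + α ^ 2 * ‖inner ℝ (feature s) v • feature s‖ ^ 2 := fun s => by
        rw [linPart, norm_sub_sq_real, inner_smul_right, real_inner_comm, mul_smul, norm_smul α,
          mul_pow, Real.norm_eq_abs, sq_abs]
        ring
      have hi3 : Integrable (fun s => ‖v‖ ^ 2 - 2 * α * inner ℝ (feature s) v ^ 2) μ :=
        (integrable_const _).sub (hi1.const_mul _)
      simp_rw [hpt]
      rw [integral_add hi3 (hi2.const_mul _), integral_sub (integrable_const _) (hi1.const_mul _),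
        integral_const_mul, integral_const_mul]
      simp only [integral_const, probReal_univ, one_smul]
      have h1 := mul_le_mul_of_nonneg_left (hlr v) hα.le
      have h2 := mul_le_mul_of_nonneg_left (hpos v)
        (show 0 ≤ 2 * α * (1 - c) by have := sub_pos.2 hc; positivity)
      have h3 : (1 - 2 * α * (1 - c) * η) * ‖v‖ ^ 2 ≤ ρ * ‖v‖ ^ 2 := by
        gcongr
        exact le_max_right _ _
      nlinarith
    rw [integral_norm_sq_eq (hlin v).1] at hsq
    have h1 : (eLpNorm (fun s => linPart α s v) 2 μ).toReal ≤ √ρ * ‖v‖ := by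
      refine le_of_sq_le_sq ?_ (by positivity)
      rwa [mul_pow, Real.sq_sqrt hρ0]
    rw [← ENNReal.ofReal_toReal (hlin v).eLpNorm_ne_top]
    refine (ENNReal.ofReal_le_ofReal h1).trans (le_of_eq ?_)
    rw [ENNReal.ofReal_mul (Real.sqrt_nonneg _), ofReal_norm]
    rfl
  · have h1 : ∀ s : Sample d, step α s v
        = v + α • (s.2.1 • feature s - inner ℝ (feature s) v • feature s) := fun s => by
      rw [step_eq, ← sub_smul, smul_smul]
    simp_rw [h1]
    exact (memLp_const v).add ((hyu.sub (huu v)).const_smul α)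

omit [IsProbabilityMeasure μ] in
-- Pythagoras: the normal equations make the residual at b orthogonal to every ⟨u, v⟩, so the excess
-- risk is ½E⟨u, b' − b⟩².
lemma risk_lt_risk (hy : MemLp (fun s : Sample d => s.2.1) 2 μ)
    (hyu : Integrable (fun s : Sample d => s.2.1 • feature s) μ)
    (hi : ∀ v : Vec d, Integrable (fun s => inner ℝ (feature s) v • feature s) μ)
    (hu : MemLp (feature : Sample d → Vec d) 2 μ)
    {η : ℝ} (hη : 0 < η) (hpos : ∀ v, η * ‖v‖ ^ 2 ≤ ∫ s, inner ℝ (feature s) v ^ 2 ∂μ)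
    {b : Vec d} (hb : gramOp hi b = ∫ s, s.2.1 • feature s ∂μ) {b' : Vec d} (hne : b' ≠ b) :
    risk μ b < risk μ b' := by
  unfold risk
  simp_rw [inner_dropMat]
  have he : MemLp (fun s : Sample d => s.2.1 - inner ℝ (feature s) b) 2 μ :=
    hy.sub (hu.inner_const b)
  have hv : MemLp (fun s : Sample d => inner ℝ (feature s) (b' - b)) 2 μ := hu.inner_const _
  have hev : Integrable (fun s : Sample d =>
      (s.2.1 - inner ℝ (feature s) b) * inner ℝ (feature s) (b' - b)) μ := he.integrable_mul hv
  have hzero : ∫ s : Sample d,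
      (s.2.1 - inner ℝ (feature s) b) * inner ℝ (feature s) (b' - b) ∂μ = 0 := by
    have h1 : ∀ s : Sample d, (s.2.1 - inner ℝ (feature s) b) * inner ℝ (feature s) (b' - b)
        = inner ℝ (b' - b) (s.2.1 • feature s - inner ℝ (feature s) b • feature s) := fun s => by
      rw [← sub_smul, inner_smul_right, real_inner_comm (feature s) (b' - b)]
    have h2 : Integrable (fun s : Sample d =>
        s.2.1 • feature s - inner ℝ (feature s) b • feature s) μ := hyu.sub (hi b)
    simp_rw [h1]
    rw [integral_inner h2, integral_sub hyu (hi b), ← hb]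
    simp [gramOp]
  have hpt : ∀ s : Sample d, (1 / 2 : ℝ) * (s.2.1 - inner ℝ (feature s) b') ^ 2
      = (1 / 2 : ℝ) * (s.2.1 - inner ℝ (feature s) b) ^ 2
        - (s.2.1 - inner ℝ (feature s) b) * inner ℝ (feature s) (b' - b)
        + (1 / 2 : ℝ) * inner ℝ (feature s) (b' - b) ^ 2 := fun s => by
    rw [inner_sub_right]
    ring
  have hi3 : Integrable (fun s : Sample d => (1 / 2 : ℝ) * (s.2.1 - inner ℝ (feature s) b) ^ 2
      - (s.2.1 - inner ℝ (feature s) b) * inner ℝ (feature s) (b' - b)) μ :=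
    (he.integrable_sq.const_mul _).sub hev
  have hint : ∫ s : Sample d, (1 / 2 : ℝ) * (s.2.1 - inner ℝ (feature s) b') ^ 2 ∂μ
      = ∫ s : Sample d, (1 / 2 : ℝ) * (s.2.1 - inner ℝ (feature s) b) ^ 2 ∂μ
        + (1 / 2 : ℝ) * ∫ s, inner ℝ (feature s) (b' - b) ^ 2 ∂μ := by
    simp_rw [hpt]
    rw [integral_add hi3 (hv.integrable_sq.const_mul _),
      integral_sub (he.integrable_sq.const_mul _) hev, hzero, integral_const_mul, integral_const_mul]
    ring
  rw [hint]
  have h1 : 0 < ‖b' - b‖ := norm_pos_iff.2 (sub_ne_zero.2 hne)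
  have h2 := hpos (b' - b)
  have h3 : 0 < η * ‖b' - b‖ ^ 2 := by positivity
  linarith

end DropoutSGD
end

noncomputable section
namespace DropoutSGD

/-! ### The dropout mask and the moments of the linear model -/

variable {d : ℕ} {p : unitInterval}

/-- The law of the diagonal of the dropout matrix. -/
abbrev maskLaw (d : ℕ) (p : unitInterval) : Measure (Fin d → ℝ) :=
  Measure.pi fun _ : Fin d => bernoulliMeasure (1 : ℝ) 0 p

lemma ae_mask : ∀ᵐ δ ∂maskLaw d p, ∀ i, δ i = 0 ∨ δ i = 1 := by
  refine ae_all_iff.2 fun i => ?_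
  have h : ∀ᵐ t ∂bernoulliMeasure (1 : ℝ) 0 p, t = 0 ∨ t = 1 := by
    rw [ae_iff]
    have hm : MeasurableSet {t : ℝ | ¬(t = 0 ∨ t = 1)} := by measurability
    exact bernoulliMeasure_apply_of_notMem_of_notMem p hm (by simp) (by simp)
  exact (measurePreserving_eval (fun _ : Fin d => bernoulliMeasure (1 : ℝ) 0 p)
    i).quasiMeasurePreserving.ae h

/-- A 0–1 variable equals its square, so the diagonal gets p and not p². This asymmetry is the
origin of (xxᵀ)_p. -/
lemma integral_mask_mul (i j : Fin d) :
    ∫ δ, δ i * δ j ∂maskLaw d p = p * if i = j then 1 else (p : ℝ) := by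
  have h1 : ∀ i : Fin d, ∫ δ, δ i ∂maskLaw d p = p := fun i => by
    rw [integral_comp_eval (μ := fun _ : Fin d => bernoulliMeasure (1 : ℝ) 0 p) (i := i)
      (f := fun t : ℝ => t) measurable_id.aestronglyMeasurable, integral_bernoulliMeasure]
    simp
  split_ifs with hij
  · subst hij
    rw [mul_one, ← h1 i]
    refine integral_congr_ae ?_
    filter_upwards [ae_mask (p := p) (d := d)] with δ hδ
    rcases hδ i with h | h <;> simp [h]
  · have hind : iIndepFun (fun (i : Fin d) (δ : Fin d → ℝ) => δ i) (maskLaw d p) :=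
      iIndepFun_pi (X := fun (_ : Fin d) (t : ℝ) => t) fun _ => aemeasurable_id
    have := (hind.indepFun hij).integral_fun_mul_eq_mul_integral
      (measurable_pi_apply i).aestronglyMeasurable (measurable_pi_apply j).aestronglyMeasurable
    rw [this, h1, h1]

/-- The map `(D, x, ε) ↦ (D, (xᵀ β* + ε, x))`. -/
def toSample (bstar : Vec d) (s : (Fin d → ℝ) × Vec d × ℝ) : Sample d :=
  (s.1, inner ℝ s.2.1 bstar + s.2.2, s.2.1)

lemma measurable_toSample (bstar : Vec d) : Measurable (toSample bstar) := by
  unfold toSample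
  fun_prop

variable {covLaw : Measure (Vec d)} [IsProbabilityMeasure covLaw]
  {noiseLaw : Measure ℝ} [IsProbabilityMeasure noiseLaw] {bstar : Vec d}

instance : IsProbabilityMeasure (inputLaw p covLaw noiseLaw) := by
  unfold inputLaw; infer_instance

omit [IsProbabilityMeasure covLaw] [IsProbabilityMeasure noiseLaw] in
lemma sampleLaw_eq : sampleLaw p covLaw noiseLaw bstar
    = (inputLaw p covLaw noiseLaw).map (toSample bstar) := rfl

instance : IsProbabilityMeasure (sampleLaw p covLaw noiseLaw bstar) :=
  Measure.isProbabilityMeasure_map (measurable_toSample bstar).aemeasurable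

omit [IsProbabilityMeasure covLaw] [IsProbabilityMeasure noiseLaw] in
lemma ae_mask_inputLaw : ∀ᵐ s ∂inputLaw p covLaw noiseLaw, ∀ i, s.1 i = 0 ∨ s.1 i = 1 :=
  Measure.quasiMeasurePreserving_fst.ae ae_mask

lemma measurePreserving_cov : MeasurePreserving
    (fun s : (Fin d → ℝ) × Vec d × ℝ => s.2.1) (inputLaw p covLaw noiseLaw) covLaw :=
  measurePreserving_fst.comp measurePreserving_snd

lemma measurePreserving_noise : MeasurePreserving
    (fun s : (Fin d → ℝ) × Vec d × ℝ => s.2.2) (inputLaw p covLaw noiseLaw) noiseLaw :=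
  measurePreserving_snd.comp measurePreserving_snd

omit [IsProbabilityMeasure covLaw] [IsProbabilityMeasure noiseLaw] in
/-- Multiplying by an entry of the mask does not increase absolute values. -/
lemma memLp_mask_mul {f : (Fin d → ℝ) × Vec d × ℝ → ℝ}
    (hf : MemLp f 2 (inputLaw p covLaw noiseLaw)) (i : Fin d) :
    MemLp (fun s => s.1 i * f s) 2 (inputLaw p covLaw noiseLaw) := by
  have hm : Measurable fun s : (Fin d → ℝ) × Vec d × ℝ => s.1 i := by fun_prop
  refine hf.mono (hm.aestronglyMeasurable.mul hf.1) ?_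
  filter_upwards [ae_mask_inputLaw (p := p) (covLaw := covLaw) (noiseLaw := noiseLaw)] with s hs
  rcases hs i with h | h <;> simp [h]

lemma memLp_feature (hx : ∀ i, MemLp (fun x : Vec d => x i) 2 covLaw) :
    MemLp (feature : Sample d → Vec d) 2 (sampleLaw p covLaw noiseLaw bstar) := by
  rw [sampleLaw_eq, memLp_map_measure_iff measurable_feature.aestronglyMeasurable
    (measurable_toSample bstar).aemeasurable]
  refine MemLp.of_eval_piLp fun i => ?_
  simp only [Function.comp_apply, feature_apply, toSample]
  exact memLp_mask_mul ((hx i).comp_measurePreserving measurePreserving_cov) i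

lemma memLp_response (hx : ∀ i, MemLp (fun x : Vec d => x i) 2 covLaw)
    (hnoise : MemLp id 2 noiseLaw) :
    MemLp (fun s : Sample d => s.2.1) 2 (sampleLaw p covLaw noiseLaw bstar) := by
  rw [sampleLaw_eq, memLp_map_measure_iff (by fun_prop) (measurable_toSample bstar).aemeasurable]
  have h1 : MemLp (id : Vec d → Vec d) 2 covLaw := MemLp.of_eval_piLp hx
  have h2 : MemLp (fun x : Vec d => (inner ℝ x bstar : ℝ)) 2 covLaw := h1.inner_const bstar
  exact (h2.comp_measurePreserving measurePreserving_cov).add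
    (hnoise.comp_measurePreserving measurePreserving_noise)

/-- The i-th coordinate is δ_i(Σ_j β*_j x_i x_j + x_i ε). The first part needs products of
covariates in L², the second only independence of x and ε. -/
lemma memLp_response_smul_feature (hx : ∀ i, MemLp (fun x : Vec d => x i) 2 covLaw)
    (hxx : ∀ i j, MemLp (fun x : Vec d => x i * x j) 2 covLaw)
    (hnoise : MemLp id 2 noiseLaw) :
    MemLp (fun s : Sample d => s.2.1 • feature s) 2 (sampleLaw p covLaw noiseLaw bstar) := by
  have hm : Measurable fun s : Sample d => s.2.1 • feature s := by
    have := measurable_feature (d := d)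
    fun_prop
  rw [sampleLaw_eq, memLp_map_measure_iff hm.aestronglyMeasurable
    (measurable_toSample bstar).aemeasurable]
  refine MemLp.of_eval_piLp fun i => ?_
  have h1 : MemLp (fun x : Vec d => ∑ j, bstar j * (x i * x j)) 2 covLaw :=
    memLp_finsetSum _ fun j _ => (hxx i j).const_mul _
  have h2 : MemLp (fun z : Vec d × ℝ => z.1 i * z.2) 2 (covLaw.prod noiseLaw) := by
    rw [memLp_two_iff_integrable_sq (by fun_prop)]
    simp_rw [mul_pow]
    exact (hx i).integrable_sq.mul_prod hnoise.integrable_sq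
  have h3 := memLp_mask_mul ((h1.comp_measurePreserving
    (measurePreserving_cov (p := p) (noiseLaw := noiseLaw))).add
    (h2.comp_measurePreserving (measurePreserving_snd (μ := maskLaw d p)))) i
  convert h3 using 2 with s
  simp only [Function.comp_apply, feature_apply, toSample, PiLp.smul_apply, smul_eq_mul,
    Pi.add_apply, PiLp.inner_apply, RCLike.inner_apply, conj_trivial, add_mul, mul_add,
    Finset.sum_mul, Finset.mul_sum]
  congr 1
  · exact Finset.sum_congr rfl fun j _ => by ring
  · ring

/-- Products of covariates inherit square integrability from their masked versions. -/
lemma memLp_mul_of_mask (hp : 0 < p) {i j : Fin d}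
    (h : MemLp (fun s : (Fin d → ℝ) × Vec d × ℝ => (s.1 i * s.1 j) * (s.2.1 i * s.2.1 j)) 2
      (inputLaw p covLaw noiseLaw)) :
    MemLp (fun x : Vec d => x i * x j) 2 covLaw := by
  have hm : ∀ᵐ δ ∂maskLaw d p, Integrable (fun z : Vec d × ℝ =>
      ((δ i * δ j) * (z.1 i * z.1 j)) ^ 2) (covLaw.prod noiseLaw) :=
    h.integrable_sq.prod_right_ae
  -- The product of the two mask entries has positive mean, so it is nonzero with positive
  -- probability; for such a mask the section is integrable and the constant can be divided out.
  have hex : ∃ᵐ δ ∂maskLaw d p, δ i * δ j ≠ 0 := by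
    intro h0
    have h1 : ∫ δ, δ i * δ j ∂maskLaw d p = 0 := by
      rw [← integral_zero (Fin d → ℝ) ℝ (μ := maskLaw d p)]
      refine integral_congr_ae ?_
      filter_upwards [h0] with δ hδ
      exact not_not.1 hδ
    rw [integral_mask_mul] at h1
    have hp' : (0 : ℝ) < p := hp
    split_ifs at h1 <;> simp [hp'.ne'] at h1
  obtain ⟨δ, h1, h2⟩ := (hex.and_eventually hm).exists
  simp_rw [mul_pow _ _ 2] at h2
  rw [memLp_two_iff_integrable_sq (by fun_prop)]
  have h3 := h2.const_mul ((δ i ^ 2 * δ j ^ 2)⁻¹)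
  have h4 : (δ i ^ 2 * δ j ^ 2) ≠ 0 := by rw [← mul_pow]; exact pow_ne_zero 2 h1
  simp_rw [inv_mul_cancel_left₀ h4] at h3
  have h5 := (measurePreserving_fst (μ := covLaw) (ν := noiseLaw)).integrable_comp
    (g := fun x : Vec d => (x i * x j) ^ 2) (by fun_prop)
  refine h5.1 (h3.congr (ae_of_all _ fun z => ?_))
  simp [mul_pow]

omit [IsProbabilityMeasure covLaw] in
lemma meanGram_apply (i j : Fin d) :
    meanGram (p : ℝ) covLaw i j = (if i = j then 1 else (p : ℝ)) * ∫ x, x i * x j ∂covLaw := by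
  have h : ∀ x : Vec d, offDiagScale (p : ℝ) (gram x) i j
      = (if i = j then 1 else (p : ℝ)) * (x i * x j) := fun x => by
    by_cases hij : i = j
    · subst hij
      simp [offDiagScale, gram, Matrix.vecMulVec_apply]
      ring
    · simp [offDiagScale, gram, Matrix.vecMulVec_apply, hij]
  simp only [meanGram, Matrix.of_apply, h]
  exact integral_const_mul _ _

/-- The second moment matrix of `Dx` is `p E[(x xᵀ)_p]`. -/
lemma integral_inner_feature_sq (hx : ∀ i, MemLp (fun x : Vec d => x i) 2 covLaw) (v : Vec d) :
    ∫ s, inner ℝ (feature s) v ^ 2 ∂sampleLaw p covLaw noiseLaw bstar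
      = p * (v.ofLp ⬝ᵥ (meanGram p covLaw *ᵥ v.ofLp)) := by
  have hm : Measurable fun s : Sample d => (inner ℝ (feature s) v : ℝ) ^ 2 := by
    have := measurable_feature (d := d)
    fun_prop
  rw [sampleLaw_eq, integral_map (measurable_toSample bstar).aemeasurable hm.aestronglyMeasurable]
  have hpt : ∀ s : (Fin d → ℝ) × Vec d × ℝ, (inner ℝ (feature (toSample bstar s)) v : ℝ) ^ 2
      = ∑ i, ∑ j, (v i * v j) * ((s.1 i * s.1 j) * (s.2.1 i * s.2.1 j)) := fun s => by
    simp only [PiLp.inner_apply, feature_apply, toSample, RCLike.inner_apply, conj_trivial, sq,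
      Finset.sum_mul_sum]
    exact Finset.sum_congr rfl fun i _ => Finset.sum_congr rfl fun j _ => by ring
  simp_rw [hpt]
  have hmask : ∀ i j : Fin d, Integrable (fun δ : Fin d → ℝ => δ i * δ j) (maskLaw d p) :=
    fun i j => by
      refine Integrable.of_bound (by fun_prop) 1 ?_
      filter_upwards [ae_mask (d := d) (p := p)] with δ hδ
      rcases hδ i with h | h <;> rcases hδ j with h' | h' <;> simp [h, h']
  have hcov : ∀ i j : Fin d, Integrable (fun z : Vec d × ℝ => z.1 i * z.1 j)
      (covLaw.prod noiseLaw) := fun i j =>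
    measurePreserving_fst.integrable_comp_of_integrable ((hx i).integrable_mul (hx j))
  have hint : ∀ i j : Fin d, Integrable (fun s : (Fin d → ℝ) × Vec d × ℝ =>
      (v i * v j) * ((s.1 i * s.1 j) * (s.2.1 i * s.2.1 j))) (inputLaw p covLaw noiseLaw) :=
    fun i j => ((hmask i j).mul_prod (hcov i j)).const_mul _
  rw [integral_finsetSum _ fun i _ => integrable_finsetSum _ fun j _ => hint i j]
  simp only [dotProduct, Matrix.mulVec, Finset.mul_sum]
  refine Finset.sum_congr rfl fun i _ => ?_
  rw [integral_finsetSum _ fun j _ => hint i j]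
  refine Finset.sum_congr rfl fun j _ => ?_
  rw [integral_const_mul, inputLaw, integral_prod_mul (fun δ : Fin d → ℝ => δ i * δ j)
    (fun z : Vec d × ℝ => z.1 i * z.1 j), integral_mask_mul, meanGram_apply]
  have : ∫ z : Vec d × ℝ, z.1 i * z.1 j ∂covLaw.prod noiseLaw = ∫ x, x i * x j ∂covLaw := by
    have := integral_fun_fst (μ := covLaw) (ν := noiseLaw) (fun x : Vec d => x i * x j)
    simpa using this
  rw [this]
  ring

/-- The quadratic form is p times pE⟨x,v⟩² + (1 − p)Σ v_i² E x_i². The diagonal part alone is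
coercive: this is the regularizing effect of dropout. -/
lemma le_integral_inner_feature_sq (hx : ∀ i, MemLp (fun x : Vec d => x i) 2 covLaw) {κ : ℝ}
    (hκ : ∀ i, κ ≤ ∫ x, x i ^ 2 ∂covLaw) (v : Vec d) :
    (p * (1 - p) * κ) * ‖v‖ ^ 2
      ≤ ∫ s, inner ℝ (feature s) v ^ 2 ∂sampleLaw p covLaw noiseLaw bstar := by
  have hp0 : (0 : ℝ) ≤ p := p.2.1
  have hp1 : (0 : ℝ) ≤ 1 - p := sub_nonneg.2 p.2.2
  rw [integral_inner_feature_sq hx, mul_assoc, mul_assoc]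
  refine mul_le_mul_of_nonneg_left ?_ hp0
  have h1 : v.ofLp ⬝ᵥ (meanGram p covLaw *ᵥ v.ofLp)
      = p * ∫ x, inner ℝ x v ^ 2 ∂covLaw + (1 - p) * ∑ i, v i ^ 2 * ∫ x, x i ^ 2 ∂covLaw := by
    have hpt : ∀ x : Vec d, (inner ℝ x v : ℝ) ^ 2 = ∑ i, ∑ j, (v i * v j) * (x i * x j) :=
      fun x => by
        simp only [PiLp.inner_apply, RCLike.inner_apply, conj_trivial, sq, Finset.sum_mul_sum]
        exact Finset.sum_congr rfl fun i _ => Finset.sum_congr rfl fun j _ => by ring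
    have hint : ∀ i j : Fin d, Integrable (fun x : Vec d => (v i * v j) * (x i * x j)) covLaw :=
      fun i j => ((hx i).integrable_mul (hx j)).const_mul _
    simp_rw [hpt]
    rw [integral_finsetSum _ fun i _ => integrable_finsetSum _ fun j _ => hint i j]
    simp only [dotProduct, Matrix.mulVec, Finset.mul_sum, meanGram_apply]
    rw [← Finset.sum_add_distrib]
    refine Finset.sum_congr rfl fun i _ => ?_
    rw [integral_finsetSum _ fun j _ => hint i j, Finset.mul_sum,
      ← Finset.sum_erase_add _ _ (Finset.mem_univ i), ← Finset.sum_erase_add _ _ (Finset.mem_univ i),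
      add_assoc]
    congr 1
    · refine Finset.sum_congr rfl fun j hj => ?_
      rw [if_neg (Finset.ne_of_mem_erase hj).symm, integral_const_mul]
      ring
    · rw [if_pos rfl, integral_const_mul]
      simp_rw [← sq]
      ring
  rw [h1]
  have h2 : κ * ‖v‖ ^ 2 ≤ ∑ i, v i ^ 2 * ∫ x, x i ^ 2 ∂covLaw := by
    rw [EuclideanSpace.real_norm_sq_eq, Finset.mul_sum]
    refine Finset.sum_le_sum fun i _ => ?_
    rw [mul_comm]
    exact mul_le_mul_of_nonneg_left (hκ i) (sq_nonneg _)
  have h3 : 0 ≤ ∫ x, inner ℝ x v ^ 2 ∂covLaw := integral_nonneg fun x => sq_nonneg _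
  nlinarith [mul_le_mul_of_nonneg_left h2 hp1, mul_nonneg hp0 h3]

end DropoutSGD
end

noncomputable section
namespace DropoutSGD

/-! ### Consequences of the learning-rate condition -/

variable {d : ℕ} {p : unitInterval} {covLaw : Measure (Vec d)} {noiseLaw : Measure ℝ}
  {bstar : Vec d} {q α : ℝ}

lemma mom_eq (μ : Measure (Sample d)) (q : ℝ) (v : Vec d) :
    mom μ q v = eLpNorm (fun s => inner ℝ (feature s) v • feature s) (ENNReal.ofReal q) μ := by
  unfold mom
  congr 1
  ext s i
  rw [← inner_dropMat, PiLp.smul_apply, feature_apply]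
  simp only [Matrix.toLpLin_apply, gram, dropMat, ← Matrix.mulVec_mulVec, Matrix.mulVec_diagonal]
  simp only [Matrix.mulVec, dotProduct, Matrix.vecMulVec_apply, PiLp.inner_apply,
    RCLike.inner_apply, conj_trivial, smul_eq_mul, Finset.sum_mul, Finset.mul_sum,
    Matrix.diagonal_apply, ite_mul, zero_mul, Finset.sum_ite_eq, Finset.mem_univ, if_true]
  exact Finset.sum_congr rfl fun j _ => by ring

lemma measurable_inner_smul_feature (v : Vec d) :
    Measurable fun s : Sample d => (inner ℝ (feature s) v : ℝ) • feature s := by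
  have := measurable_feature (d := d)
  fun_prop

/-- An infinite moment in one unit direction would make the supremum infinite, because the power
factor is at least 1, the denominator is finite and the prefactor is positive. Other directions
follow by homogeneity. -/
lemma LearningRateCond.memLp (hq : 2 ≤ q) (hα : 0 < α)
    (hcond : LearningRateCond p covLaw noiseLaw bstar q α) (v : Vec d) :
    MemLp (fun s => inner ℝ (feature s) v • feature s) (ENNReal.ofReal q)
      (sampleLaw p covLaw noiseLaw bstar) := by
  have hunit : ∀ v : Vec d, ‖v‖ = 1 → MemLp (fun s => inner ℝ (feature s) v • feature s)
      (ENNReal.ofReal q) (sampleLaw p covLaw noiseLaw bstar) := fun v hv => by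
    refine ⟨(measurable_inner_smul_feature v).aestronglyMeasurable, ?_⟩
    rw [← mom_eq, lt_top_iff_ne_top]
    intro htop
    have ha : ENNReal.ofReal (α * (q - 1) / 2) ≠ 0 := by
      rw [ENNReal.ofReal_ne_zero_iff]
      have : 0 < q - 1 := by linarith
      positivity
    have hsup := le_iSup₂ (f := fun (v : Vec d) (_ : ‖v‖ = 1) =>
      (1 + ENNReal.ofReal α * mom (sampleLaw p covLaw noiseLaw bstar) q v) ^ (q - 2) *
        mom (sampleLaw p covLaw noiseLaw bstar) q v ^ 2 /
          ENNReal.ofReal ((p : ℝ) * (v.ofLp ⬝ᵥ (meanGram p covLaw *ᵥ v.ofLp)))) v hv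
    have h1 : (1 + ENNReal.ofReal α * mom (sampleLaw p covLaw noiseLaw bstar) q v) ^ (q - 2)
        ≠ 0 := by
      refine (lt_of_lt_of_le one_pos ?_).ne'
      exact (ENNReal.one_rpow (q - 2)).symm.le.trans
        (ENNReal.rpow_le_rpow le_self_add (by linarith))
    rw [htop] at hsup h1
    rw [ENNReal.top_pow two_ne_zero, ENNReal.mul_top h1, ENNReal.top_div_of_ne_top
      ENNReal.ofReal_ne_top, top_le_iff] at hsup
    unfold LearningRateCond at hcond
    rw [hsup, ENNReal.mul_top ha] at hcond
    exact absurd hcond (by simp)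
  rcases eq_or_ne v 0 with rfl | hv
  · simp
  · have hv' : ‖v‖ ≠ 0 := norm_ne_zero_iff.2 hv
    have h := (hunit (‖v‖⁻¹ • v) (by rw [norm_smul, norm_inv, norm_norm, inv_mul_cancel₀ hv'])
      ).const_smul ‖v‖
    refine h.congr_norm (measurable_inner_smul_feature v).aestronglyMeasurable
      (ae_of_all _ fun s => ?_)
    rw [Pi.smul_apply, inner_smul_right, smul_smul, mul_inv_cancel_left₀ hv']

/-- The condition only weakens when q is lowered to 2: q − 1 ≥ 1, the power factor is at least 1,
and L² norms are at most L^q norms. The constant c is the left side of the condition itself. -/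
lemma LearningRateCond.exists_lt_one [IsProbabilityMeasure covLaw] [IsProbabilityMeasure noiseLaw]
    (hx : ∀ i, MemLp (fun x : Vec d => x i) 2 covLaw)
    {η : ℝ} (hη : 0 < η) (hpos : ∀ v : Vec d, η * ‖v‖ ^ 2
      ≤ ∫ s, inner ℝ (feature s) v ^ 2 ∂sampleLaw p covLaw noiseLaw bstar)
    (hq : 2 ≤ q) (hα : 0 < α) (hcond : LearningRateCond p covLaw noiseLaw bstar q α) :
    ∃ c < (1 : ℝ), ∀ v : Vec d,
      α * ∫ s, ‖inner ℝ (feature s) v • feature s‖ ^ 2 ∂sampleLaw p covLaw noiseLaw bstar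
        ≤ 2 * c * ∫ s, inner ℝ (feature s) v ^ 2 ∂sampleLaw p covLaw noiseLaw bstar := by
  have hmem := LearningRateCond.memLp hq hα hcond
  unfold LearningRateCond at hcond
  set μ := sampleLaw p covLaw noiseLaw bstar with hμ
  set S := ⨆ (v : Vec d) (_ : ‖v‖ = 1), (1 + ENNReal.ofReal α * mom μ q v) ^ (q - 2) *
    mom μ q v ^ 2 / ENNReal.ofReal ((p : ℝ) * (v.ofLp ⬝ᵥ (meanGram p covLaw *ᵥ v.ofLp))) with hS
  have hct : ENNReal.ofReal (α * (q - 1) / 2) * S ≠ ⊤ := hcond.ne_top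
  have hq2 : (2 : ℝ≥0∞) ≤ ENNReal.ofReal q := by
    rw [show (2 : ℝ≥0∞) = ENNReal.ofReal 2 by simp]
    exact ENNReal.ofReal_le_ofReal hq
  refine ⟨(ENNReal.ofReal (α * (q - 1) / 2) * S).toReal, ?_, fun v => ?_⟩
  · rw [← ENNReal.toReal_one]
    exact (ENNReal.toReal_lt_toReal hct ENNReal.one_ne_top).2 hcond
  have hunit : ∀ v : Vec d, ‖v‖ = 1 → α * ∫ s, ‖inner ℝ (feature s) v • feature s‖ ^ 2 ∂μ
      ≤ 2 * (ENNReal.ofReal (α * (q - 1) / 2) * S).toReal *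
        ∫ s, inner ℝ (feature s) v ^ 2 ∂μ := fun v hv => by
    have hh : 0 < ∫ s, inner ℝ (feature s) v ^ 2 ∂μ := by
      have := hpos v
      rw [hv] at this
      linarith
    set h := ∫ s, inner ℝ (feature s) v ^ 2 ∂μ with hh'
    have hsup : (1 + ENNReal.ofReal α * mom μ q v) ^ (q - 2) * mom μ q v ^ 2 /
        ENNReal.ofReal h ≤ S := by
      rw [hh', hμ, integral_inner_feature_sq hx]
      exact le_iSup₂ (f := fun (v : Vec d) (_ : ‖v‖ = 1) =>
        (1 + ENNReal.ofReal α * mom μ q v) ^ (q - 2) * mom μ q v ^ 2 /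
          ENNReal.ofReal ((p : ℝ) * (v.ofLp ⬝ᵥ (meanGram p covLaw *ᵥ v.ofLp)))) v hv
    rw [ENNReal.div_le_iff (by simpa using hh) ENNReal.ofReal_ne_top] at hsup
    have h1 : 1 ≤ (1 + ENNReal.ofReal α * mom μ q v) ^ (q - 2) := by
      exact (ENNReal.one_rpow (q - 2)).symm.le.trans
        (ENNReal.rpow_le_rpow le_self_add (by linarith))
    have h2 : eLpNorm (fun s => inner ℝ (feature s) v • feature s) 2 μ ≤ mom μ q v := by
      rw [mom_eq]
      exact eLpNorm_le_eLpNorm_of_exponent_le hq2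
        (measurable_inner_smul_feature v).aestronglyMeasurable
    have h3 : ENNReal.ofReal (α / 2) *
        eLpNorm (fun s => inner ℝ (feature s) v • feature s) 2 μ ^ 2
        ≤ ENNReal.ofReal (α * (q - 1) / 2) * S * ENNReal.ofReal h := by
      calc _ ≤ ENNReal.ofReal (α * (q - 1) / 2) * mom μ q v ^ 2 := by
            gcongr
            nlinarith
        _ ≤ ENNReal.ofReal (α * (q - 1) / 2) *
            ((1 + ENNReal.ofReal α * mom μ q v) ^ (q - 2) * mom μ q v ^ 2) := by
            gcongr
            exact le_mul_of_one_le_left zero_le h1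
        _ ≤ _ := by
            rw [mul_assoc]
            gcongr
    have h4 := ENNReal.toReal_mono (ENNReal.mul_ne_top hct ENNReal.ofReal_ne_top) h3
    rw [ENNReal.toReal_mul, ENNReal.toReal_mul, ENNReal.toReal_pow, ENNReal.toReal_ofReal hh.le,
      ENNReal.toReal_ofReal (by positivity),
      ← integral_norm_sq_eq (measurable_inner_smul_feature v).aestronglyMeasurable] at h4
    linarith
  rcases eq_or_ne v 0 with rfl | hv
  · simp
  · have hv' : ‖v‖ ≠ 0 := norm_ne_zero_iff.2 hv
    have h := hunit (‖v‖⁻¹ • v) (by rw [norm_smul, norm_inv, norm_norm, inv_mul_cancel₀ hv'])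
    simp_rw [inner_smul_right, mul_smul, norm_smul ‖v‖⁻¹, mul_pow, integral_const_mul] at h
    have h0 : 0 < ‖‖v‖⁻¹‖ ^ 2 := pow_pos (norm_pos_iff.2 (inv_ne_zero hv')) 2
    have h1 : ‖v‖⁻¹ ^ 2 = ‖‖v‖⁻¹‖ ^ 2 := by simp
    rw [h1, mul_left_comm, mul_left_comm (2 * _)] at h
    exact le_of_mul_le_mul_left h h0

/-- The Bochner integral of a non-integrable function is 0, so positivity already encodes
finiteness. -/
lemma memLp_coord_of_integral_sq_pos {i : Fin d} (h : 0 < ∫ x, x i ^ 2 ∂covLaw) :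
    MemLp (fun x : Vec d => x i) 2 covLaw := by
  rw [memLp_two_iff_integrable_sq (by fun_prop)]
  exact not_imp_comm.1 integral_undef h.ne'

/-- In direction e_j the i-th coordinate of ⟨u,v⟩u is the masked product x_i x_j, and the mask can
be removed. -/
lemma LearningRateCond.memLp_mul [IsProbabilityMeasure covLaw] [IsProbabilityMeasure noiseLaw]
    (hp : 0 < p) (hq : 2 ≤ q) (hα : 0 < α)
    (hcond : LearningRateCond p covLaw noiseLaw bstar q α) (i j : Fin d) :
    MemLp (fun x : Vec d => x i * x j) 2 covLaw := by
  refine memLp_mul_of_mask (noiseLaw := noiseLaw) hp ?_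
  have hq2 : (2 : ℝ≥0∞) ≤ ENNReal.ofReal q := by
    rw [show (2 : ℝ≥0∞) = ENNReal.ofReal 2 by simp]
    exact ENNReal.ofReal_le_ofReal hq
  have h1 := (LearningRateCond.memLp hq hα hcond (EuclideanSpace.single j 1)).mono_exponent hq2
  rw [sampleLaw_eq, memLp_map_measure_iff
    (measurable_inner_smul_feature _).aestronglyMeasurable
    (measurable_toSample bstar).aemeasurable] at h1
  have h2 := h1.eval_piLp i
  convert h2 using 2 with s
  simp [feature_apply, toSample, EuclideanSpace.inner_single_right]
  ring

end DropoutSGD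
end

noncomputable section
namespace DropoutSGD

/-! ### Convergence in distribution of the averaged iterates -/

variable {d : ℕ} {α : ℝ}

lemma measurable_sgd (α : ℝ) (b₀ : Vec d) (n : ℕ) :
    Measurable fun ζ : ℕ → Sample d => sgd α ζ b₀ n := by
  induction n with
  | zero => exact measurable_const
  | succ n ih => exact Measurable.step α (f := fun ζ : ℕ → Sample d => ζ n) (by fun_prop) ih

lemma measurable_avgSgd (α : ℝ) (b₀ : Vec d) (n : ℕ) :
    Measurable fun ζ : ℕ → Sample d => avgSgd α ζ b₀ n := by
  have := fun k => measurable_sgd α b₀ (d := d) k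
  unfold avgSgd
  fun_prop

theorem IsContracting.tendstoInDistribution {μ : Measure (Sample d)} [IsProbabilityMeasure μ]
    {A : Vec d →L[ℝ] Vec d} {b : Vec d} {r : ℝ≥0} (h : IsContracting α μ r)
    (hA : IsMeanStep α μ A b) {Ω : Type*} [MeasurableSpace Ω] {P : Measure Ω}
    [IsProbabilityMeasure P] {ζ : Ω → ℕ → Sample d}
    (hζ : HasLaw ζ (Measure.infinitePi fun _ : ℕ => μ) P) (b₀ : Vec d) :
    TendstoInDistribution (fun (n : ℕ) ω => √(n : ℝ) • (avgSgd α (ζ ω) b₀ n - b)) atTop id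
      (fun _ => P) (multivariateGaussian 0 (longRunCov α μ b)) := by
  have hm : ∀ n : ℕ, Measurable fun z : ℕ → Sample d => √(n : ℝ) • (avgSgd α z b₀ n - b) :=
    fun n => by
      have := measurable_avgSgd α b₀ n (d := d)
      fun_prop
  -- Only the law of the inputs matters, so they may be realized as the entries 1, 2, … of the
  -- two-sided sequence; Lévy's continuity theorem then reduces the claim to characteristic
  -- functions.
  have hshift : (twoSided μ).map (fun ξ (k : ℕ) => ξ ((k : ℤ) + 1))
      = Measure.infinitePi fun _ : ℕ => μ :=
    Measure.map_infinitePi_infinitePi_of_inj (P := fun _ : ℤ => μ) (f := fun k : ℕ => (k : ℤ) + 1)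
      fun i j hij => by simpa using hij
  have hsm : Measurable fun (ξ : ℤ → Sample d) (k : ℕ) => ξ ((k : ℤ) + 1) := by fun_prop
  refine ⟨fun n => (hm n).comp_aemeasurable hζ.aemeasurable, aemeasurable_id, ?_⟩
  refine ProbabilityMeasure.tendsto_iff_tendsto_charFun.2 fun t => ?_
  have hlim := h.tendsto_integral_cexp_average hA b₀ t
  simp only [ProbabilityMeasure.coe_mk, Measure.map_id]
  rw [charFun_multivariateGaussian (h.posSemidef_longRunCov hA), inner_zero_right]
  convert hlim using 2 with n
  · have h1 : P.map (fun ω => √(n : ℝ) • (avgSgd α (ζ ω) b₀ n - b))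
        = (twoSided μ).map ((fun z : ℕ → Sample d => √(n : ℝ) • (avgSgd α z b₀ n - b)) ∘
          fun ξ (k : ℕ) => ξ ((k : ℤ) + 1)) := by
      rw [← Measure.map_map (hm n) hsm, hshift, ← hζ.map_eq,
        AEMeasurable.map_map_of_aemeasurable (hm n).aemeasurable hζ.aemeasurable]
      rfl
    rw [h1, charFun_apply, integral_map ((hm n).comp hsm).aemeasurable
      (by fun_prop)]
    simp_rw [Function.comp_apply, avgSgd, sgd_eq_flow]
  · congr 1
    simp
    ring

lemma hasLaw_samples {p : unitInterval} {covLaw : Measure (Vec d)} [IsProbabilityMeasure covLaw]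
    {noiseLaw : Measure ℝ} [IsProbabilityMeasure noiseLaw] {bstar : Vec d}
    {Ω : Type*} [MeasurableSpace Ω] {P : Measure Ω} [IsProbabilityMeasure P]
    {δ : ℕ → Ω → Fin d → ℝ} {x : ℕ → Ω → Vec d} {ε y : ℕ → Ω → ℝ}
    (hind : iIndepFun (fun k ω => (δ k ω, x k ω, ε k ω)) P)
    (hlaw : ∀ k, HasLaw (fun ω => (δ k ω, x k ω, ε k ω)) (inputLaw p covLaw noiseLaw) P)
    (hy : ∀ k ω, y k ω = inner ℝ (x k ω) bstar + ε k ω) :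
    HasLaw (fun ω k => (δ k ω, y k ω, x k ω))
      (Measure.infinitePi fun _ : ℕ => sampleLaw p covLaw noiseLaw bstar) P := by
  have hT : HasLaw (toSample bstar) (sampleLaw p covLaw noiseLaw bstar)
      (inputLaw p covLaw noiseLaw) := ⟨(measurable_toSample bstar).aemeasurable, rfl⟩
  have heq : (fun ω k => (δ k ω, y k ω, x k ω))
      = fun ω k => (toSample bstar ∘ fun ω => (δ k ω, x k ω, ε k ω)) ω := by
    funext ω k
    simp [toSample, hy]
  rw [heq]
  have hk := fun k => hT.comp (hlaw k)
  exact (hind.comp (fun _ => toSample bstar) fun _ => measurable_toSample bstar).hasLaw_infinitePi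
    hk (aemeasurable_pi_iff.2 fun k => (hk k).aemeasurable)

end DropoutSGD
end

/-! ### The main theorem -/

theorem mainTheorem4 {d : ℕ} (p : unitInterval) (hp0 : 0 < p) (hp1 : p < 1)
    (covLaw : Measure (DropoutSGD.Vec d)) [IsProbabilityMeasure covLaw]
    (noiseLaw : Measure ℝ) [IsProbabilityMeasure noiseLaw]
    (hred : ∀ i, 0 < ∫ x, x i ^ 2 ∂covLaw)
    (hnoise : MemLp id 2 noiseLaw) (hmean : ∫ e, e ∂noiseLaw = 0)
    (hvar : variance id noiseLaw = 1)
    (bstar : DropoutSGD.Vec d)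
    (q α : ℝ) (hq : 2 ≤ q) (hα : 0 < α)
    (hcond : DropoutSGD.LearningRateCond p covLaw noiseLaw bstar q α) :
    ∃ b : DropoutSGD.Vec d,
      -- `b` is the unique minimizer of the risk
      (∀ b', b' ≠ b → DropoutSGD.risk (DropoutSGD.sampleLaw p covLaw noiseLaw bstar) b <
        DropoutSGD.risk (DropoutSGD.sampleLaw p covLaw noiseLaw bstar) b') ∧
      -- the limits defining the stationary sequence exist and do not depend on the start
      (∀ (k : ℤ) (c : DropoutSGD.Vec d),
        ∀ᵐ ξ ∂(DropoutSGD.twoSided (DropoutSGD.sampleLaw p covLaw noiseLaw bstar)),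
          Tendsto (fun m : ℕ => DropoutSGD.backward α ξ k m c) atTop
            (𝓝 (DropoutSGD.stat α k ξ))) ∧
      -- each member of that sequence follows the unique stationary distribution
      (∃ π : Measure (DropoutSGD.Vec d), IsProbabilityMeasure π ∧
        (∀ π' : Measure (DropoutSGD.Vec d), IsProbabilityMeasure π' →
          (DropoutSGD.IsStationary α (DropoutSGD.sampleLaw p covLaw noiseLaw bstar) π' ↔
            π' = π)) ∧
        ∀ k : ℤ, HasLaw (DropoutSGD.stat α k) π
          (DropoutSGD.twoSided (DropoutSGD.sampleLaw p covLaw noiseLaw bstar))) ∧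
      -- the long-run covariance matrix is a well-defined covariance matrix
      (∀ k : ℤ, MemLp (DropoutSGD.stat α k) 2
        (DropoutSGD.twoSided (DropoutSGD.sampleLaw p covLaw noiseLaw bstar))) ∧
      Summable (fun k : ℤ =>
        DropoutSGD.autocov α (DropoutSGD.sampleLaw p covLaw noiseLaw bstar) b k) ∧
      (DropoutSGD.longRunCov α
        (DropoutSGD.sampleLaw p covLaw noiseLaw bstar) b).PosSemidef ∧
      -- the quenched central limit theorem
      ∀ {Ω : Type*} [MeasurableSpace Ω] (P : Measure Ω) [IsProbabilityMeasure P]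
        (δ : ℕ → Ω → Fin d → ℝ) (x : ℕ → Ω → DropoutSGD.Vec d) (ε y : ℕ → Ω → ℝ),
        iIndepFun (fun k ω => (δ k ω, x k ω, ε k ω)) P →
        (∀ k, HasLaw (fun ω => (δ k ω, x k ω, ε k ω))
          (DropoutSGD.inputLaw p covLaw noiseLaw) P) →
        (∀ k ω, y k ω = inner ℝ (x k ω) bstar + ε k ω) →
        ∀ b₀ : DropoutSGD.Vec d,
          TendstoInDistribution
            (fun (n : ℕ) ω => √(n : ℝ) •
              (DropoutSGD.avgSgd α (fun k => (δ k ω, y k ω, x k ω)) b₀ n - b))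
            atTop id (fun _ => P)
            (multivariateGaussian 0 (DropoutSGD.longRunCov α
              (DropoutSGD.sampleLaw p covLaw noiseLaw bstar) b)) := by
  have hx : ∀ i, MemLp (fun x : DropoutSGD.Vec d => x i) 2 covLaw :=
    fun i => DropoutSGD.memLp_coord_of_integral_sq_pos (hred i)
  have hxx := fun i j =>
    DropoutSGD.LearningRateCond.memLp_mul hp0 hq hα hcond i j
  -- The least coordinate second moment; in dimension zero any positive number serves.
  obtain ⟨κ, hκ0, hκ⟩ : ∃ κ : ℝ, 0 < κ ∧ ∀ i, κ ≤ ∫ x, x i ^ 2 ∂covLaw := by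
    rcases isEmpty_or_nonempty (Fin d) with hd | hd
    · exact ⟨1, one_pos, fun i => hd.elim i⟩
    · obtain ⟨i, hi⟩ := Finite.exists_min fun i => ∫ x : DropoutSGD.Vec d, x i ^ 2 ∂covLaw
      exact ⟨_, hred i, hi⟩
  set μ := DropoutSGD.sampleLaw p covLaw noiseLaw bstar with hμ
  have hη : 0 < (p : ℝ) * (1 - p) * κ :=
    mul_pos (mul_pos hp0 (sub_pos.2 hp1)) hκ0
  have hpos := DropoutSGD.le_integral_inner_feature_sq (p := p) (noiseLaw := noiseLaw)
    (bstar := bstar) hx hκ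
  have hu := DropoutSGD.memLp_feature (p := p) (noiseLaw := noiseLaw) (bstar := bstar) hx
  have hy := DropoutSGD.memLp_response (p := p) (bstar := bstar) hx hnoise
  have hyu := DropoutSGD.memLp_response_smul_feature (p := p) (bstar := bstar) hx hxx hnoise
  have hq2 : (2 : ℝ≥0∞) ≤ ENNReal.ofReal q := by
    rw [show (2 : ℝ≥0∞) = ENNReal.ofReal 2 by simp]
    exact ENNReal.ofReal_le_ofReal hq
  have huu := fun v => (DropoutSGD.LearningRateCond.memLp hq hα hcond v).mono_exponent hq2
  have hi := fun v => (huu v).integrable one_le_two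
  have hyi := hyu.integrable one_le_two
  obtain ⟨c, hc, hlr⟩ := hcond.exists_lt_one hx hη hpos hq hα
  obtain ⟨r, h⟩ := DropoutSGD.isContracting_of_moments hα hyu huu hu hη hpos hc hlr
  obtain ⟨b, hb⟩ := DropoutSGD.exists_gramOp_eq hi hη hpos (∫ s, s.2.1 • DropoutSGD.feature s ∂μ)
  have hA := DropoutSGD.isMeanStep_meanOp (α := α) hi hyi hb
  refine ⟨b, fun b' hne => DropoutSGD.risk_lt_risk hy hyi hi hu hη hpos hb hne,
    h.ae_tendsto_backward, ⟨DropoutSGD.statLaw α μ, inferInstance, fun π' _ =>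
      ⟨h.eq_statLaw, fun hπ => hπ ▸ h.isStationary_statLaw⟩, DropoutSGD.hasLaw_stat⟩,
    h.memLp_stat, h.summable_autocov hA, h.posSemidef_longRunCov hA, ?_⟩
  intro Ω _ P _ δ x ε y hind hlaw hy b₀
  exact h.tendstoInDistribution hA (DropoutSGD.hasLaw_samples hind hlaw hy) b₀
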